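/- Setting. Fix $n\ge 0$. Let $K=K_n\subset\mathbb R^2$ be the closed polygonal curve which is the $n$-th prefractal approximation of the Koch snowflake built (with outward bumps) on an equilateral triangle of unit side, so that $K_n$ consists of $3\cdot 4^n$ segments of length $3^{-n}$; let $\Omega=\Omega_n$ be the bounded open domain with boundary $K_n$, $ds$ the arc length on $K_n$, and let $L^2(\Omega,m)$ be the real Lebesgue space for $dm=dx+ds$ on $\Omega\cup K_n$. Let $\gamma_0u(x)=\lim_{r\to0}\frac1{|B_r(x)\cap\Omega|}\int_{B_r(x)\cap\Omega}u\,dy$ denote the trace on $K_n$, let $H^1(K_n)$ be the space of continuous functions on $K_n$ that are of class $H^1$ on every open side, and let $V=\{u\in H^1(\Omega):\gamma_0u\in H^1(K_n)\}$, regarded as a subspace of $L^2(\Omega,m)$ through $u\mapsto(u|_\Omega,\gamma_0u)$. Let $b$ be a positive continuous function on $\overline\Omega$, and for $u,v\in V$ put $$E(u,v)=\int_\Omega\nabla u\cdot\nabla v\,dx+\int_{K_n}\nabla_su\,\nabla_sv\,ds+\int_{K_n}b\,u\,v\,ds+\iint_{K_n\times K_n}\frac{(u(x)-u(y))(v(x)-v(y))}{|x-y|^2}\,ds(x)\,ds(y),$$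 where $\nabla_s$ is the tangential derivative. Let $A$ be the operator associated with $E$: $u\in D(A)$ and $Au=w$ if and only if $u\in V$, $w\in L^2(\Omega,m)$ and $E(u,v)=(-w,v)_{L^2(\Omega,m)}$ for all $v\in V$; $D(A)$ carries the graph norm $\|u\|_{D(A)}=\|u\|+\|Au\|$. Then $A$ generates a strongly continuous semigroup $(T_t)_{t\ge0}$ on $L^2(\Omega,m)$, and the following holds. Theorem. Let $T>0$, $\alpha\in(0,1)$, $f\in C^{0,\alpha}([0,T];L^2(\Omega,m))$ and $u_0\in D(A)$, and define $$u(t)=T_tu_0+\int_0^tT_{t-\tau}f(\tau)\,d\tau,\qquad t\in[0,T].$$ Then $u$ is the unique strict solution of $u'(t)=Au(t)+f(t)$, $u(0)=u_0$, i.e. the unique function $u\in C^1([0,T];L^2(\Omega,m))\cap C^0([0,T];D(A))$ such that $u'(t)=Au(t)+f(t)$ for all $t\in[0,T]$ (with one-sided derivatives at the end points) and $u(0)=u_0$. Moreover $$\|u\|_{C^1([0,T];L^2(\Omega,m))}+\|u\|_{C^0([0,T];D(A))}\le C\left(\|u_0\|_{D(A)}+\|f\|_{C^{0,\alpha}([0,T];L^2(\Omega,m))}\right),$$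 where $C>0$ depends only on $T$ and $\alpha$; in particular it is independent of $n$ (and of $b$, $f$, $u_0$). -/

import Mathlib

open Set Filter Topology MeasureTheory
open scoped NNReal ENNReal ContDiff

namespace KochVenttsel

/-! ### Geometry.  The plane `ℝ²` is identified with `ℂ` (as a real inner product space). -/

/-- The four contractions of ratio `1/3` generating the Koch curve over the segment `[0, 1]`. -/
noncomputable def contraction : Fin 4 → ℂ → ℂ
  | 0 => fun z => z / 3
  | 1 => fun z => 1 / 3 + Complex.exp (Complex.I * (Real.pi / 3)) * z / 3
  | 2 => fun z => (1 / 3 + Complex.exp (Complex.I * (Real.pi / 3)) / 3)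
      + Complex.exp (-(Complex.I * (Real.pi / 3))) * z / 3
  | 3 => fun z => 2 / 3 + z / 3

/-- `ψ_{w₁} ∘ ⋯ ∘ ψ_{wₙ}` for a word `w = (w₁, …, wₙ)`. -/
noncomputable def wordMap : (n : ℕ) → (Fin n → Fin 4) → ℂ → ℂ
  | 0, _ => id
  | n + 1, w => contraction (w 0) ∘ wordMap n (Fin.tail w)

/-- The centre of the equilateral triangle with vertices `0`, `1`, `exp (-iπ/3)`, which lies below
the segment `[0, 1]` (the bumps of the Koch curve over `[0, 1]` point upwards, so outwards). -/
noncomputable def center : ℂ := (1 + Complex.exp (-(Complex.I * (Real.pi / 3)))) / 3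

/-- Rotation by the angle `2πj/3` about the centre of the triangle. -/
noncomputable def rotate (j : Fin 3) (z : ℂ) : ℂ :=
  center + Complex.exp (Complex.I * (2 * Real.pi * (j : ℕ) / 3)) * (z - center)

/-- Index set of the `3 * 4 ^ n` sides of the `n`-th prefractal Koch snowflake. -/
abbrev SideIndex (n : ℕ) : Type := Fin 3 × (Fin n → Fin 4)

/-- The length of a side of the `n`-th prefractal. -/
noncomputable def sideLength (n : ℕ) : ℝ := (3 ^ n)⁻¹

/-- Arc length parametrization of a side (to be used on `[0, sideLength n]`). -/
noncomputable def sideParam (n : ℕ) (i : SideIndex n) (s : ℝ) : ℂ :=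
  rotate i.1 (wordMap n i.2 (((3 : ℝ) ^ n * s : ℝ) : ℂ))

/-- The closed polygonal curve `K_n`, union of its (closed) sides. -/
noncomputable def snowflake (n : ℕ) : Set ℂ :=
  ⋃ i : SideIndex n, sideParam n i '' Icc 0 (sideLength n)

/-- The open bounded domain `Ω_n` enclosed by `K_n`: the points off `K_n` whose connected component
in the complement of `K_n` is bounded. -/
noncomputable def domain (n : ℕ) : Set ℂ :=
  {x | x ∉ snowflake n ∧ Bornology.IsBounded (connectedComponentIn (snowflake n)ᶜ x)}

/-- The arc length measure `ds` on `K_n`. -/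
noncomputable def arcMeasure (n : ℕ) : Measure ℂ :=
  ∑ i : SideIndex n, (volume.restrict (Ioo 0 (sideLength n))).map (sideParam n i)

/-- The measure `dm = dx + ds`. -/
noncomputable def mMeasure (n : ℕ) : Measure ℂ :=
  volume.restrict (domain n) + arcMeasure n

/-- The real Hilbert space `L²(Ω, m)`. -/
abbrev L2 (n : ℕ) : Type := Lp ℝ 2 (mMeasure n)

/-! ### Sobolev spaces and traces -/

/-- `G` is an `L²` weak gradient of `u` on the open set `D`. -/
def IsWeakGrad (D : Set ℂ) (u : ℂ → ℝ) (G : ℂ → ℂ) : Prop :=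
  MemLp G 2 (volume.restrict D) ∧
    ∀ φ : ℂ → ℝ, ContDiff ℝ ∞ φ → HasCompactSupport φ → tsupport φ ⊆ D → ∀ e : ℂ,
      ∫ x in D, u x * fderiv ℝ φ x e = -∫ x in D, inner ℝ (G x) e * φ x

/-- Membership in `H¹(D)`. -/
def MemH1 (D : Set ℂ) (u : ℂ → ℝ) : Prop :=
  MemLp u 2 (volume.restrict D) ∧ ∃ G, IsWeakGrad D u G

open Classical in
/-- The weak gradient (defined up to null sets). -/
noncomputable def weakGrad (D : Set ℂ) (u : ℂ → ℝ) : ℂ → ℂ :=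
  if h : ∃ G, IsWeakGrad D u G then h.choose else 0

/-- The trace `γ₀ u (x)`, the limit of the averages of `u` over `B_r(x) ∩ D` as `r → 0`, exists and
equals `c`. -/
def HasTraceAt (D : Set ℂ) (u : ℂ → ℝ) (x : ℂ) (c : ℝ) : Prop :=
  Tendsto (fun r : ℝ => ⨍ y in Metric.ball x r ∩ D, u y) (𝓝[>] 0) (𝓝 c)

/-- `h` is an `L²` weak derivative of `g` on the interval `(0, ℓ)`. -/
def IsWeakDeriv (ℓ : ℝ) (g h : ℝ → ℝ) : Prop :=
  MemLp h 2 (volume.restrict (Ioo 0 ℓ)) ∧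
    ∀ φ : ℝ → ℝ, ContDiff ℝ ∞ φ → HasCompactSupport φ → tsupport φ ⊆ Ioo 0 ℓ →
      ∫ s in Ioo 0 ℓ, g s * deriv φ s = -∫ s in Ioo 0 ℓ, h s * φ s

/-- Membership in `H¹(K_n)`: continuous on `K_n` (after a change on a null set) and of class `H¹` on
each open side. -/
def MemH1Boundary (n : ℕ) (g : ℂ → ℝ) : Prop :=
  ∃ g' : ℂ → ℝ, ContinuousOn g' (snowflake n) ∧ g =ᵐ[arcMeasure n] g' ∧
    ∀ i : SideIndex n, ∃ h, IsWeakDeriv (sideLength n) (g' ∘ sideParam n i) h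

open Classical in
/-- The tangential derivative of `g` along the side `i`, as a function of arc length. -/
noncomputable def tangDeriv (n : ℕ) (g : ℂ → ℝ) (i : SideIndex n) : ℝ → ℝ :=
  if h : ∃ h, IsWeakDeriv (sideLength n) (g ∘ sideParam n i) h then h.choose else 0

/-- The form domain `V(Ω, K_n) = {u ∈ H¹(Ω) : γ₀ u ∈ H¹(K_n)}` as a subset of `L²(Ω, m)`: the values
on `K_n` of the element of `L²(Ω, m)` given by `u` are those of the trace of `u`. -/
def formDomain (n : ℕ) : Set (L2 n) :=
  {u | MemH1 (domain n) u ∧ (∀ᵐ x ∂arcMeasure n, HasTraceAt (domain n) u x (u x)) ∧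
    MemH1Boundary n u}

/-! ### The energy form and its operator -/

/-- The energy form
`E(u,v) = ∫_Ω ∇u·∇v dx + ∫_K ∇ₛu ∇ₛv ds + ∫_K b u v ds + ⟨θ₂ u, v⟩`. -/
noncomputable def energy (n : ℕ) (b u v : ℂ → ℝ) : ℝ :=
  (∫ x in domain n, inner ℝ (weakGrad (domain n) u x) (weakGrad (domain n) v x))
  + (∑ i : SideIndex n, ∫ s in Ioo 0 (sideLength n), tangDeriv n u i s * tangDeriv n v i s)
  + (∫ x, b x * u x * v x ∂arcMeasure n)
  + ∫ p, (u p.1 - u p.2) * (v p.1 - v p.2) / ‖p.1 - p.2‖ ^ 2 ∂(arcMeasure n).prod (arcMeasure n)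

/-- `u ∈ D(A)` and `A u = w`, that is, `E(u, v) = (-w, v)` for all `v ∈ V(Ω, K_n)`. -/
def IsImage (n : ℕ) (b : ℂ → ℝ) (u w : L2 n) : Prop :=
  u ∈ formDomain n ∧ ∀ v ∈ formDomain n, energy n b u v = inner ℝ (-w) v

/-- The domain `D(A)`. -/
def opDomain (n : ℕ) (b : ℂ → ℝ) : Set (L2 n) := {u | ∃ w, IsImage n b u w}

open Classical in
/-- The operator `A` associated with the energy form (extended by `0` outside `D(A)`). -/
noncomputable def opA (n : ℕ) (b : ℂ → ℝ) (u : L2 n) : L2 n :=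
  if h : ∃ w, IsImage n b u w then h.choose else 0

/-! ### Semigroups and the Cauchy problem -/

/-- `S` is (on `[0, ∞)`) a strongly continuous semigroup whose infinitesimal generator is the
operator `A` with domain `D`. -/
structure IsC0SemigroupGeneratedBy {H : Type*} [NormedAddCommGroup H] [NormedSpace ℝ H]
    (D : Set H) (A : H → H) (S : ℝ → H →L[ℝ] H) : Prop where
  zero : S 0 = ContinuousLinearMap.id ℝ H
  add : ∀ s t, 0 ≤ s → 0 ≤ t → S (s + t) = (S s).comp (S t)
  continuous : ∀ x, ContinuousOn (fun t => S t x) (Ici 0)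
  generator : ∀ x y,
    Tendsto (fun t : ℝ => t⁻¹ • (S t x - x)) (𝓝[>] 0) (𝓝 y) ↔ x ∈ D ∧ A x = y

open Classical in
/-- The semigroup `T_t` generated by `A`. -/
noncomputable def semigroup (n : ℕ) (b : ℂ → ℝ) : ℝ → L2 n →L[ℝ] L2 n :=
  if h : ∃ S, IsC0SemigroupGeneratedBy (opDomain n b) (opA n b) S then h.choose else 0

/-- The mild solution `u(t) = T_t u₀ + ∫₀ᵗ T_{t-τ} f(τ) dτ`. -/
noncomputable def mildSolution (n : ℕ) (b : ℂ → ℝ) (u₀ : L2 n) (f : ℝ → L2 n) (t : ℝ) : L2 n :=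
  semigroup n b t u₀ + ∫ τ in (0 : ℝ)..t, semigroup n b (t - τ) (f τ)

/-- `u ∈ C¹([0,T]; L²(Ω,m)) ∩ C⁰([0,T]; D(A))`, `u' = A u + f` on `[0,T]` and `u(0) = u₀`. -/
structure IsStrictSolution (n : ℕ) (b : ℂ → ℝ) (T : ℝ) (f : ℝ → L2 n) (u₀ : L2 n)
    (u : ℝ → L2 n) : Prop where
  contDiffOn : ContDiffOn ℝ 1 u (Icc 0 T)
  mem_domain : ∀ t ∈ Icc 0 T, u t ∈ opDomain n b
  continuousOn_op : ContinuousOn (fun t => opA n b (u t)) (Icc 0 T)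
  equation : ∀ t ∈ Icc 0 T, derivWithin u (Icc 0 T) t = opA n b (u t) + f t
  initial : u 0 = u₀

/-- The supremum norm on `[0,T]`. -/
noncomputable def supNorm {H : Type*} [NormedAddCommGroup H] (T : ℝ) (g : ℝ → H) : ℝ :=
  ⨆ t : Icc (0 : ℝ) T, ‖g t‖

/-- The norm of `C^{0,α}([0,T]; H)`. -/
noncomputable def holderNorm {H : Type*} [NormedAddCommGroup H] (T α : ℝ) (g : ℝ → H) : ℝ :=
  supNorm T g + ⨆ p : Icc (0 : ℝ) T × Icc (0 : ℝ) T,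
    ‖g p.1 - g p.2‖ / |(p.1 : ℝ) - (p.2 : ℝ)| ^ α

/-- The norm of `C¹([0,T]; H)`. -/
noncomputable def c1Norm {H : Type*} [NormedAddCommGroup H] [NormedSpace ℝ H] (T : ℝ)
    (g : ℝ → H) : ℝ :=
  supNorm T g + supNorm T (derivWithin g (Icc 0 T))

/-- The graph norm of `D(A)`. -/
noncomputable def graphNorm (n : ℕ) (b : ℂ → ℝ) (u : L2 n) : ℝ := ‖u‖ + ‖opA n b u‖

/-- The norm of `C⁰([0,T]; D(A))`. -/
noncomputable def c0GraphNorm (n : ℕ) (b : ℂ → ℝ) (T : ℝ) (u : ℝ → L2 n) : ℝ :=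
  ⨆ t : Icc (0 : ℝ) T, graphNorm n b (u t)

end KochVenttsel

open KochVenttsel

/-! The energy form is nonnegative, densely defined and closed, so `A` is a nonpositive self-adjoint
operator on `L²(Ω, m)`. For every such operator the semigroup obeys `‖T_t‖ ≤ 1` and `‖A T_t‖ ≤ 1/t`,
with constants that do not see the operator. The classical argument for analytic semigroups with
Hölder data uses nothing else, and this is why the final constant depends on `T` and `α` only, not
on `n` or `b`.

Abstract half. The operator enters through `R = (1 - A)⁻¹` (`IsResolvent`, `IsGen`), which turns
every statement about the unbounded `A` into one about a bounded `R`. Commuting bounded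
approximations of `A` generate exponentials for which both bounds follow from one Lyapunov
functional (`expOp_energy`); the limit is `IsResolvent.exists_semigroup`. In the Duhamel integral,
`f(t - s)` is split into `f(t - s) - f(t)`, where the Hölder bound turns the singularity `1/s` into
the integrable `s^(α-1)`, and the constant `f(t)`, where `A` integrates exactly
(`IsAnalyticSemigroup.isGen_duhamel`). Regularity, uniqueness and the estimate are collected in
`IsResolvent.strict_solution`.

Concrete half. A closed, densely defined map from `u` to the data entering the energy gives `R` by
orthogonal projection onto its graph (`exists_resolvent_of_closed`). Closedness is
`IsLift.of_tendsto`, whose delicate clause is that the pointwise trace survives limits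
(`hasTraceAt_of_tendsto`). Almost every boundary point has a neighbourhood in which the curve is a
straight line (`ae_isGoodPoint`) and in which the inner side belongs to `Ω`. The latter comes from
an explicit filled region (`frontier_filled_subset`), with no appeal to the Jordan curve theorem.
Near such a point the trace is a fixed linear expression in averages of `u` and of its normal
derivative, hence passes to the limit. The nonlocal term is finite on all of `V` (`memLp_quotient`),
so the graph really lies over `V`. Density comes from test functions of the plane. -/

namespace KochVenttsel
open scoped ComplexConjugate
set_option linter.unusedSectionVars false

/-! ### Exponentials of bounded symmetric nonpositive operators -/

section BoundedGenerator

variable {H : Type*} [NormedAddCommGroup H] [InnerProductSpace ℝ H] [CompleteSpace H]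

/-- The group generated by a bounded operator. -/
noncomputable def expOp (Q : H →L[ℝ] H) (t : ℝ) : H →L[ℝ] H := NormedSpace.exp (t • Q)

lemma expOp_zero (Q : H →L[ℝ] H) : expOp Q 0 = 1 := by simp [expOp, NormedSpace.exp_zero]

lemma expOp_add (Q : H →L[ℝ] H) (s t : ℝ) : expOp Q (s + t) = expOp Q s * expOp Q t := by
  let _ : NormedAlgebra ℚ (H →L[ℝ] H) := NormedAlgebra.restrictScalars ℚ ℝ _
  rw [expOp, expOp, expOp, add_smul]
  exact NormedSpace.exp_add_of_commute (((Commute.refl Q).smul_left s).smul_right t)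

lemma commute_expOp {P Q : H →L[ℝ] H} (h : Commute P Q) (t : ℝ) : Commute P (expOp Q t) :=
  (h.smul_right t).exp_right

lemma expOp_comm_apply {P Q : H →L[ℝ] H} (h : Commute P Q) (t : ℝ) (x : H) :
    P (expOp Q t x) = expOp Q t (P x) := by
  have := congrArg (fun L : H →L[ℝ] H => L x) (commute_expOp h t).eq
  simpa using this

lemma hasDerivAt_expOp (Q : H →L[ℝ] H) (t : ℝ) : HasDerivAt (expOp Q) (expOp Q t * Q) t :=
  hasDerivAt_exp_smul_const (𝕂 := ℝ) Q t

lemma hasDerivAt_expOp_apply (Q : H →L[ℝ] H) (x : H) (t : ℝ) :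
    HasDerivAt (fun s => expOp Q s x) (Q (expOp Q t x)) t := by
  have h := (hasDerivAt_expOp Q t).clm_apply (hasDerivAt_const t x)
  simpa [expOp_comm_apply (Commute.refl Q)] using h

/-- Bounds for the semigroup generated by a bounded symmetric nonpositive operator. -/
lemma expOp_energy {Q : H →L[ℝ] H} (hs : ∀ x y, inner ℝ (Q x) y = inner ℝ x (Q y))
    (hn : ∀ x, inner ℝ (Q x) x ≤ 0) (x : H) {t : ℝ} (ht : 0 ≤ t) :
    ‖expOp Q t x‖ ^ 2 - 2 * t * inner ℝ (Q (expOp Q t x)) (expOp Q t x)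
      + 2 * t ^ 2 * ‖Q (expOp Q t x)‖ ^ 2 ≤ ‖x‖ ^ 2 := by
  set y : ℝ → H := fun s => expOp Q s x with hy
  have hd : ∀ s, HasDerivAt y (Q (y s)) s := fun s => hasDerivAt_expOp_apply Q x s
  have hd' : ∀ s, HasDerivAt (fun s => Q (y s)) (Q (Q (y s))) s := fun s =>
    Q.hasFDerivAt.comp_hasDerivAt s (hd s)
  -- Lyapunov functional with weights `1`, `2s`, `2s²`: by symmetry of `Q` the lower order terms of
  -- the derivative cancel in pairs, and only `4s² ⟨Q(Qy), Qy⟩ ≤ 0` remains.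
  set L : ℝ → ℝ := fun s => ‖y s‖ ^ 2 - 2 * s * inner ℝ (Q (y s)) (y s) + 2 * s ^ 2 * ‖Q (y s)‖ ^ 2
  have hL : ∀ s, HasDerivAt L (4 * s ^ 2 * inner ℝ (Q (Q (y s))) (Q (y s))) s := by
    intro s
    have h1 := (hd s).norm_sq
    have h2 := (hd' s).inner ℝ (hd s)
    have h3 := (hd' s).norm_sq
    have h4 := (h1.sub (((hasDerivAt_id s).const_mul 2).mul h2)).add
      ((((hasDerivAt_id s).pow 2).const_mul 2).mul h3)
    refine HasDerivAt.congr_deriv (f := L) h4 ?_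
    rw [hs (Q (y s)) (y s), real_inner_self_eq_norm_sq, real_inner_comm (Q (y s)) (y s),
      real_inner_comm (Q (Q (y s))) (Q (y s))]
    simp only [Pi.pow_apply, id]
    push_cast
    ring
  have hanti : AntitoneOn L (Ici 0) := by
    refine antitoneOn_of_deriv_nonpos (convex_Ici 0)
      (fun s _ => (hL s).continuousAt.continuousWithinAt)
      (fun s _ => (hL s).differentiableAt.differentiableWithinAt) fun s _ => ?_
    rw [(hL s).deriv]
    exact mul_nonpos_of_nonneg_of_nonpos (by positivity) (hn _)
  have := hanti (mem_Ici.2 le_rfl) (mem_Ici.2 ht) ht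
  simpa [L, hy, expOp_zero] using this

/-- In `expOp_energy` the terms other than `‖expOp Q t x‖ ^ 2` are nonnegative and may be dropped.
-/
lemma norm_expOp_le {Q : H →L[ℝ] H} (hs : ∀ x y, inner ℝ (Q x) y = inner ℝ x (Q y))
    (hn : ∀ x, inner ℝ (Q x) x ≤ 0) (x : H) {t : ℝ} (ht : 0 ≤ t) : ‖expOp Q t x‖ ≤ ‖x‖ := by
  have h := expOp_energy hs hn x ht
  have h2 := mul_nonneg ht (neg_nonneg.2 (hn (expOp Q t x)))
  have h3 := sq_nonneg (t * ‖Q (expOp Q t x)‖)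
  exact abs_le_of_sq_le_sq' (by nlinarith) (norm_nonneg _) |>.2

/-- The smoothing estimate: this time the last term of `expOp_energy` is kept. The constant does not
involve `‖Q‖`, so the bound survives the passage to an unbounded generator. -/
lemma norm_gen_expOp_le {Q : H →L[ℝ] H} (hs : ∀ x y, inner ℝ (Q x) y = inner ℝ x (Q y))
    (hn : ∀ x, inner ℝ (Q x) x ≤ 0) (x : H) {t : ℝ} (ht : 0 < t) :
    ‖Q (expOp Q t x)‖ ≤ t⁻¹ * ‖x‖ := by
  have h := expOp_energy hs hn x ht.le
  have h2 := mul_nonneg ht.le (neg_nonneg.2 (hn (expOp Q t x)))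
  rw [inv_mul_eq_div, le_div_iff₀ ht]
  have h3 := sq_nonneg (t * ‖Q (expOp Q t x)‖)
  have h4 := sq_nonneg ‖expOp Q t x‖
  exact abs_le_of_sq_le_sq' (by nlinarith) (norm_nonneg _) |>.2

/-- The path `exp((t - s)Q) exp(sP) x` joins the two exponentials, and commutativity makes its
velocity a contraction applied to `P x - Q x`. Convergence of the generators on a vector therefore
gives convergence of the exponentials on it. -/
lemma norm_expOp_sub_le {Q P : H →L[ℝ] H} (hs : ∀ x y, inner ℝ (Q x) y = inner ℝ x (Q y))
    (hn : ∀ x, inner ℝ (Q x) x ≤ 0) (hs' : ∀ x y, inner ℝ (P x) y = inner ℝ x (P y))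
    (hn' : ∀ x, inner ℝ (P x) x ≤ 0) (hc : Commute P Q) (x : H) {t : ℝ} (ht : 0 ≤ t) :
    ‖expOp P t x - expOp Q t x‖ ≤ t * ‖P x - Q x‖ := by
  set F : ℝ → H := fun s => expOp Q (t - s) (expOp P s x)
  have hF : ∀ s, HasDerivAt F (expOp Q (t - s) (expOp P s (P x - Q x))) s := by
    intro s
    have h1 : HasDerivAt (fun s => expOp Q (t - s)) (-(expOp Q (t - s) * Q)) s := by
      have := (hasDerivAt_expOp Q (t - s)).scomp s ((hasDerivAt_id s).const_sub t)
      rw [neg_one_smul] at this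
      exact this
    have h := h1.clm_apply (hasDerivAt_expOp_apply P x s)
    refine h.congr_deriv ?_
    simp only [neg_apply, mul_apply_eq_comp, map_sub]
    rw [expOp_comm_apply hc.symm, expOp_comm_apply (Commute.refl P)]
    abel
  have := Convex.norm_image_sub_le_of_norm_hasDerivWithin_le (f := F) (s := Icc 0 t) (x := 0)
    (y := t) (C := ‖P x - Q x‖) (fun s hs => (hF s).hasDerivWithinAt) (fun s hst => ?_)
    (convex_Icc 0 t) ⟨le_rfl, ht⟩ ⟨ht, le_rfl⟩
  · simpa [F, expOp_zero, abs_of_nonneg ht, mul_comm] using this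
  · exact (norm_expOp_le hs hn _ (by linarith [hst.2])).trans (norm_expOp_le hs' hn' _ hst.1)

/-- Quantitative differentiability at `0`. Comparing `Q x` with an auxiliary `z` replaces the second
order quantity `Q (Q x)` by `Q z`, which can be controlled uniformly along the approximation when
`z` is taken in the range of the resolvent. -/
lemma norm_expOp_sub_sub_le {Q : H →L[ℝ] H} (hs : ∀ x y, inner ℝ (Q x) y = inner ℝ x (Q y))
    (hn : ∀ x, inner ℝ (Q x) x ≤ 0) (x z : H) {t : ℝ} (ht : 0 ≤ t) :
    ‖expOp Q t x - x - t • Q x‖ ≤ t * (t * ‖Q z‖ + 2 * ‖Q x - z‖) := by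
  have h0 : ∀ w s, 0 ≤ s → ‖expOp Q s w - w‖ ≤ s * ‖Q w‖ := by
    intro w s hs0
    have := Convex.norm_image_sub_le_of_norm_hasDerivWithin_le (f := fun s => expOp Q s w)
      (f' := fun s => Q (expOp Q s w)) (s := Icc 0 s) (x := 0)
      (y := s) (C := ‖Q w‖) (fun s _ => (hasDerivAt_expOp_apply Q w s).hasDerivWithinAt)
      (fun s hst => ?_) (convex_Icc 0 s) ⟨le_rfl, hs0⟩ ⟨hs0, le_rfl⟩
    · simpa [expOp_zero, abs_of_nonneg hs0, mul_comm] using this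
    · rw [expOp_comm_apply (Commute.refl Q)]
      exact norm_expOp_le hs hn _ hst.1
  have := Convex.norm_image_sub_le_of_norm_hasDerivWithin_le (f := fun s => expOp Q s x - s • Q x)
      (f' := fun s => Q (expOp Q s x) - Q x) (s := Icc 0 t) (x := 0)
      (y := t) (C := t * ‖Q z‖ + 2 * ‖Q x - z‖)
      (fun s _ => ?_)
      (fun s hst => ?_) (convex_Icc 0 t) ⟨le_rfl, ht⟩ ⟨ht, le_rfl⟩
  · have e : expOp Q t x - x - t • Q x = expOp Q t x - t • Q x - x := by abel
    rw [e]
    simpa [expOp_zero, abs_of_nonneg ht, mul_comm] using this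
  · have := ((hasDerivAt_expOp_apply Q x s).sub
      ((hasDerivAt_id s).smul_const (Q x))).hasDerivWithinAt (s := Icc 0 t)
    rw [one_smul] at this
    exact this
  · rw [expOp_comm_apply (Commute.refl Q)]
    have e : expOp Q s (Q x) - Q x = expOp Q s (Q x - z) + (expOp Q s z - z) - (Q x - z) := by
      rw [map_sub]; abel
    rw [e]
    have h1 := norm_expOp_le hs hn (Q x - z) hst.1
    have h2 := h0 z s hst.1
    have h3 : s * ‖Q z‖ ≤ t * ‖Q z‖ := by gcongr; exact hst.2
    calc _ ≤ ‖expOp Q s (Q x - z) + (expOp Q s z - z)‖ + ‖Q x - z‖ := norm_sub_le _ _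
      _ ≤ ‖expOp Q s (Q x - z)‖ + ‖expOp Q s z - z‖ + ‖Q x - z‖ := by
        gcongr; exact norm_add_le _ _
      _ ≤ _ := by linarith

end BoundedGenerator

/-! ### From the resolvent to the analytic semigroup -/

section Resolvent

variable {H : Type*} [NormedAddCommGroup H] [InnerProductSpace ℝ H] [CompleteSpace H]

/-- `R = (1 - A)⁻¹` for a nonpositive self-adjoint operator `A`. -/
structure IsResolvent (R : H →L[ℝ] H) : Prop where
  symm : ∀ x y, inner ℝ (R x) y = inner ℝ x (R y)
  norm_sq_le : ∀ x, ‖R x‖ ^ 2 ≤ inner ℝ (R x) x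
  dense : DenseRange R

/-- `u ∈ D(A)` and `A u = w`, for the operator `A = 1 - R⁻¹`. -/
def IsGen (R : H →L[ℝ] H) (u w : H) : Prop := u = R (u - w)

/-- `S t = exp (t A)` and `B t = A exp (t A)`, where `A = 1 - R⁻¹`. -/
structure IsAnalyticSemigroup (R : H →L[ℝ] H) (S B : ℝ → H →L[ℝ] H) : Prop where
  of_nonpos : ∀ t ≤ 0, ∀ x, S t x = x
  add : ∀ s t, 0 ≤ s → 0 ≤ t → ∀ x, S (s + t) x = S s (S t x)
  norm_le : ∀ t x, ‖S t x‖ ≤ ‖x‖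
  comm : ∀ t x, S t (R x) = R (S t x)
  cont : ∀ x, Continuous fun t => S t x
  smooth : ∀ t, 0 < t → ∀ x, IsGen R (S t x) (B t x)
  norm_le' : ∀ t, 0 < t → ∀ x, ‖B t x‖ ≤ t⁻¹ * ‖x‖
  deriv : ∀ x y, IsGen R x y → HasDerivWithinAt (fun t => S t x) y (Ici 0) 0

lemma IsResolvent.norm_le {R : H →L[ℝ] H} (hR : IsResolvent R) (x : H) : ‖R x‖ ≤ ‖x‖ := by
  have h1 := hR.norm_sq_le x
  have h2 := real_inner_le_norm (R x) x
  by_contra h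
  push Not at h
  nlinarith [norm_nonneg x, norm_nonneg (R x)]

lemma IsResolvent.inner_nonneg {R : H →L[ℝ] H} (hR : IsResolvent R) (x : H) :
    0 ≤ inner ℝ (R x) x := (sq_nonneg _).trans (hR.norm_sq_le x)

/-- By symmetry the kernel of `R` is orthogonal to its range, which is dense. This is what makes `A
= 1 - R⁻¹` single-valued. -/
lemma IsResolvent.injective {R : H →L[ℝ] H} (hR : IsResolvent R) {x : H} (hx : R x = 0) :
    x = 0 := by
  have h : ∀ y, inner ℝ x (R y) = 0 := fun y => by rw [← hR.symm, hx, inner_zero_left]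
  have h2 : ∀ y, inner ℝ x y = 0 := fun y => by
    refine hR.dense.induction_on (p := fun y => inner ℝ x y = 0) y ?_ h
    exact isClosed_eq (by fun_prop) continuous_const
  exact inner_self_eq_zero.1 (h2 x)

lemma IsResolvent.gen_unique {R : H →L[ℝ] H} (hR : IsResolvent R) {u w w' : H}
    (h : IsGen R u w) (h' : IsGen R u w') : w = w' := by
  have : R (w - w') = 0 := by
    have e : R (u - w) = R (u - w') := h.symm.trans h'
    rw [map_sub, map_sub, sub_right_inj] at e
    rw [map_sub, e, sub_self]
  exact sub_eq_zero.1 (hR.injective this)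

lemma isGen_range (R : H →L[ℝ] H) (y : H) : IsGen R (R y) (R y - y) := by simp [IsGen]

lemma IsGen.sub {R : H →L[ℝ] H} {u w u' w' : H} (h : IsGen R u w) (h' : IsGen R u' w') :
    IsGen R (u - u') (w - w') := by
  unfold IsGen at *
  have e : u - u' - (w - w') = (u - w) - (u' - w') := by abel
  rw [e, map_sub, ← h, ← h']

lemma IsGen.add {R : H →L[ℝ] H} {u w u' w' : H} (h : IsGen R u w) (h' : IsGen R u' w') :
    IsGen R (u + u') (w + w') := by
  unfold IsGen at *
  have e : u + u' - (w + w') = (u - w) + (u' - w') := by abel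
  rw [e, map_add, ← h, ← h']

/-- Dissipativity of `A`: with `u = R (u - w)`, the inequality for `R` reads `‖u‖² ≤ ⟨u, u - w⟩`. -/
lemma IsResolvent.gen_inner_nonpos {R : H →L[ℝ] H} (hR : IsResolvent R) {u w : H}
    (h : IsGen R u w) : inner ℝ u w ≤ 0 := by
  have h1 := hR.norm_sq_le (u - w)
  rw [← h, inner_sub_right, real_inner_self_eq_norm_sq] at h1
  linarith

/-- Bounded operators which converge on a dense set converge everywhere. -/
lemma exists_limit_of_denseRange {R : H →L[ℝ] H} (hd : DenseRange R) (L : ℕ → H →L[ℝ] H) (C : ℝ)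
    (hb : ∀ k x, ‖L k x‖ ≤ C * ‖x‖)
    (hc : ∀ y, ∃ z, Tendsto (fun k => L k (R y)) atTop (𝓝 z)) :
    ∃ L' : H →L[ℝ] H, (∀ x, Tendsto (fun k => L k x) atTop (𝓝 (L' x))) ∧
      ∀ x, ‖L' x‖ ≤ C * ‖x‖ := by
  have hC : ∀ x, ∃ z, Tendsto (fun k => L k x) atTop (𝓝 z) := by
    intro x
    refine cauchySeq_tendsto_of_complete (Metric.cauchySeq_iff.2 fun ε hε => ?_)
    obtain ⟨_, ⟨y, rfl⟩, hy⟩ := Metric.mem_closure_iff.1 (hd x) (ε / (4 * (|C| + 1))) (by positivity)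
    obtain ⟨z, hz⟩ := hc y
    obtain ⟨N, hN⟩ := Metric.cauchySeq_iff.1 hz.cauchySeq (ε / 4) (by positivity)
    have hk : ∀ k, dist (L k x) (L k (R y)) ≤ ε / 4 := by
      intro k
      rw [dist_eq_norm, ← map_sub]
      refine (hb k _).trans ?_
      rw [dist_eq_norm] at hy
      rw [lt_div_iff₀ (by positivity)] at hy
      have h1 : C * ‖x - R y‖ ≤ (|C| + 1) * ‖x - R y‖ := by
        gcongr; linarith [le_abs_self C]
      linarith
    refine ⟨N, fun m hm n hn => ?_⟩
    calc dist (L m x) (L n x) ≤ dist (L m x) (L m (R y)) + dist (L m (R y)) (L n (R y))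
          + dist (L n (R y)) (L n x) := dist_triangle4 _ _ _ _
      _ < ε := by
        have := hN m hm n hn
        have h1 := hk m
        have h2 := hk n
        rw [dist_comm] at h2
        linarith
  choose f hf using hC
  refine ⟨continuousLinearMapOfTendsto L (f := f) (tendsto_pi_nhds.2 hf), fun x => hf x,
    fun x => ?_⟩
  exact le_of_tendsto (hf x).norm (Eventually.of_forall fun k => hb k x)

/-- Bounded approximations of the operator `A = 1 - R⁻¹`. -/
lemma IsResolvent.exists_approx {R : H →L[ℝ] H} (hR : IsResolvent R) :
    ∃ Q : ℕ → H →L[ℝ] H, (∀ k x y, inner ℝ (Q k x) y = inner ℝ x (Q k y)) ∧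
      (∀ k x, inner ℝ (Q k x) x ≤ 0) ∧ (∀ k l, Commute (Q k) (Q l)) ∧ (∀ k, Commute R (Q k)) ∧
      ∀ x y, IsGen R x y → Tendsto (fun k => Q k x) atTop (𝓝 y) := by
  set ε : ℕ → ℝ := fun k => 1 / ((k : ℝ) + 1) with hε
  have hε0 : ∀ k, 0 < ε k := fun k => by positivity
  -- Formally `A = (R - 1) R⁻¹`. The inverse is regularized to `(R + ε)⁻¹`, which exists because `R
  -- + ε` is coercive, and `Q = (R - 1)(R + ε)⁻¹` is then bounded and commutes with `R`.
  set T : ℕ → H →L[ℝ] H := fun k => R + ε k • 1 with hT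
  have hTx : ∀ k x, T k x = R x + ε k • x := fun k x => by simp [hT]
  have hTi : ∀ k x, ε k * ‖x‖ ^ 2 ≤ inner ℝ (T k x) x := fun k x => by
    rw [hTx, inner_add_left, real_inner_smul_left, real_inner_self_eq_norm_sq]
    linarith [hR.inner_nonneg x]
  have hunit : ∀ k, IsUnit (T k) := by
    intro k
    refine ContinuousLinearMap.isUnit_of_forall_le_norm_inner_map (T k) (c := ⟨ε k, (hε0 k).le⟩)
      (hε0 k) fun x => ?_
    rw [mul_comm]
    exact (hTi k x).trans (le_abs_self _)
  choose U hU using hunit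
  set P : ℕ → H →L[ℝ] H := fun k => ↑(U k)⁻¹ with hP
  have hTP : ∀ k x, T k (P k x) = x := fun k x => by
    have : (U k : H →L[ℝ] H) * ↑(U k)⁻¹ = 1 := Units.mul_inv _
    rw [hU] at this
    simpa using congrArg (fun L : H →L[ℝ] H => L x) this
  have hPT : ∀ k x, P k (T k x) = x := fun k x => by
    have : ↑(U k)⁻¹ * (U k : H →L[ℝ] H) = 1 := Units.inv_mul _
    rw [hU] at this
    simpa using congrArg (fun L : H →L[ℝ] H => L x) this
  have hcT : ∀ k, Commute R (T k) := fun k =>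
    (Commute.refl R).add_right ((Commute.one_right R).smul_right _)
  have hcTT : ∀ k l, Commute (T l) (T k) := fun k l =>
    (hcT k).add_left ((Commute.one_left _).smul_left _)
  have hcP : ∀ k, Commute R (P k) := fun k => by
    have : Commute R (U k : H →L[ℝ] H) := by rw [hU]; exact hcT k
    exact this.units_inv_right
  have hcPP : ∀ k l, Commute (P k) (P l) := fun k l => by
    have : Commute (U k : H →L[ℝ] H) (U l : H →L[ℝ] H) := by rw [hU, hU]; exact hcTT l k
    exact this.units_inv_right.units_inv_left
  have hcRP : ∀ k x, R (P k x) = P k (R x) := fun k x => by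
    simpa using congrArg (fun L : H →L[ℝ] H => L x) (hcP k).eq
  have hcQP : ∀ l, Commute (R - 1) (P l) := fun l =>
    (hcP l).sub_left (Commute.one_left _)
  have hn : ∀ k x, ‖ε k • P k x‖ ≤ 1 * ‖x‖ := by
    intro k x
    have h1 := hTi k (P k x)
    rw [hTP] at h1
    have h2 := real_inner_le_norm x (P k x)
    rw [norm_smul, Real.norm_of_nonneg (hε0 k).le, one_mul]
    rcases eq_or_lt_of_le (norm_nonneg (P k x)) with h | h
    · rw [← h, mul_zero]; exact norm_nonneg _
    · nlinarith [hε0 k]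
  have hlim : Tendsto ε atTop (𝓝 0) := tendsto_one_div_add_atTop_nhds_zero_nat
  have hPR : ∀ k z, P k (R z) = z - ε k • P k z := fun k z => by
    have := hPT k z
    rw [hTx, map_add, map_smul] at this
    exact eq_sub_of_add_eq this
  -- The operators `ε (R + ε)⁻¹` are contractions. On `R z` they equal `ε (z - ε (R + ε)⁻¹ z)`, of
  -- norm at most `2 ε ‖z‖`, so they tend to `0` strongly by density of the range.
  have hzero : ∀ x, Tendsto (fun k => ε k • P k x) atTop (𝓝 0) := by
    have hR0 : ∀ z, Tendsto (fun k => (ε k • P k) (R z)) atTop (𝓝 0) := by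
      intro z
      rw [tendsto_zero_iff_norm_tendsto_zero]
      refine squeeze_zero (g := fun k => ε k * (2 * ‖z‖)) (fun _ => norm_nonneg _) (fun k => ?_) ?_
      · simp only [smul_apply, hPR]
        rw [norm_smul, Real.norm_of_nonneg (hε0 k).le]
        refine mul_le_mul_of_nonneg_left ((norm_sub_le _ _).trans ?_) (hε0 k).le
        linarith [hn k z]
      · simpa using hlim.mul_const (2 * ‖z‖)
    obtain ⟨L', hL', -⟩ := exists_limit_of_denseRange hR.dense (fun k => ε k • P k) 1 hn
      fun y => ⟨0, hR0 y⟩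
    intro x
    have : L' x = 0 := by
      refine hR.dense.induction_on (p := fun x => L' x = 0) x
        (isClosed_eq L'.continuous continuous_const) fun z => ?_
      exact tendsto_nhds_unique (hL' (R z)) (hR0 z)
    simpa [this] using hL' x
  refine ⟨fun k => (R - 1) * P k, fun k x y => ?_, fun k x => ?_, fun k l => ?_, fun k => ?_,
    fun x y hxy => ?_⟩
  -- Writing both vectors in the range of `R + ε` removes the inverse and leaves identities between
  -- inner products involving `R` only.
  · obtain ⟨a, rfl⟩ : ∃ a, x = T k a := ⟨P k x, (hTP k x).symm⟩
    obtain ⟨b, rfl⟩ : ∃ b, y = T k b := ⟨P k y, (hTP k y).symm⟩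
    simp only [mul_apply_eq_comp, hPT]
    simp only [hTx, sub_apply, one_apply_eq_self, map_smul,
      inner_add_left, inner_add_right, inner_sub_left, inner_sub_right, real_inner_smul_left,
      real_inner_smul_right, hR.symm]
    ring
  · obtain ⟨a, rfl⟩ : ∃ a, x = T k a := ⟨P k x, (hTP k x).symm⟩
    simp only [mul_apply_eq_comp, hPT]
    simp only [hTx, sub_apply, one_apply_eq_self, inner_add_right, inner_sub_left, real_inner_smul_right, real_inner_self_eq_norm_sq]
    have h1 := hR.norm_sq_le a
    have h2 := real_inner_le_norm (R a) a
    have h3 := hR.norm_le a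
    have h4 : inner ℝ a (R a) = inner ℝ (R a) a := real_inner_comm _ _
    have h5 : inner ℝ (R a) a ≤ ‖a‖ ^ 2 := by nlinarith [norm_nonneg a]
    nlinarith [hε0 k]
  · exact ((Commute.refl _).mul_right (hcQP l)).mul_left
      ((hcQP k).symm.mul_right (hcPP k l))
  · exact ((Commute.refl R).sub_right (Commute.one_right R)).mul_right (hcP k)
  -- Since `x = R (x - y)`, the regularized inverse returns `x - y` up to the vanishing term of
  -- `hzero`, and `(R - 1)(x - y) = y`.
  · have h1 : ∀ k, ((R - 1) * P k) x = (R - 1) (x - y) - (R - 1) (ε k • P k (x - y)) := by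
      intro k
      conv_lhs => rw [hxy]
      rw [mul_apply_eq_comp, hPR, map_sub]
    simp only [h1]
    have h2 : Tendsto (fun k => (R - 1) (ε k • P k (x - y))) atTop (𝓝 0) := by
      have := ((R - 1).continuous.tendsto 0).comp (hzero (x - y))
      rwa [map_zero] at this
    have h3 : (R - 1) (x - y) = y := by
      rw [sub_apply, one_apply_eq_self, ← hxy]; abel
    simpa [h3] using (tendsto_const_nhds (x := y)).sub h2

/-- A nonpositive self-adjoint operator generates an analytic semigroup. -/
theorem IsResolvent.exists_semigroup {R : H →L[ℝ] H} (hR : IsResolvent R) :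
    ∃ S B : ℝ → H →L[ℝ] H, IsAnalyticSemigroup R S B := by
  obtain ⟨Q, hs, hn, hQQ, hRQ, hQ⟩ := hR.exists_approx
  have hQR : ∀ y, Tendsto (fun k => Q k (R y)) atTop (𝓝 (R y - y)) := fun y =>
    hQ _ _ (isGen_range R y)
  -- Truncating time by `max t 0` makes the family total on `ℝ`, equal to the identity for negative
  -- times. Later this gives continuity in `t` on the whole line.
  have hS : ∀ t : ℝ, ∃ S : H →L[ℝ] H,
      (∀ x, Tendsto (fun k => expOp (Q k) (max t 0) x) atTop (𝓝 (S x))) ∧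
      ∀ x, ‖S x‖ ≤ 1 * ‖x‖ := by
    intro t
    refine exists_limit_of_denseRange hR.dense _ 1 (fun k x => ?_) fun y => ?_
    · rw [one_mul]
      exact norm_expOp_le (hs k) (hn k) x (le_max_right _ _)
    · refine cauchySeq_tendsto_of_complete (Metric.cauchySeq_iff.2 fun ε hε => ?_)
      obtain ⟨N, hN⟩ := Metric.cauchySeq_iff.1 (hQR y).cauchySeq (ε / (max t 0 + 1))
        (by positivity)
      refine ⟨N, fun m hm n hn' => ?_⟩
      have h1 := hN m hm n hn'
      rw [dist_eq_norm] at h1 ⊢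
      refine (norm_expOp_sub_le (hs n) (hn n) (hs m) (hn m) (hQQ m n) (R y)
        (le_max_right t 0)).trans_lt ?_
      rw [lt_div_iff₀ (by positivity)] at h1
      nlinarith [norm_nonneg (Q m (R y) - Q n (R y)), le_max_right t 0]
  choose S hS hS1 using hS
  have hSpos : ∀ t, 0 ≤ t → ∀ x, Tendsto (fun k => expOp (Q k) t x) atTop (𝓝 (S t x)) := by
    intro t ht x
    simpa [max_eq_left ht] using hS t x
  have hB : ∀ t : ℝ, ∃ B : H →L[ℝ] H, 0 < t →
      (∀ x, Tendsto (fun k => Q k (expOp (Q k) t x)) atTop (𝓝 (B x))) ∧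
      ∀ x, ‖B x‖ ≤ t⁻¹ * ‖x‖ := by
    intro t
    by_cases ht : 0 < t
    -- On the range of `R` the generator can be moved inside, `Q exp(tQ) R y = exp(tQ) (Q R y)`,
    -- where `Q R y` converges to `R y - y`; contractivity absorbs the error.
    · have hlim : ∀ y, Tendsto (fun k => (Q k * expOp (Q k) t) (R y)) atTop
          (𝓝 (S t (R y - y))) := by
        intro y
        have h1 : ∀ k, (Q k * expOp (Q k) t) (R y)
            = expOp (Q k) t (Q k (R y) - (R y - y)) + expOp (Q k) t (R y - y) := by
          intro k
          rw [mul_apply_eq_comp, expOp_comm_apply (Commute.refl _), ← map_add, sub_add_cancel]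
        simp only [h1]
        rw [← zero_add (S t (R y - y))]
        refine Tendsto.add ?_ (hSpos t ht.le _)
        rw [tendsto_zero_iff_norm_tendsto_zero]
        refine squeeze_zero (fun _ => norm_nonneg _)
          (fun k => norm_expOp_le (hs k) (hn k) _ ht.le) ?_
        exact tendsto_iff_norm_sub_tendsto_zero.1 (hQR y)
      obtain ⟨B, hB, hB'⟩ := exists_limit_of_denseRange hR.dense (fun k => Q k * expOp (Q k) t) t⁻¹
        (fun k x => norm_gen_expOp_le (hs k) (hn k) x ht) fun y => ⟨_, hlim y⟩
      exact ⟨B, fun _ => ⟨hB, hB'⟩⟩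
    · exact ⟨0, fun h => absurd h ht⟩
  choose B hB using hB
  have hcomm : ∀ t x, S t (R x) = R (S t x) := by
    intro t x
    refine tendsto_nhds_unique (hS t (R x)) ?_
    have := (R.continuous.tendsto _).comp (hS t x)
    refine this.congr fun k => ?_
    exact expOp_comm_apply (hRQ k) _ _
  have hnorm : ∀ t x, ‖S t x‖ ≤ ‖x‖ := fun t x => by simpa using hS1 t x
  have hSB : ∀ t, 0 < t → ∀ y, B t (R y) = S t (R y - y) := by
    intro t ht y
    have h1 := ((hB t ht).1 (R y)).sub (hSpos t ht.le (R y - y))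
    have h2 : Tendsto (fun k => Q k (expOp (Q k) t (R y)) - expOp (Q k) t (R y - y)) atTop
        (𝓝 0) := by
      rw [tendsto_zero_iff_norm_tendsto_zero]
      refine squeeze_zero (fun _ => norm_nonneg _) (fun k => ?_)
        (tendsto_iff_norm_sub_tendsto_zero.1 (hQR y))
      rw [expOp_comm_apply (Commute.refl _), ← map_sub]
      exact norm_expOp_le (hs k) (hn k) _ ht.le
    exact sub_eq_zero.1 (tendsto_nhds_unique h1 h2)
  refine ⟨S, B, fun t ht x => ?_, fun s t hs0 ht0 x => ?_, hnorm, hcomm, fun x => ?_,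
    fun t ht x => ?_, fun t ht => (hB t ht).2, fun x y hxy => ?_⟩
  · refine tendsto_nhds_unique (hS t x) ?_
    simp [max_eq_right ht, expOp_zero]
  · refine tendsto_nhds_unique (hSpos (s + t) (add_nonneg hs0 ht0) x) ?_
    have h1 : ∀ k, expOp (Q k) (s + t) x
        = expOp (Q k) s (expOp (Q k) t x - S t x) + expOp (Q k) s (S t x) := by
      intro k
      rw [expOp_add, mul_apply_eq_comp, ← map_add, sub_add_cancel]
    simp only [h1]
    rw [← zero_add (S s (S t x))]
    refine Tendsto.add ?_ (hSpos s hs0 _)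
    rw [tendsto_zero_iff_norm_tendsto_zero]
    exact squeeze_zero (fun _ => norm_nonneg _) (fun k => norm_expOp_le (hs k) (hn k) _ hs0)
      (tendsto_iff_norm_sub_tendsto_zero.1 (hSpos t ht0 x))
  · have hdense : ∀ y, Continuous fun t => S t (R y) := by
      intro y
      refine LipschitzWith.continuous (K := ‖R y - y‖₊) (LipschitzWith.of_dist_le_mul fun s t => ?_)
      rw [dist_eq_norm]
      refine le_of_tendsto_of_tendsto ((hS s (R y)).sub (hS t (R y))).norm
        ((hQR y).norm.mul_const (dist s t)) (Eventually.of_forall fun k => ?_)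
      have := Convex.norm_image_sub_le_of_norm_hasDerivWithin_le (f := fun s => expOp (Q k) s (R y))
        (f' := fun s => Q k (expOp (Q k) s (R y))) (s := Ici 0) (x := max t 0)
        (y := max s 0) (C := ‖Q k (R y)‖)
        (fun s _ => (hasDerivAt_expOp_apply (Q k) (R y) s).hasDerivWithinAt)
        (fun s hst => ?_) (convex_Ici 0) (mem_Ici.2 (le_max_right t 0)) (mem_Ici.2 (le_max_right s 0))
      · refine this.trans (mul_le_mul_of_nonneg_left ?_ (norm_nonneg _))
        rw [Real.norm_eq_abs, Real.dist_eq]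
        exact abs_max_sub_max_le_abs _ _ _
      · rw [expOp_comm_apply (Commute.refl _)]
        exact norm_expOp_le (hs k) (hn k) _ hst
    -- Orbits of vectors `R y` are Lipschitz, and by contractivity every orbit is a uniform limit of
    -- such orbits.
    refine continuous_of_uniform_approx_of_continuous fun u hu => ?_
    obtain ⟨ε, hε, hεu⟩ := Metric.mem_uniformity_dist.1 hu
    obtain ⟨_, ⟨y, rfl⟩, hy⟩ := Metric.mem_closure_iff.1 (hR.dense x) ε hε
    refine ⟨_, hdense y, fun t => hεu ?_⟩
    rw [dist_eq_norm, ← map_sub]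
    exact (hnorm t _).trans_lt (by rwa [← dist_eq_norm])
  · unfold IsGen
    refine hR.dense.induction_on (p := fun x => S t x = R (S t x - B t x)) x
      (isClosed_eq (S t).continuous (R.continuous.comp ((S t).continuous.sub (B t).continuous)))
      fun y => ?_
    rw [hSB t ht, hcomm, map_sub (S t), hcomm, sub_sub_cancel]
  -- Limit of `norm_expOp_sub_sub_le`. The vector `R z` is then chosen close to `y`, and `t` small
  -- depending on `z`, so that the error is `o(t)`.
  · have hkey : ∀ z t, 0 ≤ t → ‖S t x - x - t • y‖ ≤ t * (t * ‖R z - z‖ + 2 * ‖y - R z‖) := by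
      intro z t ht
      refine le_of_tendsto_of_tendsto
        (((hSpos t ht x).sub_const x).sub ((hQ x y hxy).const_smul t)).norm
        (((hQR z).norm.const_mul t).add (((hQ x y hxy).sub_const (R z)).norm.const_mul 2)
          |>.const_mul t) (Eventually.of_forall fun k => ?_)
      exact norm_expOp_sub_sub_le (hs k) (hn k) x (R z) ht
    have h0 : S 0 x = x := by
      refine tendsto_nhds_unique (hSpos 0 le_rfl x) ?_
      simp [expOp_zero]
    rw [hasDerivWithinAt_iff_isLittleO, Asymptotics.isLittleO_iff]
    intro c hc
    obtain ⟨_, ⟨z, rfl⟩, hz⟩ := Metric.mem_closure_iff.1 (hR.dense y) (c / 4) (by positivity)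
    rw [dist_eq_norm] at hz
    have hev : ∀ᶠ t : ℝ in 𝓝[Ici 0] 0, t * ‖R z - z‖ < c / 2 := by
      have : Tendsto (fun t : ℝ => t * ‖R z - z‖) (𝓝[Ici 0] 0) (𝓝 (0 * ‖R z - z‖)) :=
        ((continuous_id.mul continuous_const).tendsto 0).mono_left nhdsWithin_le_nhds
      rw [zero_mul] at this
      exact this.eventually_lt_const (by positivity)
    filter_upwards [hev, self_mem_nhdsWithin] with t ht ht0
    have ht0' : (0 : ℝ) ≤ t := ht0
    rw [h0, sub_zero, Real.norm_of_nonneg ht0']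
    refine (hkey z t ht0').trans ?_
    rw [mul_comm c]
    gcongr
    linarith

end Resolvent

/-! ### Duhamel's formula with Hölder continuous source -/

section CauchyProblem

variable {H : Type*} [NormedAddCommGroup H] [InnerProductSpace ℝ H] [CompleteSpace H]
  {R : H →L[ℝ] H} {S B : ℝ → H →L[ℝ] H}

lemma IsAnalyticSemigroup.isGen (hS : IsAnalyticSemigroup R S B) {u w : H} (h : IsGen R u w)
    (t : ℝ) : IsGen R (S t u) (S t w) := by
  unfold IsGen at *
  rw [← map_sub, ← hS.comm, ← h]

lemma IsAnalyticSemigroup.continuous_uncurry (hS : IsAnalyticSemigroup R S B) :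
    Continuous fun p : ℝ × H => S p.1 p.2 := by
  rw [continuous_iff_continuousAt]
  rintro ⟨t, x⟩
  rw [ContinuousAt, tendsto_iff_norm_sub_tendsto_zero]
  have h1 : Tendsto (fun p : ℝ × H => ‖p.2 - x‖ + ‖S p.1 x - S t x‖) (𝓝 (t, x)) (𝓝 0) := by
    have hc := (hS.cont x).comp (continuous_fst (X := ℝ) (Y := H))
    have : Continuous fun p : ℝ × H => ‖p.2 - x‖ + ‖S p.1 x - S t x‖ :=
      ((continuous_snd.sub continuous_const).norm).add (hc.sub continuous_const).norm
    simpa using this.tendsto (t, x)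
  refine squeeze_zero (fun _ => norm_nonneg _) (fun p => ?_) h1
  calc ‖S p.1 p.2 - S t x‖ = ‖S p.1 (p.2 - x) + (S p.1 x - S t x)‖ := by
        rw [map_sub]; congr 1; abel
    _ ≤ _ := (norm_add_le _ _).trans (by gcongr; exact hS.norm_le _ _)

lemma hasDerivWithinAt_shift {g : ℝ → H} {y : H} (h : HasDerivWithinAt g y (Ici 0) 0) (t : ℝ) :
    HasDerivWithinAt (fun s => g (s - t)) y (Ici t) t := by
  have h1 : HasDerivWithinAt g y (Ici 0) (t - t) := by rwa [sub_self]
  have h2 := HasDerivWithinAt.scomp (h := fun s : ℝ => s - t) (s := Ici t) t h1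
    ((hasDerivAt_id t).sub_const t).hasDerivWithinAt fun s hs => sub_nonneg.2 (mem_Ici.1 hs)
  rw [one_smul] at h2
  exact h2

lemma IsAnalyticSemigroup.hasDerivWithinAt (hS : IsAnalyticSemigroup R S B) {x y : H}
    (h : IsGen R x y) {t : ℝ} (ht : 0 ≤ t) :
    HasDerivWithinAt (fun s => S s x) (S t y) (Ici t) t := by
  have h1 := hS.deriv _ _ (hS.isGen h t)
  have h2 := hasDerivWithinAt_shift h1 t
  refine h2.congr (fun s hs => ?_) ?_
  · rw [← hS.add _ _ (sub_nonneg.2 hs) ht, sub_add_cancel]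
  · rw [hS.of_nonpos (t - t) (by simp)]

/-- Both sides are the value of `A` at `S t x`, computed with or without stopping at time `s`;
uniqueness of that value identifies them. Continuity of `t ↦ B t` away from `0` follows from that of
`S`. -/
lemma IsAnalyticSemigroup.smoothing_eq (hR : IsResolvent R) (hS : IsAnalyticSemigroup R S B)
    {s t : ℝ} (hs : 0 < s) (hst : s ≤ t) (x : H) : B t x = S (t - s) (B s x) := by
  refine hR.gen_unique (hS.smooth t (hs.trans_le hst) x) ?_
  have := hS.isGen (hS.smooth s hs x) (t - s)
  rwa [← hS.add _ _ (sub_nonneg.2 hst) hs.le, sub_add_cancel] at this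

lemma IsAnalyticSemigroup.continuousOn_smoothing (hR : IsResolvent R)
    (hS : IsAnalyticSemigroup R S B) {g : ℝ → H} (hg : Continuous g) :
    ContinuousOn (fun t => B t (g t)) (Ioi 0) := by
  intro t ht
  have ht' : (0 : ℝ) < t / 2 := half_pos ht
  refine ContinuousAt.continuousWithinAt ?_
  have h1 : Continuous fun s => S (s - t / 2) (B (t / 2) (g s)) :=
    hS.continuous_uncurry.comp ((continuous_id.sub continuous_const).prodMk
      ((B (t / 2)).continuous.comp hg))
  refine h1.continuousAt.congr ?_
  filter_upwards [lt_mem_nhds (half_lt_self ht)] with s hs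
  exact (hS.smoothing_eq hR ht' (le_of_lt hs) _).symm

/-- Integration commutes with `A` because the relation `u = R (u - w)` involves only the bounded
operator `R`. -/
lemma IsGen.intervalIntegral {F F' : ℝ → H} {a b : ℝ} (hab : a ≤ b)
    (hF : IntervalIntegrable F volume a b) (hF' : IntervalIntegrable F' volume a b)
    (h : ∀ s ∈ Ioc a b, IsGen R (F s) (F' s)) : IsGen R (∫ s in a..b, F s) (∫ s in a..b, F' s) := by
  unfold IsGen
  rw [← intervalIntegral.integral_sub hF hF',
    ← ContinuousLinearMap.intervalIntegral_comp_comm R (hF.sub hF')]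
  refine intervalIntegral.integral_congr_ae (Eventually.of_forall fun s hs => ?_)
  rw [uIoc_of_le hab] at hs
  exact h s hs

/-- The vector `y` need not lie in `D(A)`. The fundamental theorem of calculus is applied to the
orbit of `R y`, which does, and `R` is then pulled out of the integral. -/
lemma IsAnalyticSemigroup.isGen_integral (hS : IsAnalyticSemigroup R S B) (y : H) {t : ℝ}
    (ht : 0 ≤ t) : IsGen R (∫ s in (0 : ℝ)..t, S s y) (S t y - y) := by
  have h1 : ∫ s in (0 : ℝ)..t, S s (R y - y) = S t (R y) - S 0 (R y) := by
    refine intervalIntegral.integral_eq_sub_of_hasDeriv_right (hS.cont _).continuousOn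
      (fun s hs => ?_) ((hS.cont _).intervalIntegrable _ _)
    rw [min_eq_left ht] at hs
    exact (hS.hasDerivWithinAt (isGen_range R y) hs.1.le).mono Ioi_subset_Ici_self
  have h2 : ∫ s in (0 : ℝ)..t, S s (R y - y)
      = R (∫ s in (0 : ℝ)..t, S s y) - ∫ s in (0 : ℝ)..t, S s y := by
    rw [← ContinuousLinearMap.intervalIntegral_comp_comm R ((hS.cont _).intervalIntegrable _ _),
      ← intervalIntegral.integral_sub
        (Continuous.intervalIntegrable (u := fun s => R (S s y)) (R.continuous.comp (hS.cont y)) _ _)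
        ((hS.cont y).intervalIntegrable _ _)]
    simp [map_sub, hS.comm]
  rw [h2, hS.of_nonpos 0 le_rfl, hS.comm] at h1
  unfold IsGen
  rw [map_sub, map_sub, ← h1]
  abel

/-- The convolution of the semigroup with the source term. -/
noncomputable def duhamel (S : ℝ → H →L[ℝ] H) (f : ℝ → H) (t : ℝ) : H :=
  ∫ s in (0 : ℝ)..t, S s (f (t - s))

/-- The singular part of `A` applied to the convolution. -/
noncomputable def singularPart (B : ℝ → H →L[ℝ] H) (f : ℝ → H) (t : ℝ) : H :=
  ∫ s in (0 : ℝ)..t, B s (f (t - s) - f t)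

lemma IsAnalyticSemigroup.continuous_duhamel (hS : IsAnalyticSemigroup R S B) {f : ℝ → H}
    (hf : Continuous f) : Continuous (duhamel S f) := by
  refine intervalIntegral.continuous_parametric_intervalIntegral_of_continuous ?_ continuous_id
  exact hS.continuous_uncurry.comp (continuous_snd.prodMk
    (hf.comp (continuous_fst.sub continuous_snd)))

section Hoelder

variable {f : ℝ → H} {M α : ℝ}

/-- The one place where the Hölder condition is essential: smoothing costs `1/s`, the increment of
`f` gains `s^α`, and the product is integrable at `0`. -/
lemma IsAnalyticSemigroup.norm_singular_le (hS : IsAnalyticSemigroup R S B)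
    (hf : ∀ s t, ‖f s - f t‖ ≤ M * |s - t| ^ α) (t : ℝ) {s : ℝ} (hs : 0 < s) :
    ‖B s (f (t - s) - f t)‖ ≤ M * s ^ (α - 1) := by
  refine (hS.norm_le' s hs _).trans ?_
  have h1 := hf (t - s) t
  rw [show t - s - t = -s by ring, abs_neg, abs_of_pos hs] at h1
  calc s⁻¹ * ‖f (t - s) - f t‖ ≤ s⁻¹ * (M * s ^ α) := by gcongr
    _ = M * s ^ (α - 1) := by
      rw [Real.rpow_sub_one hs.ne']; field_simp

lemma intervalIntegrable_singular_bound (hα : 0 < α) (M a b : ℝ) :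
    IntervalIntegrable (fun s : ℝ => M * s ^ (α - 1)) volume a b :=
  (intervalIntegral.intervalIntegrable_rpow' (by linarith)).const_mul M

lemma IsAnalyticSemigroup.aestronglyMeasurable_singular (hR : IsResolvent R)
    (hS : IsAnalyticSemigroup R S B) (hc : Continuous f) (t T : ℝ) :
    AEStronglyMeasurable (fun s => B s (f (t - s) - f t)) (volume.restrict (Ioc 0 T)) := by
  refine ContinuousOn.aestronglyMeasurable ?_ measurableSet_Ioc
  exact (hS.continuousOn_smoothing hR (g := fun s => f (t - s) - f t) (by fun_prop)).mono
    fun s hs => hs.1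

lemma IsAnalyticSemigroup.intervalIntegrable_singular (hR : IsResolvent R)
    (hS : IsAnalyticSemigroup R S B) (hα : 0 < α) (hc : Continuous f)
    (hf : ∀ s t, ‖f s - f t‖ ≤ M * |s - t| ^ α) (t : ℝ) {T : ℝ} (hT : 0 ≤ T) :
    IntervalIntegrable (fun s => B s (f (t - s) - f t)) volume 0 T := by
  have hb := intervalIntegrable_singular_bound hα M 0 T
  rw [intervalIntegrable_iff_integrableOn_Ioc_of_le hT] at hb ⊢
  refine Integrable.mono' hb (hS.aestronglyMeasurable_singular hR hc t T) ?_
  refine (ae_restrict_iff' measurableSet_Ioc).2 (Eventually.of_forall fun s hs => ?_)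
  exact hS.norm_singular_le hf t hs.1

lemma IsAnalyticSemigroup.norm_singularPart_le (hS : IsAnalyticSemigroup R S B) (hα : 0 < α)
    (hf : ∀ s t, ‖f s - f t‖ ≤ M * |s - t| ^ α) {t : ℝ} (ht : 0 ≤ t) :
    ‖singularPart B f t‖ ≤ M * (t ^ α / α) := by
  have h1 : ‖singularPart B f t‖ ≤ ∫ s in (0 : ℝ)..t, M * s ^ (α - 1) := by
    refine intervalIntegral.norm_integral_le_of_norm_le ht
      (Eventually.of_forall fun s hs => hS.norm_singular_le hf t hs.1)
      (intervalIntegrable_singular_bound hα M 0 t)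
  rw [intervalIntegral.integral_const_mul, integral_rpow (Or.inl (by linarith))] at h1
  simpa [Real.zero_rpow hα.ne'] using h1

lemma IsAnalyticSemigroup.continuousOn_singularPart (hR : IsResolvent R)
    (hS : IsAnalyticSemigroup R S B) (hα : 0 < α) (hc : Continuous f)
    (hf : ∀ s t, ‖f s - f t‖ ≤ M * |s - t| ^ α) {T : ℝ} (hT : 0 ≤ T) :
    ContinuousOn (singularPart B f) (Icc 0 T) := by
  -- The variable upper limit is moved into an indicator, so that dominated convergence applies on
  -- the fixed interval `[0, T]`. For fixed `s`, the integrand jumps only at `t = s`, which excludes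
  -- a single `s` for each `t`.
  set F : ℝ → ℝ → H := fun t => (Iio t).indicator fun s => B s (f (t - s) - f t) with hF
  have hFt : ∀ t ∈ Icc 0 T, singularPart B f t = ∫ s in (0 : ℝ)..T, F t s := by
    intro t ht
    have h1 : IntervalIntegrable (F t) volume 0 T := by
      have := hS.intervalIntegrable_singular hR hα hc hf t hT
      rw [intervalIntegrable_iff_integrableOn_Ioc_of_le hT] at this ⊢
      exact this.indicator measurableSet_Iio
    have hsub : ∀ a b, 0 ≤ a → a ≤ b → b ≤ T → IntervalIntegrable (F t) volume a b :=
      fun a b ha hab hb => h1.mono_set (by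
        rw [uIcc_of_le hab, uIcc_of_le hT]; exact Icc_subset_Icc ha hb)
    rw [← intervalIntegral.integral_add_adjacent_intervals (hsub 0 t le_rfl ht.1 ht.2)
      (hsub t T ht.1 ht.2 le_rfl)]
    have h2 : ∫ s in t..T, F t s = 0 := by
      refine intervalIntegral.integral_zero_ae (Eventually.of_forall fun s hs => ?_)
      rw [uIoc_of_le ht.2] at hs
      exact indicator_of_notMem (s := Iio t) (fun h : s < t => absurd hs.1 (not_lt.2 h.le)) _
    rw [h2, add_zero]
    refine intervalIntegral.integral_congr_ae ?_
    filter_upwards [compl_mem_ae_iff.2 (measure_singleton t)] with s hst hs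
    rw [uIoc_of_le ht.1] at hs
    exact (indicator_of_mem (show s ∈ Iio t from lt_of_le_of_ne hs.2 hst)
      (fun s => B s (f (t - s) - f t))).symm
  refine ContinuousOn.congr (f := fun t => ∫ s in (0 : ℝ)..T, F t s) (fun t ht => ?_) hFt
  refine intervalIntegral.continuousWithinAt_of_dominated_interval
    (bound := fun s => M * s ^ (α - 1)) ?_ ?_ (intervalIntegrable_singular_bound hα M 0 T) ?_
  · refine Eventually.of_forall fun r => ?_
    rw [uIoc_of_le hT]
    exact (hS.aestronglyMeasurable_singular hR hc r T).indicator measurableSet_Iio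
  · refine Eventually.of_forall fun r => Eventually.of_forall fun s hs => ?_
    rw [uIoc_of_le hT] at hs
    refine (norm_indicator_le_norm_self _ _).trans (hS.norm_singular_le hf r hs.1)
  · filter_upwards [compl_mem_ae_iff.2 (measure_singleton t)] with s hst hs
    rw [uIoc_of_le hT] at hs
    refine ContinuousAt.continuousWithinAt ?_
    rcases lt_or_gt_of_ne (show s ≠ t from hst) with h | h
    · have h1 : Continuous fun r => B s (f (r - s) - f r) :=
        (B s).continuous.comp (by fun_prop)
      refine h1.continuousAt.congr ?_
      filter_upwards [lt_mem_nhds h] with r hr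
      exact (indicator_of_mem (show s ∈ Iio r from hr) (fun s => B s (f (r - s) - f r))).symm
    · refine (continuousAt_const (y := (0 : H))).congr ?_
      filter_upwards [gt_mem_nhds h] with r hr
      exact (indicator_of_notMem (show s ∉ Iio r from not_lt.2 (le_of_lt hr)) _).symm

/-- Split `f (t - s) = (f (t - s) - f t) + f t`. On the first part `A` passes under the integral
thanks to the integrable bound; on the constant part `isGen_integral` is exact. -/
lemma IsAnalyticSemigroup.isGen_duhamel (hR : IsResolvent R)
    (hS : IsAnalyticSemigroup R S B) (hα : 0 < α) (hc : Continuous f)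
    (hf : ∀ s t, ‖f s - f t‖ ≤ M * |s - t| ^ α) {t : ℝ} (ht : 0 ≤ t) :
    IsGen R (duhamel S f t) (singularPart B f t + (S t (f t) - f t)) := by
  have hi : IntervalIntegrable (fun s => S s (f (t - s) - f t)) volume 0 t :=
    (hS.continuous_uncurry.comp (continuous_id.prodMk
      (by fun_prop : Continuous fun s => f (t - s) - f t))).intervalIntegrable _ _
  have h1 : IsGen R (∫ s in (0 : ℝ)..t, S s (f (t - s) - f t)) (singularPart B f t) :=
    IsGen.intervalIntegral ht hi (hS.intervalIntegrable_singular hR hα hc hf t ht)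
      fun s hs => hS.smooth s hs.1 _
  have h2 := h1.add (hS.isGen_integral (f t) ht)
  rw [← intervalIntegral.integral_add hi ((hS.cont _).intervalIntegrable _ _)] at h2
  simpa [duhamel] using h2

end Hoelder

/-- Restarting the evolution at time `t`; this separates a semigroup orbit from a short-time forcing
term when differentiating. -/
lemma IsAnalyticSemigroup.duhamel_add (hS : IsAnalyticSemigroup R S B) {f : ℝ → H}
    (hf : Continuous f) {t h : ℝ} (ht : 0 ≤ t) (hh : 0 ≤ h) :
    duhamel S f (t + h) = S h (duhamel S f t) + ∫ s in (0 : ℝ)..h, S s (f (t + h - s)) := by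
  have hc : ∀ r, Continuous fun s => S s (f (r - s)) := fun r =>
    hS.continuous_uncurry.comp (continuous_id.prodMk (by fun_prop))
  rw [duhamel, ← intervalIntegral.integral_add_adjacent_intervals
    ((hc (t + h)).intervalIntegrable 0 h) ((hc (t + h)).intervalIntegrable h (t + h)), add_comm]
  congr 1
  rw [duhamel, ← ContinuousLinearMap.intervalIntegral_comp_comm (S h)
    ((hc t).intervalIntegrable 0 t)]
  have := intervalIntegral.integral_comp_add_right (fun s => S s (f (t + h - s))) (a := 0) (b := t) h
  rw [zero_add] at this
  rw [← this]
  refine intervalIntegral.integral_congr fun s hs => ?_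
  rw [uIcc_of_le ht] at hs
  rw [← hS.add _ _ hh hs.1, add_comm s h]
  congr 2
  ring

/-- After restarting at `t`, the orbit part has right derivative `w` because its initial value lies
in `D(A)`, and the forcing part is an average converging to `f t`. Only the right derivative is
visible this way. -/
lemma IsAnalyticSemigroup.hasDerivWithinAt_duhamel (hS : IsAnalyticSemigroup R S B) {f : ℝ → H}
    (hf : Continuous f) {t : ℝ} (ht : 0 ≤ t) {w : H} (hw : IsGen R (duhamel S f t) w) :
    HasDerivWithinAt (duhamel S f) (w + f t) (Ici t) t := by
  have hc : Continuous fun p : ℝ × ℝ => S p.2 (f (t + p.1 - p.2)) :=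
    hS.continuous_uncurry.comp (continuous_snd.prodMk (by fun_prop))
  have h2 : HasDerivWithinAt (fun h => ∫ s in (0 : ℝ)..h, S s (f (t + h - s))) (f t) (Ici 0) 0 := by
    rw [hasDerivWithinAt_iff_isLittleO, Asymptotics.isLittleO_iff]
    intro c hc0
    have h0 := hc.tendsto (0, 0)
    simp only [hS.of_nonpos 0 le_rfl, add_zero, sub_zero] at h0
    obtain ⟨δ, hδ, hδc⟩ := Metric.tendsto_nhds_nhds.1 h0 c hc0
    have hev : ∀ᶠ h : ℝ in 𝓝[Ici 0] 0, h < δ :=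
      nhdsWithin_le_nhds (gt_mem_nhds hδ)
    filter_upwards [hev, self_mem_nhdsWithin] with h hhδ hh0
    have hh0' : (0 : ℝ) ≤ h := hh0
    have hi : IntervalIntegrable (fun s => S s (f (t + h - s))) volume 0 h :=
      (hc.comp (continuous_const.prodMk continuous_id)).intervalIntegrable _ _
    rw [intervalIntegral.integral_same, sub_zero, sub_zero]
    have e : (∫ s in (0 : ℝ)..h, S s (f (t + h - s))) - h • f t
        = ∫ s in (0 : ℝ)..h, (S s (f (t + h - s)) - f t) := by
      rw [intervalIntegral.integral_sub hi (intervalIntegrable_const), intervalIntegral.integral_const,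
        sub_zero]
    rw [e]
    have := intervalIntegral.norm_integral_le_of_norm_le_const (a := 0) (b := h) (C := c)
      (f := fun s => S s (f (t + h - s)) - f t) fun s hs => ?_
    · simpa using this
    · rw [uIoc_of_le hh0'] at hs
      rw [← dist_eq_norm]
      refine (@hδc (h, s) ?_).le
      rw [Prod.dist_eq, max_lt_iff]
      simp only [Real.dist_eq, sub_zero, abs_of_nonneg hh0', abs_of_pos hs.1]
      exact ⟨hhδ, hs.2.trans_lt hhδ⟩
  have h3 : HasDerivWithinAt (fun h => duhamel S f (t + h)) (w + f t) (Ici 0) 0 := by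
    refine ((hS.deriv _ _ hw).add h2).congr (fun h hh => hS.duhamel_add hf ht hh) ?_
    simpa using hS.duhamel_add hf ht (le_refl 0)
  have h4 := hasDerivWithinAt_shift h3 t
  simpa using h4

/-- A continuous function with a continuous right derivative is differentiable. -/
lemma hasDerivWithinAt_of_right {u g : ℝ → H} {T : ℝ} (hu : ContinuousOn u (Icc 0 T))
    (hg : ContinuousOn g (Icc 0 T)) (hd : ∀ t ∈ Ico 0 T, HasDerivWithinAt u (g t) (Ici t) t)
    {t : ℝ} (ht : t ∈ Icc 0 T) : HasDerivWithinAt u (g t) (Icc 0 T) t := by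
  have hT : (0 : ℝ) ≤ T := ht.1.trans ht.2
  -- Extending the right derivative by constants makes it continuous on the line, so its primitive
  -- is differentiable on both sides and agrees with `u - u 0` on `[0, T]`.
  set G : ℝ → H := fun s => g (projIcc 0 T hT s) with hG
  have hGc : Continuous G := by
    have := (continuousOn_iff_continuous_domRestrict.1 hg).comp (continuous_projIcc (h := hT))
    exact this
  have hGg : ∀ s ∈ Icc 0 T, G s = g s := fun s hs => by simp [hG, projIcc_of_mem hT hs]
  have hint : ∀ s ∈ Icc 0 T, u s = u 0 + ∫ r in (0 : ℝ)..s, G r := by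
    intro s hs
    have := intervalIntegral.integral_eq_sub_of_hasDeriv_right (f := u) (f' := G) (a := 0) (b := s)
      (by rw [uIcc_of_le hs.1]; exact hu.mono (Icc_subset_Icc_right hs.2)) (fun r hr => ?_)
      (hGc.intervalIntegrable _ _)
    · rw [this]; abel
    · rw [min_eq_left hs.1, max_eq_right hs.1] at hr
      rw [hGg r ⟨hr.1.le, hr.2.le.trans hs.2⟩]
      exact (hd r ⟨hr.1.le, hr.2.trans_le hs.2⟩).mono Ioi_subset_Ici_self
  have h1 : HasDerivAt (fun s => u 0 + ∫ r in (0 : ℝ)..s, G r) (G t) t :=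
    (hGc.integral_hasStrictDerivAt 0 t).hasDerivAt.const_add _
  rw [← hGg t ht]
  exact h1.hasDerivWithinAt.congr hint (hint t ht)

/-- Uniqueness for the homogeneous Cauchy problem. -/
lemma IsResolvent.eq_zero_of_hasDerivWithinAt (hR : IsResolvent R) {w w' : ℝ → H} {T : ℝ}
    (hw : ContinuousOn w (Icc 0 T)) (hd : ∀ t ∈ Ico 0 T, HasDerivWithinAt w (w' t) (Ici t) t)
    (hg : ∀ t ∈ Ico 0 T, IsGen R (w t) (w' t)) (h0 : w 0 = 0) {t : ℝ} (ht : t ∈ Icc 0 T) :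
    w t = 0 := by
  -- Dissipativity: `‖w‖²` has right derivative `2 ⟨w, w'⟩ ≤ 0` and starts from `0`.
  have := image_le_of_deriv_right_le_deriv_boundary (f := fun t => ‖w t‖ ^ 2)
    (f' := fun t => 2 * inner ℝ (w t) (w' t)) (a := 0) (b := T) (hw.norm.pow 2)
    (fun t ht => (hd t ht).norm_sq) (B := fun _ => 0) (B' := fun _ => 0) (by simp [h0])
    continuousOn_const (fun t _ => hasDerivWithinAt_const _ _ _)
    (fun t ht => by linarith [hR.gen_inner_nonpos (hg t ht)]) ht
  simpa using this

end CauchyProblem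

/-! ### Strict solutions and the a priori estimate -/

section StrictSolution

variable {H : Type*} [NormedAddCommGroup H] [InnerProductSpace ℝ H] [CompleteSpace H]
  {R : H →L[ℝ] H} {S B : ℝ → H →L[ℝ] H} {D : Set H} {A : H → H}

lemma hasDerivWithinAt_zero_iff {g : ℝ → H} {y : H} :
    HasDerivWithinAt g y (Ici 0) 0 ↔ Tendsto (fun t : ℝ => t⁻¹ • (g t - g 0)) (𝓝[>] 0) (𝓝 y) := by
  rw [← hasDerivWithinAt_Ioi_iff_Ici, hasDerivWithinAt_iff_tendsto_slope' (by simp)]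
  simp only [slope_fun_def, sub_zero, vsub_eq_sub]

lemma IsAnalyticSemigroup.isC0 (hS : IsAnalyticSemigroup R S B)
    (hDA : ∀ u w, (u ∈ D ∧ A u = w) ↔ IsGen R u w) : IsC0SemigroupGeneratedBy D A S where
  zero := by ext x; simp [hS.of_nonpos 0 le_rfl]
  add s t hs ht := by ext x; simp [hS.add s t hs ht]
  continuous x := (hS.cont x).continuousOn
  generator x y := by
    rw [hDA]
    have key : ∀ x y, IsGen R x y → Tendsto (fun t : ℝ => t⁻¹ • (S t x - x)) (𝓝[>] 0) (𝓝 y) := by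
      intro x y h
      simpa [hS.of_nonpos 0 le_rfl] using hasDerivWithinAt_zero_iff.1 (hS.deriv x y h)
    refine ⟨fun h => ?_, key x y⟩
    -- Conversely, suppose the difference quotients of an arbitrary `x` converge to `y`. Applying
    -- `R` to them gives the quotients of `R x`, whose limit is already known to be `R x - x`; hence
    -- `R x - x = R y`, which is membership in `D(A)`.
    have h1 := key _ _ (isGen_range R x)
    have h2 := (R.continuous.tendsto y).comp h
    have h3 : R x - x = R y := by
      refine tendsto_nhds_unique h1 (h2.congr fun t => ?_)
      simp [hS.comm]
    unfold IsGen
    rw [map_sub, ← h3]; abel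

/-- A semigroup obtained by choice is known only through its generator. For initial values in `D(A)`
its orbits solve the same homogeneous Cauchy problem as those of `S`, so uniqueness and density
transfer all estimates to it. -/
lemma IsC0SemigroupGeneratedBy.eq (hR : IsResolvent R) (hS : IsAnalyticSemigroup R S B)
    (hDA : ∀ u w, (u ∈ D ∧ A u = w) ↔ IsGen R u w) {S' : ℝ → H →L[ℝ] H}
    (hS' : IsC0SemigroupGeneratedBy D A S') {t : ℝ} (ht : 0 ≤ t) (x : H) : S' t x = S t x := by
  refine hR.dense.induction_on (p := fun x => S' t x = S t x) x
    (isClosed_eq (S' t).continuous (S t).continuous) fun z => ?_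
  set x := R z
  set y := R z - z
  have hxy : IsGen R x y := isGen_range R z
  -- The operators `S' s` and `S' h` commute by the semigroup law, so the quotient at `S' s x` is
  -- the image under `S' s` of the quotient at `x`.
  have h1 : ∀ s, 0 ≤ s → Tendsto (fun h : ℝ => h⁻¹ • (S' h (S' s x) - S' s x)) (𝓝[>] 0)
      (𝓝 (S' s y)) := by
    intro s hs
    have h := ((S' s).continuous.tendsto y).comp ((hS'.generator x y).2 ((hDA x y).2 hxy))
    refine h.congr' ?_
    filter_upwards [self_mem_nhdsWithin] with r hr
    have e1 := congrArg (fun L : H →L[ℝ] H => L x) (hS'.add s r hs (le_of_lt hr))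
    have e2 := congrArg (fun L : H →L[ℝ] H => L x) (hS'.add r s (le_of_lt hr) hs)
    rw [add_comm r s] at e2
    have e3 : S' s (S' r x) = S' r (S' s x) := e1.symm.trans e2
    simp [e3]
  have hgen : ∀ s, 0 ≤ s → IsGen R (S' s x) (S' s y) := fun s hs =>
    (hDA _ _).1 ((hS'.generator _ _).1 (h1 s hs))
  have hd : ∀ s, 0 ≤ s → HasDerivWithinAt (fun r => S' r x) (S' s y) (Ici s) s := by
    intro s hs
    have h0 : HasDerivWithinAt (fun h => S' h (S' s x)) (S' s y) (Ici 0) 0 := by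
      rw [hasDerivWithinAt_zero_iff]
      simpa [hS'.zero] using h1 s hs
    refine (hasDerivWithinAt_shift h0 s).congr (fun r hr => ?_) ?_
    · have := congrArg (fun L : H →L[ℝ] H => L x) (hS'.add (r - s) s (sub_nonneg.2 hr) hs)
      rw [sub_add_cancel] at this
      exact this
    · simp [hS'.zero]
  have := hR.eq_zero_of_hasDerivWithinAt (T := t) (w := fun s => S' s x - S s x)
    (w' := fun s => S' s y - S s y)
    (((hS'.continuous x).mono fun s hs => hs.1).sub (hS.cont x).continuousOn)
    (fun s hs => (hd s hs.1).sub (hS.hasDerivWithinAt hxy hs.1))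
    (fun s hs => (hgen s hs.1).sub (hS.isGen hxy s))
    (by simp [hS'.zero, hS.of_nonpos 0 le_rfl]) ⟨ht, le_rfl⟩
  exact sub_eq_zero.1 this

lemma bddAbove_norm {T : ℝ} {g : ℝ → H} (hg : ContinuousOn g (Icc 0 T)) :
    BddAbove (range fun t : Icc (0 : ℝ) T => ‖g t‖) := by
  have := (isCompact_Icc.image_of_continuousOn hg.norm).bddAbove
  refine this.mono ?_
  rintro _ ⟨t, rfl⟩
  exact ⟨t, t.2, rfl⟩

lemma norm_le_supNorm {T : ℝ} {g : ℝ → H} (hg : ContinuousOn g (Icc 0 T)) {t : ℝ}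
    (ht : t ∈ Icc 0 T) : ‖g t‖ ≤ supNorm T g :=
  le_ciSup (bddAbove_norm hg) (⟨t, ht⟩ : Icc (0 : ℝ) T)

lemma supNorm_le {T : ℝ} (hT : 0 ≤ T) {g : ℝ → H} {C : ℝ} (h : ∀ t ∈ Icc 0 T, ‖g t‖ ≤ C) :
    supNorm T g ≤ C := by
  have : Nonempty (Icc (0 : ℝ) T) := ⟨⟨0, le_rfl, hT⟩⟩
  exact ciSup_le fun t => h t t.2

/-- The `α`-Hölder seminorm on `[0, T]`. -/
noncomputable def holderSeminorm (T α : ℝ) (f : ℝ → H) : ℝ :=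
  ⨆ p : Icc (0 : ℝ) T × Icc (0 : ℝ) T, ‖f p.1 - f p.2‖ / |(p.1 : ℝ) - (p.2 : ℝ)| ^ α

/-- The final estimate must involve the seminorm itself and not some admissible `M`. The constant
`M` serves only to bound the set whose supremum is taken, without which a real supremum carries no
information. -/
lemma norm_sub_le_holderSeminorm {T : ℝ} {α M : ℝ≥0} (hα : 0 < α) {f : ℝ → H}
    (hf : HolderOnWith M α f (Icc 0 T)) {s t : ℝ} (hs : s ∈ Icc 0 T) (ht : t ∈ Icc 0 T) :
    ‖f s - f t‖ ≤ holderSeminorm T α f * |s - t| ^ (α : ℝ) := by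
  rcases eq_or_ne s t with rfl | hst
  · simp [Real.zero_rpow (NNReal.coe_pos.2 hα).ne']
  have hpos : 0 < |s - t| ^ (α : ℝ) := Real.rpow_pos_of_pos (abs_pos.2 (sub_ne_zero.2 hst)) _
  rw [← div_le_iff₀ hpos]
  refine le_ciSup (f := fun p : Icc (0 : ℝ) T × Icc (0 : ℝ) T =>
    ‖f p.1 - f p.2‖ / |(p.1 : ℝ) - (p.2 : ℝ)| ^ (α : ℝ)) ⟨M, ?_⟩ (⟨s, hs⟩, ⟨t, ht⟩)
  rintro _ ⟨⟨a, b⟩, rfl⟩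
  refine div_le_of_le_mul₀ (by positivity) M.2 ?_
  have := hf.dist_le a.2 b.2
  rwa [dist_eq_norm, Real.dist_eq] at this

lemma holderSeminorm_nonneg (T α : ℝ) (f : ℝ → H) : 0 ≤ holderSeminorm T α f :=
  Real.iSup_nonneg fun _ => by positivity

/-- Strict solutions of the Cauchy problem for a nonpositive self-adjoint operator. -/
theorem IsResolvent.strict_solution (hR : IsResolvent R)
    (hDA : ∀ u w, (u ∈ D ∧ A u = w) ↔ IsGen R u w) {S' : ℝ → H →L[ℝ] H}
    (hS' : IsC0SemigroupGeneratedBy D A S') {T : ℝ} (hT : 0 < T) {α : ℝ≥0} (hα : 0 < α)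
    {f : ℝ → H} {u₀ : H} (hf : ∃ M : ℝ≥0, HolderOnWith M α f (Icc 0 T)) (hu₀ : u₀ ∈ D)
    {u : ℝ → H} (hu : ∀ t, u t = S' t u₀ + ∫ τ in (0 : ℝ)..t, S' (t - τ) (f τ)) :
    (∀ t ∈ Icc 0 T, IntervalIntegrable (fun τ => S' (t - τ) (f τ)) volume 0 t) ∧
    ContDiffOn ℝ 1 u (Icc 0 T) ∧ (∀ t ∈ Icc 0 T, u t ∈ D) ∧
    ContinuousOn (fun t => A (u t)) (Icc 0 T) ∧
    (∀ t ∈ Icc 0 T, derivWithin u (Icc 0 T) t = A (u t) + f t) ∧ u 0 = u₀ ∧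
    (∀ v : ℝ → H, ContDiffOn ℝ 1 v (Icc 0 T) → (∀ t ∈ Icc 0 T, v t ∈ D) →
      (∀ t ∈ Icc 0 T, derivWithin v (Icc 0 T) t = A (v t) + f t) → v 0 = u₀ →
      EqOn v u (Icc 0 T)) ∧
    c1Norm T u + (⨆ t : Icc (0 : ℝ) T, (‖u t‖ + ‖A (u t)‖)) ≤
      (2 * T + 5 + 2 * (T ^ (α : ℝ) / α)) * (‖u₀‖ + ‖A u₀‖ + holderNorm T α f) := by
  obtain ⟨M, hM⟩ := hf
  obtain ⟨S, B, hS⟩ := hR.exists_semigroup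
  have hα' : (0 : ℝ) < α := NNReal.coe_pos.2 hα
  have hSS : ∀ t, 0 ≤ t → ∀ x, S' t x = S t x := fun t ht x => hS'.eq hR hS hDA ht x
  set K := holderSeminorm T α f with hK
  have hK0 : 0 ≤ K := holderSeminorm_nonneg _ _ _
  -- Constant extension of `f` beyond `[0, T]`. The projection onto the interval is `1`-Lipschitz,
  -- so the Hölder constant is unchanged.
  set g : ℝ → H := fun t => f (projIcc 0 T hT.le t) with hg
  have hgf : ∀ t ∈ Icc 0 T, g t = f t := fun t ht => by simp [hg, projIcc_of_mem hT.le ht]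
  have hgH : ∀ s t, ‖g s - g t‖ ≤ K * |s - t| ^ (α : ℝ) := by
    intro s t
    refine (norm_sub_le_holderSeminorm hα hM (Subtype.coe_prop _) (Subtype.coe_prop _)).trans ?_
    refine mul_le_mul_of_nonneg_left (Real.rpow_le_rpow (abs_nonneg _) ?_ hα'.le) hK0
    exact abs_projIcc_sub_projIcc hT.le
  have hfc : ContinuousOn f (Icc 0 T) := hM.continuousOn hα
  have hgc : Continuous g := by
    have := (continuousOn_iff_continuous_domRestrict.1 hfc).comp (continuous_projIcc (h := hT.le))
    exact this
  have hfun : ∀ t ∈ Icc 0 T, EqOn (fun τ => S' (t - τ) (f τ)) (fun τ => S (t - τ) (g τ))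
      (uIcc 0 t) := by
    intro t ht τ hτ
    rw [uIcc_of_le ht.1] at hτ
    simp only
    rw [hSS _ (sub_nonneg.2 hτ.2), hgf τ ⟨hτ.1, hτ.2.trans ht.2⟩]
  have hcont : ∀ t, Continuous fun τ => S (t - τ) (g τ) := fun t =>
    hS.continuous_uncurry.comp ((continuous_const.sub continuous_id).prodMk hgc)
  set A₀ := A u₀ with hA₀
  have hu₀A : IsGen R u₀ A₀ := (hDA _ _).1 ⟨hu₀, rfl⟩
  set U : ℝ → H := fun t => S t u₀ + duhamel S g t with hU
  have huU : ∀ t ∈ Icc 0 T, u t = U t := by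
    intro t ht
    rw [hu, hSS t ht.1, intervalIntegral.integral_congr (hfun t ht), hU]
    congr 1
    rw [duhamel]
    have := intervalIntegral.integral_comp_sub_left (fun s => S s (g (t - s))) t (a := 0) (b := t)
    simpa using this
  -- The value of `A` along the solution, with the singular and the exact part of the Duhamel term
  -- shown separately; each summand is continuous on `[0, T]`.
  set W : ℝ → H := fun t => S t A₀ + (singularPart B g t + (S t (g t) - g t)) with hW
  have hgen : ∀ t, 0 ≤ t → IsGen R (U t) (W t) := fun t ht =>
    (hS.isGen hu₀A t).add (hS.isGen_duhamel hR hα' hgc hgH ht)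
  have hAu : ∀ t ∈ Icc 0 T, u t ∈ D ∧ A (u t) = W t := fun t ht => by
    rw [huU t ht]
    exact (hDA _ _).2 (hgen t ht.1)
  have hWc : ContinuousOn W (Icc 0 T) :=
    (hS.cont A₀).continuousOn.add ((hS.continuousOn_singularPart hR hα' hgc hgH hT.le).add
      ((hS.continuous_uncurry.comp (continuous_id.prodMk hgc)).sub hgc).continuousOn)
  have hUc : Continuous U := (hS.cont u₀).add (hS.continuous_duhamel hgc)
  have hUr : ∀ t, 0 ≤ t → HasDerivWithinAt U (W t + g t) (Ici t) t := by
    intro t ht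
    have h1 := (hS.hasDerivWithinAt hu₀A ht).add
      (hS.hasDerivWithinAt_duhamel hgc ht (hS.isGen_duhamel hR hα' hgc hgH ht))
    rw [← add_assoc] at h1
    exact h1
  have hUd : ∀ t ∈ Icc 0 T, HasDerivWithinAt U (W t + g t) (Icc 0 T) t := fun t ht =>
    hasDerivWithinAt_of_right (g := fun t => W t + g t) hUc.continuousOn
      (hWc.add hgc.continuousOn) (fun s hs => hUr s hs.1) ht
  have hud : ∀ t ∈ Icc 0 T, HasDerivWithinAt u (W t + g t) (Icc 0 T) t := fun t ht =>
    (hUd t ht).congr huU (huU t ht)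
  have huniq := uniqueDiffOn_Icc hT
  have hder : ∀ t ∈ Icc 0 T, derivWithin u (Icc 0 T) t = A (u t) + f t := fun t ht => by
    rw [(hud t ht).derivWithin (huniq t ht), (hAu t ht).2, hgf t ht]
  have hu0 : u 0 = u₀ := by
    rw [huU 0 ⟨le_rfl, hT.le⟩, hU]
    simp [hS.of_nonpos 0 le_rfl, duhamel]
  refine ⟨fun t ht => ?_, ?_, fun t ht => (hAu t ht).1, hWc.congr fun t ht => (hAu t ht).2,
    hder, hu0, fun v hv hvD hvd hv0 t ht => ?_, ?_⟩
  · refine ((hcont t).intervalIntegrable 0 t).congr fun τ hτ => ?_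
    exact (hfun t ht (uIoc_subset_uIcc hτ)).symm
  · rw [contDiffOn_one_iff_derivWithin huniq]
    refine ⟨fun t ht => (hud t ht).differentiableWithinAt, ?_⟩
    exact (hWc.add hgc.continuousOn).congr fun t ht => (hud t ht).derivWithin (huniq t ht)
  · have hvd' : ∀ t ∈ Icc 0 T, HasDerivWithinAt v (A (v t) + f t) (Icc 0 T) t := fun t ht => by
      rw [← hvd t ht]
      exact (hv.differentiableOn one_ne_zero t ht).hasDerivWithinAt
    have hIci : ∀ t ∈ Ico 0 T, Icc 0 T ∈ 𝓝[Ici t] t := fun t ht =>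
      mem_nhdsWithin.2 ⟨Iio T, isOpen_Iio, ht.2, fun s hs => ⟨ht.1.trans hs.2, le_of_lt hs.1⟩⟩
    have := hR.eq_zero_of_hasDerivWithinAt (T := T) (w := fun s => v s - u s)
      (w' := fun s => A (v s) - W s) (hv.continuousOn.sub (hUc.continuousOn.congr huU))
      (fun s hs => ?_) (fun s hs => ?_) (by simp [hv0, hu0]) ht
    · exact sub_eq_zero.1 this
    · have hs' : s ∈ Icc 0 T := ⟨hs.1, hs.2.le⟩
      have h1 := (hvd' s hs').sub (hud s hs')
      rw [hgf s hs', add_sub_add_right_eq_sub] at h1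
      exact h1.mono_of_mem_nhdsWithin (hIci s hs)
    · have hs' : s ∈ Icc 0 T := ⟨hs.1, hs.2.le⟩
      have h1 := (hDA _ _).1 ⟨hvD s hs', rfl⟩
      have h2 := hgen s hs.1
      rw [← huU s hs'] at h2
      exact h1.sub h2
  · set F := supNorm T f with hF
    have hFt : ∀ t ∈ Icc 0 T, ‖f t‖ ≤ F := fun t ht => norm_le_supNorm hfc ht
    have hF0 : 0 ≤ F := (norm_nonneg _).trans (hFt 0 ⟨le_rfl, hT.le⟩)
    have hgF : ∀ t, ‖g t‖ ≤ F := fun t => hFt _ (Subtype.coe_prop _)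
    have hb1 : ∀ t ∈ Icc 0 T, ‖u t‖ ≤ ‖u₀‖ + T * F := by
      intro t ht
      rw [huU t ht, hU]
      refine (norm_add_le _ _).trans (add_le_add (hS.norm_le _ _) ?_)
      have := intervalIntegral.norm_integral_le_of_norm_le_const (a := 0) (b := t) (C := F)
        (f := fun s => S s (g (t - s))) fun s _ => (hS.norm_le _ _).trans (hgF _)
      rw [sub_zero, abs_of_nonneg ht.1] at this
      refine this.trans ?_
      rw [mul_comm]
      gcongr
      exact ht.2
    have hb2 : ∀ t ∈ Icc 0 T, ‖A (u t)‖ ≤ ‖A₀‖ + K * (T ^ (α : ℝ) / α) + 2 * F := by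
      intro t ht
      rw [(hAu t ht).2, hW]
      have h1 : ‖singularPart B g t‖ ≤ K * (T ^ (α : ℝ) / α) := by
        refine (hS.norm_singularPart_le hα' hgH ht.1).trans ?_
        have : t ^ (α : ℝ) ≤ T ^ (α : ℝ) := Real.rpow_le_rpow ht.1 ht.2 hα'.le
        gcongr
      have h2 : ‖S t (g t) - g t‖ ≤ F + F :=
        (norm_sub_le _ _).trans (add_le_add ((hS.norm_le _ _).trans (hgF t)) (hgF t))
      have h3 := norm_add_le (S t A₀) (singularPart B g t + (S t (g t) - g t))
      have h4 := norm_add_le (singularPart B g t) (S t (g t) - g t)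
      have h5 := hS.norm_le t A₀
      simp only
      linarith
    -- The two norms together contain twice the bound for `u`, twice the bound for `A u`, and once
    -- the bound for `f`. The supremum norm of `f` thus gets the coefficient `2T + 5` and its
    -- seminorm `2 T^α / α`.
    have hc1 : c1Norm T u ≤ (‖u₀‖ + T * F) + (‖A₀‖ + K * (T ^ (α : ℝ) / α) + 2 * F + F) := by
      refine add_le_add (supNorm_le hT.le hb1) (supNorm_le hT.le fun t ht => ?_)
      rw [hder t ht]
      exact (norm_add_le _ _).trans (add_le_add (hb2 t ht) (hFt t ht))
    have hc0 : (⨆ t : Icc (0 : ℝ) T, (‖u t‖ + ‖A (u t)‖))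
        ≤ (‖u₀‖ + T * F) + (‖A₀‖ + K * (T ^ (α : ℝ) / α) + 2 * F) := by
      have : Nonempty (Icc (0 : ℝ) T) := ⟨⟨0, le_rfl, hT.le⟩⟩
      exact ciSup_le fun t => add_le_add (hb1 t t.2) (hb2 t t.2)
    have hH : holderNorm T α f = F + K := rfl
    rw [hH]
    have hq : 0 ≤ T ^ (α : ℝ) / α := by positivity
    have p1 := mul_nonneg hT.le (norm_nonneg u₀)
    have p2 := mul_nonneg hT.le (norm_nonneg A₀)
    have p3 := mul_nonneg hT.le hK0
    have p4 := mul_nonneg hq (norm_nonneg u₀)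
    have p5 := mul_nonneg hq (norm_nonneg A₀)
    have p6 := mul_nonneg hq hF0
    nlinarith [norm_nonneg u₀, norm_nonneg A₀]

end StrictSolution

/-! ### Self-adjoint operators from closed maps -/

section ClosedForm

variable {H K : Type*} [NormedAddCommGroup H] [InnerProductSpace ℝ H] [CompleteSpace H]
  [NormedAddCommGroup K] [InnerProductSpace ℝ K] [CompleteSpace K]

/-- The operator `-J* J` of a densely defined closed operator `J` with graph `Γ`. -/
theorem exists_resolvent_of_closed (Γ : Submodule ℝ (WithLp 2 (H × K)))
    (hΓ : IsClosed (Γ : Set (WithLp 2 (H × K)))) (hd : Dense {u : H | ∃ p ∈ Γ, p.fst = u}) :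
    ∃ R : H →L[ℝ] H, IsResolvent R ∧ ∀ u w, IsGen R u w ↔
      ∃ p ∈ Γ, p.fst = u ∧ ∀ q ∈ Γ, inner ℝ p.snd q.snd = inner ℝ (-w) q.fst := by
  have : CompleteSpace Γ := hΓ.completeSpace_coe
  -- Von Neumann's argument: if `(u, J u)` is the projection of `(x, 0)` onto the graph of `J`,
  -- orthogonality says `⟨u, v⟩ + ⟨J u, J v⟩ = ⟨x, v⟩` for every `v` in the domain. This is the weak
  -- form of `(1 + J*J) u = x`, so `R x` is the first component.
  set P := Γ.starProjection with hP
  set ι : H →L[ℝ] WithLp 2 (H × K) :=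
    (WithLp.prodContinuousLinearEquiv 2 ℝ H K).symm.toContinuousLinearMap ∘L
      ContinuousLinearMap.inl ℝ H K with hι
  have hι1 : ∀ x, (ι x).fst = x := fun x => rfl
  have hι2 : ∀ x, (ι x).snd = 0 := fun x => rfl
  set R : H →L[ℝ] H := ContinuousLinearMap.fst ℝ H K ∘L
    (WithLp.prodContinuousLinearEquiv 2 ℝ H K).toContinuousLinearMap ∘L P ∘L ι with hRdef
  have hR : ∀ x, R x = (P (ι x)).fst := fun x => rfl
  have hin : ∀ x p, inner ℝ (ι x) p = inner ℝ x p.fst := fun x p => by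
    rw [WithLp.prod_inner_apply]; simp [hι1, hι2]
  have hin' : ∀ x p, inner ℝ p (ι x) = inner ℝ p.fst x := fun x p => by
    rw [real_inner_comm, hin, real_inner_comm]
  have hsymm : ∀ x y, inner ℝ (R x) y = inner ℝ x (R y) := fun x y => by
    rw [hR, hR, ← hin', ← hin]
    exact Submodule.inner_starProjection_left_eq_right Γ _ _
  have hsq : ∀ x, inner ℝ (R x) x = ‖P (ι x)‖ ^ 2 := fun x => by
    rw [hR, ← hin', ← real_inner_self_eq_norm_sq]
    have h1 : P (P (ι x)) = P (ι x) :=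
      Submodule.starProjection_eq_self_iff.2 (Submodule.starProjection_apply_mem Γ _)
    conv_lhs => rw [← h1]
    exact Submodule.inner_starProjection_left_eq_right Γ _ _
  have horth : ∀ x, ∀ q ∈ Γ, inner ℝ (P (ι x)) q = inner ℝ x q.fst := fun x q hq => by
    have := Submodule.starProjection_inner_eq_zero (K := Γ) (ι x) q hq
    rw [inner_sub_left, hin, sub_eq_zero] at this
    exact this.symm
  refine ⟨R, ⟨hsymm, fun x => ?_, ?_⟩, fun u w => ⟨fun h => ?_, ?_⟩⟩
  · rw [hsq, hR]
    gcongr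
    exact WithLp.norm_fst_le _ (P (ι x))
  -- A vector `y` orthogonal to the range satisfies `R y = 0`, hence `‖P (y, 0)‖² = ⟨R y, y⟩ = 0`.
  -- Then `y` is orthogonal to the domain of the form, which is dense.
  · have hrange : R.range.topologicalClosure = ⊤ := by
      rw [Submodule.topologicalClosure_eq_top_iff, Submodule.eq_bot_iff]
      intro y hy
      have h1 : R y = 0 := by
        refine ext_inner_left ℝ fun x => ?_
        rw [← hsymm, inner_zero_right]
        exact (Submodule.mem_orthogonal _ _).1 hy _ ⟨x, rfl⟩
      have h2 : P (ι y) = 0 := by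
        have := hsq y
        rw [h1, inner_zero_left] at this
        exact norm_eq_zero.1 (pow_eq_zero_iff two_ne_zero |>.1 this.symm)
      have h3 : ∀ v, inner ℝ y v = 0 := fun v => by
        refine hd.induction (P := fun v => inner ℝ y v = 0) ?_
          (isClosed_eq (by fun_prop) continuous_const) v
        rintro _ ⟨q, hq, rfl⟩
        rw [← horth y q hq, h2, inner_zero_left]
      exact inner_self_eq_zero.1 (h3 y)
    exact Submodule.dense_iff_topologicalClosure_eq_top.2 hrange
  · refine ⟨P (ι (u - w)), Submodule.starProjection_apply_mem Γ _, h.symm, fun q hq => ?_⟩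
    have h1 := horth (u - w) q hq
    rw [WithLp.prod_inner_apply] at h1
    have h2 : (P (ι (u - w))).fst = u := h.symm
    have h3 : inner ℝ u q.fst + inner ℝ (P (ι (u - w))).snd q.snd = inner ℝ (u - w) q.fst := by
      rw [← h1]; congr 2
    rw [inner_sub_left] at h3
    rw [inner_neg_left]
    linarith
  · rintro ⟨p, hp, rfl, hq⟩
    -- The weak equation says precisely that `(u - w, 0) - p` is orthogonal to the graph, which
    -- characterizes `p` as the projection.
    have h1 : P (ι (p.fst - w)) = p := by
      refine Submodule.eq_starProjection_of_mem_of_inner_eq_zero hp fun q hqΓ => ?_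
      rw [inner_sub_left, hin, WithLp.prod_inner_apply]
      have h2 : inner ℝ p.snd q.snd = inner ℝ (-w) q.fst := hq q hqΓ
      have h3 : inner ℝ (p.fst - w) q.fst - (inner ℝ p.fst q.fst + inner ℝ p.snd q.snd) = 0 := by
        rw [h2, inner_sub_left, inner_neg_left]; ring
      exact h3
    unfold IsGen
    rw [hR, h1]

end ClosedForm

/-! ### Weak derivatives on an interval -/

section OneDimensional

lemma exists_Icc_of_isCompact_subset_Ioo {ℓ : ℝ} (hℓ : 0 < ℓ) {K : Set ℝ} (hK : IsCompact K)
    (h : K ⊆ Ioo 0 ℓ) : ∃ a b, 0 < a ∧ a ≤ b ∧ b < ℓ ∧ K ⊆ Icc a b := by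
  -- Inserting the midpoint provides a minimum and a maximum even when `K` is empty.
  have hK' : IsCompact (insert (ℓ / 2) K) := hK.insert _
  have hs : insert (ℓ / 2) K ⊆ Ioo 0 ℓ := insert_subset ⟨by linarith, by linarith⟩ h
  obtain ⟨a, ha, ha'⟩ := hK'.exists_isLeast ⟨_, mem_insert _ _⟩
  obtain ⟨b, hb, hb'⟩ := hK'.exists_isGreatest ⟨_, mem_insert _ _⟩
  exact ⟨a, b, (hs ha).1, ha' hb, (hs hb).2, fun x hx =>
    ⟨ha' (mem_insert_of_mem _ hx), hb' (mem_insert_of_mem _ hx)⟩⟩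

/-- A smooth function with vanishing integral is the derivative of a test function. -/
lemma exists_testFunction_deriv {ℓ : ℝ} (hℓ : 0 < ℓ) {θ : ℝ → ℝ} (hθ : ContDiff ℝ ∞ θ)
    (hc : HasCompactSupport θ) (hs : tsupport θ ⊆ Ioo 0 ℓ) (h0 : ∫ s, θ s = 0) :
    ∃ φ : ℝ → ℝ, ContDiff ℝ ∞ φ ∧ HasCompactSupport φ ∧ tsupport φ ⊆ Ioo 0 ℓ ∧ deriv φ = θ := by
  obtain ⟨a, b, ha, hab, hb, hsub⟩ := exists_Icc_of_isCompact_subset_Ioo hℓ hc.isCompact hs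
  have hz : ∀ s, s ∉ Icc a b → θ s = 0 := fun s hs' =>
    image_eq_zero_of_notMem_tsupport fun h => hs' (hsub h)
  set φ : ℝ → ℝ := fun s => ∫ r in (0 : ℝ)..s, θ r with hφ
  have hd : ∀ s, HasDerivAt φ (θ s) s := fun s =>
    (hθ.continuous.integral_hasStrictDerivAt 0 s).hasDerivAt
  have hderiv : deriv φ = θ := funext fun s => (hd s).deriv
  have hts : tsupport φ ⊆ Icc a b := by
    refine closure_minimal (fun s hs' => ?_) isClosed_Icc
    by_contra hn
    refine hs' ?_
    rw [hφ]
    simp only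
    rcases not_and_or.1 hn with h | h
    · push Not at h
      refine intervalIntegral.integral_zero_ae (Eventually.of_forall fun r hr => hz r fun hr' => ?_)
      have := (mem_uIoc.1 hr)
      rcases this with h1 | h1 <;> linarith [hr'.1, h1.1, h1.2]
    · push Not at h
      rw [intervalIntegral.integral_eq_integral_of_support_subset, h0]
      intro r hr
      have : r ∈ Icc a b := by
        by_contra hn'
        exact hr (hz r hn')
      exact ⟨ha.trans_le this.1, this.2.trans h.le⟩
  refine ⟨φ, ?_, isCompact_Icc.of_isClosed_subset (isClosed_tsupport _) hts, hts.trans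
    (fun s h => ⟨ha.trans_le h.1, h.2.trans_lt hb⟩), hderiv⟩
  rw [contDiff_infty_iff_deriv, hderiv]
  exact ⟨fun s => (hd s).differentiableAt, hθ⟩

lemma exists_testFunction_integral_one {ℓ : ℝ} (hℓ : 0 < ℓ) :
    ∃ η : ℝ → ℝ, ContDiff ℝ ∞ η ∧ HasCompactSupport η ∧ tsupport η ⊆ Ioo 0 ℓ ∧ ∫ s, η s = 1 := by
  let β : ContDiffBump (ℓ / 2) := ⟨ℓ / 8, ℓ / 4, by positivity, by linarith⟩
  refine ⟨β.normed volume, β.contDiff_normed, β.hasCompactSupport_normed, ?_, β.integral_normed⟩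
  rw [β.tsupport_normed_eq, Real.closedBall_eq_Icc]
  intro s hs
  have h1 : ℓ / 2 - ℓ / 4 ≤ s := hs.1
  have h2 : s ≤ ℓ / 2 + ℓ / 4 := hs.2
  constructor <;> linarith

lemma setIntegral_eq_integral_of_tsupport {X : Type*} [TopologicalSpace X] [MeasurableSpace X]
    {μ : Measure X} {D : Set X} (F φ : X → ℝ) (h : tsupport φ ⊆ D) :
    ∫ x in D, F x * φ x ∂μ = ∫ x, F x * φ x ∂μ :=
  setIntegral_eq_integral_of_forall_compl_eq_zero fun x hx => by
    rw [image_eq_zero_of_notMem_tsupport fun h' => hx (h h'), mul_zero]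

/-- A function with vanishing weak derivative is constant. -/
lemma ae_eq_const_of_weakDeriv_eq_zero {ℓ : ℝ} (hℓ : 0 < ℓ) {G : ℝ → ℝ}
    (hG : IntegrableOn G (Ioo 0 ℓ))
    (h : ∀ φ : ℝ → ℝ, ContDiff ℝ ∞ φ → HasCompactSupport φ → tsupport φ ⊆ Ioo 0 ℓ →
      ∫ s in Ioo 0 ℓ, G s * deriv φ s = 0) : ∃ c, ∀ᵐ s, s ∈ Ioo 0 ℓ → G s = c := by
  obtain ⟨η, hη, hηc, hηs, hη1⟩ := exists_testFunction_integral_one hℓ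
  have hint : ∀ ψ : ℝ → ℝ, ContDiff ℝ ∞ ψ → HasCompactSupport ψ →
      IntegrableOn (fun s => G s * ψ s) (Ioo 0 ℓ) := fun ψ hψ hψc => by
    obtain ⟨C, hC⟩ := hψc.exists_bound_of_continuous hψ.continuous
    exact hG.mul_bdd hψ.continuous.aestronglyMeasurable (Eventually.of_forall hC)
  refine ⟨∫ s in Ioo 0 ℓ, G s * η s, ?_⟩
  set c := ∫ s in Ioo 0 ℓ, G s * η s with hc
  have hloc : LocallyIntegrableOn (fun s => G s - c) (Ioo 0 ℓ) :=
    (hG.sub (integrableOn_const (by simp))).locallyIntegrableOn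
  have := isOpen_Ioo.ae_eq_zero_of_integral_contDiff_smul_eq_zero hloc fun ψ hψ hψc hψs => ?_
  · filter_upwards [this] with s hs hs'
    exact sub_eq_zero.1 (hs hs')
  -- Subtracting a multiple of the fixed bump `η` gives `ψ` mean zero, hence makes it the derivative
  -- of a test function.
  set k := ∫ s, ψ s with hk
  have hθs : tsupport (fun s => ψ s - k * η s) ⊆ Ioo 0 ℓ := by
    refine (tsupport_sub _ _).trans (union_subset hψs ?_)
    exact (closure_mono (fun s hs => right_ne_zero_of_mul hs)).trans hηs
  have hψi : Integrable ψ := hψ.continuous.integrable_of_hasCompactSupport hψc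
  have hηi : Integrable η := hη.continuous.integrable_of_hasCompactSupport hηc
  obtain ⟨φ, hφ, hφc, hφs, hφd⟩ := exists_testFunction_deriv hℓ (θ := fun s => ψ s - k * η s)
    (hψ.sub (contDiff_const.mul hη)) (hψc.sub hηc.mul_left) hθs (by
      rw [integral_sub hψi (hηi.const_mul k), integral_const_mul, hη1, mul_one, sub_self])
  have h1 := h φ hφ hφc hφs
  rw [hφd] at h1
  have h2 : ∫ s in Ioo 0 ℓ, G s * (ψ s - k * η s)
      = (∫ s in Ioo 0 ℓ, G s * ψ s) - k * c := by
    rw [hc, ← integral_const_mul, ← integral_sub (hint ψ hψ hψc) ((hint η hη hηc).const_mul k)]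
    congr 1; ext s; ring
  rw [h2] at h1
  have h3 : ∫ s in Ioo 0 ℓ, ψ s = k :=
    setIntegral_eq_integral_of_forall_compl_eq_zero fun x hx =>
      image_eq_zero_of_notMem_tsupport fun h' => hx (hψs h')
  calc ∫ s, ψ s • (G s - c) = ∫ s, (G s - c) * ψ s := by simp only [smul_eq_mul, mul_comm]
    _ = ∫ s in Ioo 0 ℓ, (G s - c) * ψ s := (setIntegral_eq_integral_of_tsupport _ _ hψs).symm
    _ = (∫ s in Ioo 0 ℓ, G s * ψ s) - c * ∫ s in Ioo 0 ℓ, ψ s := by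
      rw [← integral_const_mul, ← integral_sub (hint ψ hψ hψc) (hψi.integrableOn.const_mul c)]
      congr 1; ext s; ring
    _ = 0 := by rw [h3]; linarith

/-- A primitive has the expected weak derivative. -/
lemma integral_primitive_mul_deriv {ℓ : ℝ} (hℓ : 0 < ℓ) {h : ℝ → ℝ}
    (hh : IntegrableOn h (Ioo 0 ℓ)) {φ : ℝ → ℝ} (hφ : ContDiff ℝ ∞ φ)
    (hφs : tsupport φ ⊆ Ioo 0 ℓ) :
    ∫ s in Ioo 0 ℓ, (∫ r in (0 : ℝ)..s, h r) * deriv φ s = -∫ s in Ioo 0 ℓ, h s * φ s := by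
  have hi : IntervalIntegrable h volume 0 ℓ := by
    rwa [intervalIntegrable_iff_integrableOn_Ioo_of_le hℓ.le]
  have h1 := (hi.absolutelyContinuousOnInterval_intervalIntegral
    (c := 0) left_mem_uIcc).integral_mul_deriv_eq_deriv_mul
    ((hφ.of_le (by exact_mod_cast le_top)).contDiffOn.absolutelyContinuousOnInterval (a := 0) (b := ℓ))
  have h0 : ∀ s, s ∉ Ioo 0 ℓ → φ s = 0 := fun s hs =>
    image_eq_zero_of_notMem_tsupport fun h' => hs (hφs h')
  rw [h0 ℓ (by simp), h0 0 (by simp), mul_zero, mul_zero, sub_zero, zero_sub] at h1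
  have h2 : ∫ s in (0 : ℝ)..ℓ, deriv (fun x => ∫ r in (0 : ℝ)..x, h r) s * φ s
      = ∫ s in (0 : ℝ)..ℓ, h s * φ s := by
    refine intervalIntegral.integral_congr_ae ?_
    filter_upwards [hi.ae_hasDerivAt_integral] with s hs hs'
    rw [(hs (uIoc_subset_uIcc hs') 0 left_mem_uIcc).deriv]
  rw [h2] at h1
  simpa [intervalIntegral.integral_of_le hℓ.le, integral_Ioc_eq_integral_Ioo] using h1

/-- A function with an integrable weak derivative is almost everywhere equal to its primitive. -/
lemma ae_eq_primitive_of_weakDeriv {ℓ : ℝ} (hℓ : 0 < ℓ) {g h : ℝ → ℝ}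
    (hg : IntegrableOn g (Ioo 0 ℓ)) (hh : IntegrableOn h (Ioo 0 ℓ))
    (hw : ∀ φ : ℝ → ℝ, ContDiff ℝ ∞ φ → HasCompactSupport φ → tsupport φ ⊆ Ioo 0 ℓ →
      ∫ s in Ioo 0 ℓ, g s * deriv φ s = -∫ s in Ioo 0 ℓ, h s * φ s) :
    ∃ c, ∀ᵐ s, s ∈ Ioo 0 ℓ → g s = c + ∫ r in (0 : ℝ)..s, h r := by
  have hi : IntervalIntegrable h volume 0 ℓ := by
    rwa [intervalIntegrable_iff_integrableOn_Ioo_of_le hℓ.le]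
  have hpc : ContinuousOn (fun s => ∫ r in (0 : ℝ)..s, h r) (Icc 0 ℓ) := by
    have := (hi.absolutelyContinuousOnInterval_intervalIntegral (c := 0) left_mem_uIcc).continuousOn
    rwa [uIcc_of_le hℓ.le] at this
  have hpi : IntegrableOn (fun s => ∫ r in (0 : ℝ)..s, h r) (Ioo 0 ℓ) :=
    (hpc.integrableOn_compact isCompact_Icc).mono_set Ioo_subset_Icc_self
  have key := ae_eq_const_of_weakDeriv_eq_zero hℓ (G := fun s => g s - ∫ r in (0 : ℝ)..s, h r)
    (hg.sub hpi) fun φ hφ hφc hφs => ?_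
  · obtain ⟨c, hc⟩ := key
    refine ⟨c, ?_⟩
    filter_upwards [hc] with s hs hs'
    rw [← hs hs']; ring
  · have hφd : Continuous (deriv φ) := hφ.continuous_deriv (by simp)
    obtain ⟨C, hC⟩ := hφc.deriv.exists_bound_of_continuous hφd
    have hm : ∀ F : ℝ → ℝ, IntegrableOn F (Ioo 0 ℓ) →
        IntegrableOn (fun s => F s * deriv φ s) (Ioo 0 ℓ) := fun F hF =>
      hF.mul_bdd hφd.aestronglyMeasurable (Eventually.of_forall hC)
    simp only [sub_mul]
    rw [integral_sub (hm _ hg) (hm _ hpi), hw φ hφ hφc hφs,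
      integral_primitive_mul_deriv hℓ hh hφ hφs, sub_self]

lemma IsWeakDeriv.integrableOn {ℓ : ℝ} {g h : ℝ → ℝ} (hw : IsWeakDeriv ℓ g h) :
    IntegrableOn h (Ioo 0 ℓ) := hw.1.integrable one_le_two

/-- The fundamental theorem of calculus for continuous `H¹` functions of one variable. -/
lemma IsWeakDeriv.sub_eq_integral {ℓ : ℝ} (hℓ : 0 < ℓ) {g h : ℝ → ℝ} (hw : IsWeakDeriv ℓ g h)
    (hg : ContinuousOn g (Icc 0 ℓ)) {s t : ℝ} (hs : s ∈ Icc 0 ℓ) (ht : t ∈ Icc 0 ℓ) :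
    g t - g s = ∫ r in s..t, h r := by
  have hh := hw.integrableOn
  have hi : IntervalIntegrable h volume 0 ℓ := by
    rwa [intervalIntegrable_iff_integrableOn_Ioo_of_le hℓ.le]
  have hpc : ContinuousOn (fun s => ∫ r in (0 : ℝ)..s, h r) (Icc 0 ℓ) := by
    have := (hi.absolutelyContinuousOnInterval_intervalIntegral (c := 0) left_mem_uIcc).continuousOn
    rwa [uIcc_of_le hℓ.le] at this
  obtain ⟨c, hc⟩ := ae_eq_primitive_of_weakDeriv hℓ
    ((hg.integrableOn_compact isCompact_Icc).mono_set Ioo_subset_Icc_self) hh hw.2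
  -- Two continuous functions equal almost everywhere agree on the open interval, and then at the
  -- end points by closure. The end points matter, since adjacent sides meet there.
  have heq : ∀ r ∈ Icc 0 ℓ, g r = c + ∫ x in (0 : ℝ)..r, h x := by
    have h1 : EqOn g (fun r => c + ∫ x in (0 : ℝ)..r, h x) (Ioo 0 ℓ) := by
      refine Measure.eqOn_open_of_ae_eq (μ := volume) ?_ isOpen_Ioo (hg.mono Ioo_subset_Icc_self)
        ((continuousOn_const.add hpc).mono Ioo_subset_Icc_self)
      exact (ae_restrict_iff' measurableSet_Ioo).2 hc
    have h2 := h1.of_subset_closure hg (continuousOn_const.add hpc) Ioo_subset_Icc_self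
      (by rw [closure_Ioo hℓ.ne])
    exact h2
  rw [heq s hs, heq t ht, add_sub_add_left_eq_sub]
  have hsub : ∀ r ∈ Icc 0 ℓ, IntervalIntegrable h volume 0 r := fun r hr =>
    hi.mono_set (by rw [uIcc_of_le hr.1, uIcc_of_le hℓ.le]; exact Icc_subset_Icc_right hr.2)
  exact intervalIntegral.integral_interval_sub_left (hsub t ht) (hsub s hs)

/-- Weak derivatives are unique. -/
lemma IsWeakDeriv.ae_eq {ℓ : ℝ} {g h h' : ℝ → ℝ} (hw : IsWeakDeriv ℓ g h)
    (hw' : IsWeakDeriv ℓ g h') : h =ᵐ[volume.restrict (Ioo 0 ℓ)] h' := by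
  have hloc : LocallyIntegrableOn (fun s => h s - h' s) (Ioo 0 ℓ) :=
    (hw.integrableOn.sub hw'.integrableOn).locallyIntegrableOn
  have := isOpen_Ioo.ae_eq_zero_of_integral_contDiff_smul_eq_zero hloc fun φ hφ hφc hφs => ?_
  · rw [EventuallyEq, ae_restrict_iff' measurableSet_Ioo]
    filter_upwards [this] with s hs hs'
    exact sub_eq_zero.1 (hs hs')
  · have h1 := (hw.2 φ hφ hφc hφs).symm.trans (hw'.2 φ hφ hφc hφs)
    obtain ⟨C, hC⟩ := hφc.exists_bound_of_continuous hφ.continuous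
    have hm : ∀ F : ℝ → ℝ, IntegrableOn F (Ioo 0 ℓ) →
        IntegrableOn (fun s => F s * φ s) (Ioo 0 ℓ) := fun F hF =>
      hF.mul_bdd hφ.continuous.aestronglyMeasurable (Eventually.of_forall hC)
    calc ∫ s, φ s • (h s - h' s) = ∫ s, (h s - h' s) * φ s := by simp only [smul_eq_mul, mul_comm]
      _ = ∫ s in Ioo 0 ℓ, (h s - h' s) * φ s := (setIntegral_eq_integral_of_tsupport _ _ hφs).symm
      _ = (∫ s in Ioo 0 ℓ, h s * φ s) - ∫ s in Ioo 0 ℓ, h' s * φ s := by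
        rw [← integral_sub (hm _ hw.integrableOn) (hm _ hw'.integrableOn)]
        simp only [sub_mul]
      _ = 0 := by linarith

lemma IsWeakDeriv.congr {ℓ : ℝ} {g g' h h' : ℝ → ℝ} (hw : IsWeakDeriv ℓ g h)
    (hg : g =ᵐ[volume.restrict (Ioo 0 ℓ)] g') (hh : h =ᵐ[volume.restrict (Ioo 0 ℓ)] h') :
    IsWeakDeriv ℓ g' h' := by
  refine ⟨hw.1.ae_eq hh, fun φ hφ hφc hφs => ?_⟩
  have h1 : ∫ s in Ioo 0 ℓ, g s * deriv φ s = ∫ s in Ioo 0 ℓ, g' s * deriv φ s :=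
    integral_congr_ae (hg.mul (EventuallyEq.refl _ (deriv φ)))
  have h2 : ∫ s in Ioo 0 ℓ, h s * φ s = ∫ s in Ioo 0 ℓ, h' s * φ s :=
    integral_congr_ae (hh.mul (EventuallyEq.refl _ φ))
  rw [← h1, ← h2]
  exact hw.2 φ hφ hφc hφs

end OneDimensional

/-! ### Algebra, uniqueness and closedness of weak derivatives -/

section WeakCalculus

lemma integrable_mul_of_memLp {X : Type*} [MeasurableSpace X] {μ : Measure X} {f g : X → ℝ}
    (hf : MemLp f 2 μ) (hg : MemLp g 2 μ) : Integrable (fun x => f x * g x) μ :=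
  hf.integrable_mul hg

/-- Continuity of the `L²` pairing. -/
lemma tendsto_integral_inner {X F : Type*} [MeasurableSpace X] {μ : Measure X}
    [NormedAddCommGroup F] [InnerProductSpace ℝ F] {f : ℕ → X → F} {g ψ : X → F}
    (hf : ∀ k, MemLp (f k) 2 μ) (hg : MemLp g 2 μ) (hψ : MemLp ψ 2 μ)
    (h : Tendsto (fun k => eLpNorm (f k - g) 2 μ) atTop (𝓝 0)) :
    Tendsto (fun k => ∫ x, inner ℝ (ψ x) (f k x) ∂μ) atTop (𝓝 (∫ x, inner ℝ (ψ x) (g x) ∂μ)) := by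
  have h1 : Tendsto (fun k => (hf k).toLp (f k)) atTop (𝓝 (hg.toLp g)) :=
    (Lp.tendsto_Lp_iff_tendsto_eLpNorm'' f hf g hg).2 h
  have hc : Continuous fun Φ : Lp F 2 μ => inner ℝ (hψ.toLp ψ) Φ := by fun_prop
  have h2 := (hc.tendsto (hg.toLp g)).comp h1
  have key : ∀ {φ : X → F} (hφ : MemLp φ 2 μ),
      inner ℝ (hψ.toLp ψ) (hφ.toLp φ) = ∫ x, inner ℝ (ψ x) (φ x) ∂μ := by
    intro φ hφ
    rw [L2.inner_def]
    refine integral_congr_ae ?_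
    filter_upwards [hψ.coeFn_toLp, hφ.coeFn_toLp] with x h1 h2
    rw [h1, h2]
  rw [← key hg]
  exact h2.congr fun k => key (hf k)

lemma tendsto_integral_mul {X : Type*} [MeasurableSpace X] {μ : Measure X}
    {f : ℕ → X → ℝ} {g ψ : X → ℝ}
    (hf : ∀ k, MemLp (f k) 2 μ) (hg : MemLp g 2 μ) (hψ : MemLp ψ 2 μ)
    (h : Tendsto (fun k => eLpNorm (f k - g) 2 μ) atTop (𝓝 0)) :
    Tendsto (fun k => ∫ x, f k x * ψ x ∂μ) atTop (𝓝 (∫ x, g x * ψ x ∂μ)) := by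
  simpa using tendsto_integral_inner hf hg hψ h

lemma memLp_testFunction {E : Type*} [NormedAddCommGroup E] [MeasurableSpace E] [BorelSpace E]
    {μ : Measure E} [IsFiniteMeasureOnCompacts μ] {φ : E → ℝ} (hφ : Continuous φ)
    (hc : HasCompactSupport φ) (D : Set E) : MemLp φ 2 (μ.restrict D) :=
  (hφ.memLp_of_hasCompactSupport hc).restrict D

lemma memLp_fderiv {φ : ℂ → ℝ} (hφ : ContDiff ℝ ∞ φ) (hc : HasCompactSupport φ) (D : Set ℂ)
    (e : ℂ) : MemLp (fun x => fderiv ℝ φ x e) 2 (volume.restrict D) := by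
  refine memLp_testFunction ((hφ.continuous_fderiv (by simp)).clm_apply continuous_const) ?_ D
  exact (hc.fderiv ℝ).comp_left (g := fun L : ℂ →L[ℝ] ℝ => L e) rfl

lemma memLp_deriv {φ : ℝ → ℝ} (hφ : ContDiff ℝ ∞ φ) (hc : HasCompactSupport φ) (D : Set ℝ) :
    MemLp (deriv φ) 2 (volume.restrict D) :=
  memLp_testFunction (hφ.continuous_deriv (by simp)) hc.deriv D

variable {D : Set ℂ} {u v : ℂ → ℝ} {G G' : ℂ → ℂ} {ℓ : ℝ} {g g' h h' : ℝ → ℝ}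

lemma IsWeakGrad.congr (hw : IsWeakGrad D u G) (hu : u =ᵐ[volume.restrict D] v)
    (hG : G =ᵐ[volume.restrict D] G') : IsWeakGrad D v G' := by
  refine ⟨hw.1.ae_eq hG, fun φ hφ hφc hφs e => ?_⟩
  have h1 : ∫ x in D, u x * fderiv ℝ φ x e = ∫ x in D, v x * fderiv ℝ φ x e :=
    integral_congr_ae (hu.mul (EventuallyEq.refl _ fun x => fderiv ℝ φ x e))
  have h2 : ∫ x in D, inner ℝ (G x) e * φ x = ∫ x in D, inner ℝ (G' x) e * φ x := by
    refine integral_congr_ae ?_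
    filter_upwards [hG] with x hx
    rw [hx]
  rw [← h1, ← h2]
  exact hw.2 φ hφ hφc hφs e

lemma IsWeakGrad.add (hu : MemLp u 2 (volume.restrict D)) (hv : MemLp v 2 (volume.restrict D))
    (hw : IsWeakGrad D u G) (hw' : IsWeakGrad D v G') :
    IsWeakGrad D (fun x => u x + v x) (fun x => G x + G' x) := by
  refine ⟨hw.1.add hw'.1, fun φ hφ hφc hφs e => ?_⟩
  have hφ2 := memLp_testFunction (μ := volume) hφ.continuous hφc D
  have hd2 := memLp_fderiv hφ hφc D e
  simp only [inner_add_left, add_mul]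
  rw [integral_add (integrable_mul_of_memLp hu hd2) (integrable_mul_of_memLp hv hd2),
    integral_add (integrable_mul_of_memLp (hw.1.inner_const e) hφ2)
      (integrable_mul_of_memLp (hw'.1.inner_const e) hφ2), hw.2 φ hφ hφc hφs e, hw'.2 φ hφ hφc hφs e, neg_add]

lemma IsWeakGrad.smul (hw : IsWeakGrad D u G) (c : ℝ) :
    IsWeakGrad D (fun x => c * u x) (fun x => c • G x) := by
  refine ⟨hw.1.const_smul c, fun φ hφ hφc hφs e => ?_⟩
  simp only [real_inner_smul_left, mul_assoc]
  rw [integral_const_mul, integral_const_mul, hw.2 φ hφ hφc hφs e, mul_neg]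

/-- For a fixed test function both sides of the defining identity are `L²` pairings with fixed
functions, so they pass to the limit. -/
lemma IsWeakGrad.of_tendsto {u : ℕ → ℂ → ℝ} {G : ℕ → ℂ → ℂ} (hw : ∀ k, IsWeakGrad D (u k) (G k))
    (hu : ∀ k, MemLp (u k) 2 (volume.restrict D)) (hv : MemLp v 2 (volume.restrict D))
    (hG' : MemLp G' 2 (volume.restrict D))
    (hlu : Tendsto (fun k => eLpNorm (u k - v) 2 (volume.restrict D)) atTop (𝓝 0))
    (hlG : Tendsto (fun k => eLpNorm (G k - G') 2 (volume.restrict D)) atTop (𝓝 0)) :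
    IsWeakGrad D v G' := by
  refine ⟨hG', fun φ hφ hφc hφs e => ?_⟩
  have h1 := tendsto_integral_mul hu hv (memLp_fderiv hφ hφc D e) hlu
  have hψ : MemLp (fun x => φ x • e) 2 (volume.restrict D) :=
    ((hφ.continuous.smul continuous_const).memLp_of_hasCompactSupport hφc.smul_right).restrict D
  have h2 := tendsto_integral_inner (fun k => (hw k).1) hG' hψ hlG
  have h3 : ∀ F : ℂ → ℂ, ∫ x in D, inner ℝ (φ x • e) (F x) = ∫ x in D, inner ℝ (F x) e * φ x := by
    intro F
    congr 1; ext x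
    rw [real_inner_smul_left, real_inner_comm, mul_comm]
  simp only [h3] at h2
  refine tendsto_nhds_unique h1 (h2.neg.congr fun k => ?_)
  exact ((hw k).2 φ hφ hφc hφs e).symm

lemma IsWeakGrad.ae_eq (hD : IsOpen D) (hw : IsWeakGrad D u G) (hw' : IsWeakGrad D u G') :
    G =ᵐ[volume.restrict D] G' := by
  have hm : ∀ {F : ℂ → ℂ}, MemLp F 2 (volume.restrict D) → LocallyIntegrableOn F D volume := by
    intro F hF
    exact locallyIntegrableOn_of_locallyIntegrable_restrict (hF.locallyIntegrable one_le_two)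
  have hloc : LocallyIntegrableOn (fun s => G s - G' s) D := (hm hw.1).sub (hm hw'.1)
  have := hD.ae_eq_zero_of_integral_contDiff_smul_eq_zero hloc fun φ hφ hφc hφs => ?_
  · rw [EventuallyEq, ae_restrict_iff' hD.measurableSet]
    filter_upwards [this] with s hs hs'
    exact sub_eq_zero.1 (hs hs')
  · have hφ2 := memLp_testFunction (μ := volume) hφ.continuous hφc D
    have e1 : ∫ x, φ x • (G x - G' x) = ∫ x in D, φ x • (G x - G' x) :=
      (setIntegral_eq_integral_of_forall_compl_eq_zero fun x hx => by
        rw [image_eq_zero_of_notMem_tsupport fun h' => hx (hφs h'), zero_smul]).symm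
    have hi : ∀ {F : ℂ → ℂ}, MemLp F 2 (volume.restrict D) →
        Integrable (fun x => φ x • F x) (volume.restrict D) := fun {F} hF =>
      memLp_one_iff_integrable.1 (hF.smul hφ2)
    rw [e1]
    -- The definition tests one direction at a time, so the vector-valued integral is recovered from
    -- its components.
    refine ext_inner_left ℝ fun e => ?_
    rw [← integral_inner (f := fun x => φ x • (G x - G' x)) (hi (hw.1.sub hw'.1)) e,
      inner_zero_right]
    have h1 := (hw.2 φ hφ hφc hφs e).symm.trans (hw'.2 φ hφ hφc hφs e)
    have h2 : ∀ x, inner ℝ e (φ x • (G x - G' x))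
        = inner ℝ (G x) e * φ x - inner ℝ (G' x) e * φ x := by
      intro x
      rw [real_inner_smul_right, inner_sub_right, real_inner_comm, real_inner_comm (G' x)]
      ring
    simp only [h2]
    rw [integral_sub (integrable_mul_of_memLp (hw.1.inner_const e) hφ2)
      (integrable_mul_of_memLp (hw'.1.inner_const e) hφ2)]
    linarith

lemma IsWeakDeriv.add (hg : MemLp g 2 (volume.restrict (Ioo 0 ℓ)))
    (hg' : MemLp g' 2 (volume.restrict (Ioo 0 ℓ))) (hw : IsWeakDeriv ℓ g h)
    (hw' : IsWeakDeriv ℓ g' h') : IsWeakDeriv ℓ (fun x => g x + g' x) (fun x => h x + h' x) := by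
  refine ⟨hw.1.add hw'.1, fun φ hφ hφc hφs => ?_⟩
  have hφ2 := memLp_testFunction (μ := volume) hφ.continuous hφc (Ioo 0 ℓ)
  have hd2 := memLp_deriv hφ hφc (Ioo 0 ℓ)
  simp only [add_mul]
  rw [integral_add (integrable_mul_of_memLp hg hd2) (integrable_mul_of_memLp hg' hd2),
    integral_add (integrable_mul_of_memLp hw.1 hφ2) (integrable_mul_of_memLp hw'.1 hφ2),
    hw.2 φ hφ hφc hφs, hw'.2 φ hφ hφc hφs, neg_add]

lemma IsWeakDeriv.smul (hw : IsWeakDeriv ℓ g h) (c : ℝ) :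
    IsWeakDeriv ℓ (fun x => c * g x) (fun x => c * h x) := by
  refine ⟨hw.1.const_mul c, fun φ hφ hφc hφs => ?_⟩
  simp only [mul_assoc]
  rw [integral_const_mul, integral_const_mul, hw.2 φ hφ hφc hφs, mul_neg]

lemma IsWeakDeriv.of_tendsto {g h : ℕ → ℝ → ℝ} (hw : ∀ k, IsWeakDeriv ℓ (g k) (h k))
    (hg : ∀ k, MemLp (g k) 2 (volume.restrict (Ioo 0 ℓ)))
    (hg' : MemLp g' 2 (volume.restrict (Ioo 0 ℓ))) (hh' : MemLp h' 2 (volume.restrict (Ioo 0 ℓ)))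
    (hlg : Tendsto (fun k => eLpNorm (g k - g') 2 (volume.restrict (Ioo 0 ℓ))) atTop (𝓝 0))
    (hlh : Tendsto (fun k => eLpNorm (h k - h') 2 (volume.restrict (Ioo 0 ℓ))) atTop (𝓝 0)) :
    IsWeakDeriv ℓ g' h' := by
  refine ⟨hh', fun φ hφ hφc hφs => ?_⟩
  have h1 := tendsto_integral_mul hg hg' (memLp_deriv hφ hφc _) hlg
  have h2 := tendsto_integral_mul (fun k => (hw k).1) hh'
    (memLp_testFunction (μ := volume) hφ.continuous hφc _) hlh
  refine tendsto_nhds_unique h1 (h2.neg.congr fun k => ?_)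
  exact ((hw k).2 φ hφ hφc hφs).symm

end WeakCalculus

/-! ### The sides of the prefractal as similar copies of the unit segment -/

section Geometry

lemma exp_I_pi_div_three :
    Complex.exp (Complex.I * (Real.pi / 3)) = ⟨1 / 2, Real.sqrt 3 / 2⟩ := by
  rw [mul_comm, show ((Real.pi : ℂ) / 3) = ((Real.pi / 3 : ℝ) : ℂ) by push_cast; ring]
  apply Complex.ext
  · rw [Complex.exp_ofReal_mul_I_re, Real.cos_pi_div_three]
  · rw [Complex.exp_ofReal_mul_I_im, Real.sin_pi_div_three]

lemma exp_neg_I_pi_div_three :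
    Complex.exp (-(Complex.I * (Real.pi / 3))) = ⟨1 / 2, -(Real.sqrt 3 / 2)⟩ := by
  rw [show -(Complex.I * ((Real.pi : ℂ) / 3)) = ((-(Real.pi / 3) : ℝ) : ℂ) * Complex.I by
    push_cast; ring]
  apply Complex.ext
  · rw [Complex.exp_ofReal_mul_I_re, Real.cos_neg, Real.cos_pi_div_three]
  · rw [Complex.exp_ofReal_mul_I_im, Real.sin_neg, Real.sin_pi_div_three]

lemma sqrt_three_mul_self : Real.sqrt 3 * Real.sqrt 3 = 3 := Real.mul_self_sqrt (by norm_num)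

lemma sqrt_three_pos : 0 < Real.sqrt 3 := by positivity

lemma contraction_zero_re (z : ℂ) : (contraction 0 z).re = z.re / 3 := by
  simp [contraction]

lemma contraction_zero_im (z : ℂ) : (contraction 0 z).im = z.im / 3 := by
  simp [contraction]

lemma contraction_three_re (z : ℂ) : (contraction 3 z).re = 2 / 3 + z.re / 3 := by
  simp [contraction]

lemma contraction_three_im (z : ℂ) : (contraction 3 z).im = z.im / 3 := by
  simp [contraction]

lemma contraction_one_re (z : ℂ) :
    (contraction 1 z).re = 1 / 3 + (z.re - Real.sqrt 3 * z.im) / 6 := by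
  simp [contraction, exp_I_pi_div_three]; ring

lemma contraction_one_im (z : ℂ) :
    (contraction 1 z).im = (Real.sqrt 3 * z.re + z.im) / 6 := by
  simp [contraction, exp_I_pi_div_three]; ring

lemma contraction_two_re (z : ℂ) :
    (contraction 2 z).re = 1 / 2 + (z.re + Real.sqrt 3 * z.im) / 6 := by
  simp [contraction, exp_I_pi_div_three, exp_neg_I_pi_div_three]; ring

lemma contraction_two_im (z : ℂ) :
    (contraction 2 z).im = (Real.sqrt 3 * (1 - z.re) + z.im) / 6 := by
  simp [contraction, exp_I_pi_div_three, exp_neg_I_pi_div_three]; ring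

lemma exists_contraction (k : Fin 4) : ∃ c d : ℂ, ‖d‖ = 3⁻¹ ∧ ∀ z, contraction k z = c + d * z := by
  have h1 : ‖Complex.exp (Complex.I * (Real.pi / 3))‖ = 1 := by
    rw [mul_comm, show ((Real.pi : ℂ) / 3) = ((Real.pi / 3 : ℝ) : ℂ) by push_cast; ring]
    exact Complex.norm_exp_ofReal_mul_I _
  have h2 : ‖Complex.exp (-(Complex.I * (Real.pi / 3)))‖ = 1 := by
    rw [show -(Complex.I * ((Real.pi : ℂ) / 3)) = ((-(Real.pi / 3) : ℝ) : ℂ) * Complex.I by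
      push_cast; ring]
    exact Complex.norm_exp_ofReal_mul_I _
  fin_cases k
  · exact ⟨0, 3⁻¹, by simp, fun z => by simp [contraction]; ring⟩
  · exact ⟨1 / 3, Complex.exp (Complex.I * (Real.pi / 3)) * 3⁻¹, by rw [norm_mul, h1]; simp,
      fun z => by simp [contraction]; ring⟩
  · exact ⟨1 / 3 + Complex.exp (Complex.I * (Real.pi / 3)) / 3,
      Complex.exp (-(Complex.I * (Real.pi / 3))) * 3⁻¹, by rw [norm_mul, h2]; simp,
      fun z => by simp only [contraction]; ring⟩
  · exact ⟨2 / 3, 3⁻¹, by simp, fun z => by simp [contraction]; ring⟩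

lemma exists_wordMap (n : ℕ) (w : Fin n → Fin 4) :
    ∃ c d : ℂ, ‖d‖ = (3 ^ n)⁻¹ ∧ ∀ z, wordMap n w z = c + d * z := by
  induction n with
  | zero => exact ⟨0, 1, by simp, fun z => by simp [wordMap]⟩
  | succ n ih =>
    obtain ⟨c, d, hd, h⟩ := ih (Fin.tail w)
    obtain ⟨c', d', hd', h'⟩ := exists_contraction (w 0)
    refine ⟨c' + d' * c, d' * d, ?_, fun z => ?_⟩
    · rw [norm_mul, hd, hd', pow_succ, mul_inv, mul_comm]
    · simp only [wordMap, Function.comp_apply, h, h']; ring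

/-- The recursion defining `wordMap` peels off the outermost contraction, whereas refining a given
side means composing on the inside. This exchange lets one compare successive generations. -/
lemma wordMap_snoc (n : ℕ) (w : Fin n → Fin 4) (k : Fin 4) (z : ℂ) :
    wordMap (n + 1) (Fin.snoc w k : Fin (n + 1) → Fin 4) z = wordMap n w (contraction k z) := by
  induction n with
  | zero => simp [wordMap, Fin.snoc]
  | succ n ih =>
    have h0 : (Fin.snoc w k : Fin (n + 2) → Fin 4) 0 = w 0 := by
      exact Fin.snoc_castSucc (α := fun _ => Fin 4) k w 0
    have h1 : Fin.tail (Fin.snoc w k : Fin (n + 2) → Fin 4)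
        = (Fin.snoc (Fin.tail w) k : Fin (n + 1) → Fin 4) := by
      ext j
      refine Fin.lastCases ?_ (fun j => ?_) j
      · simp [Fin.tail, Fin.snoc]
      · simp only [Fin.snoc_castSucc, Fin.tail, ← Fin.castSucc_succ]
    have h2 : wordMap (n + 2) (Fin.snoc w k : Fin (n + 2) → Fin 4) z
        = contraction ((Fin.snoc w k : Fin (n + 2) → Fin 4) 0)
          (wordMap (n + 1) (Fin.tail (Fin.snoc w k : Fin (n + 2) → Fin 4)) z) := rfl
    rw [h2, h0, h1, ih]
    rfl

/-- The similarity which maps `[0, 1]` to a side. -/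
noncomputable def sideMap (n : ℕ) (i : SideIndex n) (z : ℂ) : ℂ := rotate i.1 (wordMap n i.2 z)

lemma sideMap_snoc (n : ℕ) (i : SideIndex n) (k : Fin 4) (z : ℂ) :
    sideMap (n + 1) (i.1, (Fin.snoc i.2 k : Fin (n + 1) → Fin 4)) z
      = sideMap n i (contraction k z) := by
  simp [sideMap, wordMap_snoc]

lemma exists_snoc (n : ℕ) (i : SideIndex (n + 1)) :
    ∃ (j : SideIndex n) (k : Fin 4), i = (j.1, (Fin.snoc j.2 k : Fin (n + 1) → Fin 4)) :=
  ⟨(i.1, Fin.init i.2), i.2 (Fin.last n), by simp [Fin.snoc_init_self]⟩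

lemma exists_sideMap (n : ℕ) (i : SideIndex n) :
    ∃ p e : ℂ, ‖e‖ = 1 ∧ (∀ z, sideMap n i z = p + e * ((3 ^ n)⁻¹ * z)) ∧
      ∀ s : ℝ, sideParam n i s = p + e * s := by
  obtain ⟨c, d, hd, h⟩ := exists_wordMap n i.2
  set ρ := Complex.exp (Complex.I * (2 * Real.pi * ((i.1 : ℕ) : ℂ) / 3)) with hρ
  have hρ1 : ‖ρ‖ = 1 := by
    rw [hρ, show Complex.I * (2 * (Real.pi : ℂ) * ((i.1 : ℕ) : ℂ) / 3)
      = ((2 * Real.pi * ((i.1 : ℕ) : ℝ) / 3 : ℝ) : ℂ) * Complex.I by push_cast; ring]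
    exact Complex.norm_exp_ofReal_mul_I _
  have h3 : (3 : ℂ) ^ n ≠ 0 := pow_ne_zero n (by norm_num)
  have hmap : ∀ z, sideMap n i z = (center + ρ * (c - center)) + (ρ * d * 3 ^ n) * ((3 ^ n)⁻¹ * z) := by
    intro z
    rw [sideMap, rotate, h, ← hρ]
    field_simp
    ring
  refine ⟨center + ρ * (c - center), ρ * d * 3 ^ n, ?_, hmap, fun s => ?_⟩
  · rw [norm_mul, norm_mul, hρ1, hd]
    simp
  · have : sideParam n i s = sideMap n i (((3 : ℝ) ^ n * s : ℝ) : ℂ) := rfl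
    rw [this, hmap]
    push_cast
    field_simp

/-- The starting point of a side. -/
noncomputable def sideBase (n : ℕ) (i : SideIndex n) : ℂ := (exists_sideMap n i).choose

/-- The unit tangent of a side. -/
noncomputable def sideDir (n : ℕ) (i : SideIndex n) : ℂ := (exists_sideMap n i).choose_spec.choose

lemma norm_sideDir (n : ℕ) (i : SideIndex n) : ‖sideDir n i‖ = 1 :=
  (exists_sideMap n i).choose_spec.choose_spec.1

lemma sideMap_eq (n : ℕ) (i : SideIndex n) (z : ℂ) :
    sideMap n i z = sideBase n i + sideDir n i * ((3 ^ n)⁻¹ * z) :=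
  (exists_sideMap n i).choose_spec.choose_spec.2.1 z

lemma sideParam_eq (n : ℕ) (i : SideIndex n) (s : ℝ) :
    sideParam n i s = sideBase n i + sideDir n i * s :=
  (exists_sideMap n i).choose_spec.choose_spec.2.2 s

lemma sideDir_ne_zero (n : ℕ) (i : SideIndex n) : sideDir n i ≠ 0 := by
  rw [← norm_ne_zero_iff, norm_sideDir]; exact one_ne_zero

lemma sideLength_pos (n : ℕ) : 0 < sideLength n := by unfold sideLength; positivity

lemma continuous_sideParam (n : ℕ) (i : SideIndex n) : Continuous (sideParam n i) := by
  have : sideParam n i = fun s : ℝ => sideBase n i + sideDir n i * s := funext (sideParam_eq n i)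
  rw [this]; fun_prop

lemma dist_sideParam (n : ℕ) (i : SideIndex n) (s t : ℝ) :
    ‖sideParam n i s - sideParam n i t‖ = |s - t| := by
  rw [sideParam_eq, sideParam_eq, add_sub_add_left_eq_sub, ← mul_sub, norm_mul, norm_sideDir,
    one_mul, ← Complex.ofReal_sub, Complex.norm_real, Real.norm_eq_abs]

lemma sideParam_image (n : ℕ) (i : SideIndex n) :
    sideParam n i '' Icc 0 (sideLength n) = (fun t : ℝ => sideMap n i t) '' Icc 0 1 := by
  have h3 : (0 : ℝ) < 3 ^ n := by positivity
  ext x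
  constructor
  · rintro ⟨s, hs, rfl⟩
    refine ⟨3 ^ n * s, ⟨by have := hs.1; positivity, ?_⟩, rfl⟩
    have h1 := hs.2
    rw [sideLength] at h1
    calc 3 ^ n * s ≤ 3 ^ n * (3 ^ n)⁻¹ := by gcongr
      _ = 1 := mul_inv_cancel₀ h3.ne'
  · rintro ⟨t, ht, rfl⟩
    refine ⟨(3 ^ n)⁻¹ * t, ⟨by have := ht.1; positivity, ?_⟩, ?_⟩
    · rw [sideLength]; exact mul_le_of_le_one_right (by positivity) ht.2
    · show sideMap n i (((3 : ℝ) ^ n * ((3 ^ n)⁻¹ * t) : ℝ) : ℂ) = _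
      rw [mul_inv_cancel_left₀ h3.ne']

lemma mem_snowflake_iff (n : ℕ) (x : ℂ) :
    x ∈ snowflake n ↔ ∃ i, ∃ t ∈ Icc (0 : ℝ) 1, sideMap n i t = x := by
  simp only [snowflake, mem_iUnion, sideParam_image]
  rfl

lemma isCompact_side (n : ℕ) (i : SideIndex n) :
    IsCompact (sideParam n i '' Icc 0 (sideLength n)) :=
  isCompact_Icc.image (continuous_sideParam n i)

lemma isCompact_snowflake (n : ℕ) : IsCompact (snowflake n) :=
  isCompact_iUnion fun i => isCompact_side n i

lemma isOpen_domain (n : ℕ) : IsOpen (domain n) := by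
  rw [isOpen_iff_mem_nhds]
  rintro x ⟨hx, hb⟩
  have ho : IsOpen (connectedComponentIn (snowflake n)ᶜ x) :=
    (isCompact_snowflake n).isClosed.isOpen_compl.connectedComponentIn
  refine mem_of_superset (ho.mem_nhds (mem_connectedComponentIn hx)) fun y hy => ?_
  exact ⟨connectedComponentIn_subset _ _ hy, by rwa [← connectedComponentIn_eq hy]⟩

/-- The definition bounds each component separately. A point outside a ball containing the curve is
joined to infinity by its radial ray, so every point of the domain lies in that one ball. -/
lemma isBounded_domain (n : ℕ) : Bornology.IsBounded (domain n) := by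
  obtain ⟨r, hr⟩ := (isCompact_snowflake n).isBounded.subset_closedBall (0 : ℂ)
  refine (Metric.isBounded_closedBall (x := (0 : ℂ)) (r := max r 0)).subset fun x hx => ?_
  by_contra hxr
  rw [mem_closedBall_zero_iff, not_le] at hxr
  have hx0 : 0 < ‖x‖ := (le_max_right _ _).trans_lt hxr
  set ray : Set ℂ := (fun t : ℝ => (t : ℂ) * x) '' Ici 1 with hray
  have hc : IsPreconnected ray := isPreconnected_Ici.image _ (by fun_prop)
  have hsub : ray ⊆ (snowflake n)ᶜ := by
    rintro _ ⟨t, ht, rfl⟩ hK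
    have h1 := mem_closedBall_zero_iff.1 (hr hK)
    rw [norm_mul, Complex.norm_real, Real.norm_of_nonneg (zero_le_one.trans ht)] at h1
    have h2 : ‖x‖ ≤ t * ‖x‖ := le_mul_of_one_le_left hx0.le ht
    have := le_max_left r 0
    linarith
  have hsub2 := hc.subset_connectedComponentIn (x := x) ⟨1, self_mem_Ici, by simp⟩ hsub
  obtain ⟨C, hC⟩ := (hx.2.subset hsub2).exists_norm_le
  have h3 := hC (((max 1 ((C + 1) / ‖x‖) : ℝ) : ℂ) * x) ⟨_, mem_Ici.2 (le_max_left 1 ((C + 1) / ‖x‖)), rfl⟩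
  rw [norm_mul, Complex.norm_real, Real.norm_of_nonneg (zero_le_one.trans (le_max_left _ _))] at h3
  have h4 : (C + 1) / ‖x‖ * ‖x‖ ≤ max 1 ((C + 1) / ‖x‖) * ‖x‖ := by
    gcongr; exact le_max_right _ _
  rw [div_mul_cancel₀ _ hx0.ne'] at h4
  linarith

/-- The triangle over the segment `[0, 1]` on the inner side. -/
def innerTriangle : Set ℂ :=
  {z | z.im ≤ 0 ∧ 0 ≤ Real.sqrt 3 * z.re + z.im ∧ 0 ≤ Real.sqrt 3 * (1 - z.re) + z.im}

/-- The triangle over the middle third of `[0, 1]` on the outer side. -/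
def bumpTriangle : Set ℂ :=
  {z | 0 ≤ z.im ∧ 0 ≤ Real.sqrt 3 * (z.re - 1 / 3) - z.im ∧ 0 ≤ Real.sqrt 3 * (2 / 3 - z.re) - z.im}

/-- An open neighbourhood of the open middle third of `[0, 1]`. -/
def middleRegion : Set ℂ :=
  {z | 0 < Real.sqrt 3 * (z.re - 1 / 3) - z.im ∧ 0 < Real.sqrt 3 * (2 / 3 - z.re) - z.im ∧
    0 < Real.sqrt 3 * z.re + z.im ∧ 0 < Real.sqrt 3 * (1 - z.re) + z.im}

lemma isOpen_middleRegion : IsOpen middleRegion := by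
  unfold middleRegion
  simp only [ofPred_and]
  refine IsOpen.inter ?_ (IsOpen.inter ?_ (IsOpen.inter ?_ ?_)) <;>
  exact isOpen_lt continuous_const (by fun_prop)

lemma middleRegion_subset : middleRegion ⊆ innerTriangle ∪ bumpTriangle := by
  rintro z ⟨h1, h2, h3, h4⟩
  rcases le_total z.im 0 with h | h
  · exact Or.inl ⟨h, h3.le, h4.le⟩
  · exact Or.inr ⟨h, h1.le, h2.le⟩

/-- For the two outer thirds the child triangle is a homothetic copy inside the parent triangle; for
the two sides of the bump it lies in the bump triangle. Refinement therefore adds only bumps. -/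
lemma contraction_innerTriangle {z : ℂ} (hz : z ∈ innerTriangle) (k : Fin 4) :
    contraction k z ∈ innerTriangle ∪ bumpTriangle := by
  obtain ⟨h1, h2, h3⟩ := hz
  have h := sqrt_three_mul_self
  have h0 := sqrt_three_pos
  fin_cases k
  · left
    refine ⟨?_, ?_, ?_⟩ <;> simp only [Fin.zero_eta, contraction_zero_re, contraction_zero_im] <;>
      linarith
  · right
    refine ⟨?_, ?_, ?_⟩ <;> simp only [Fin.mk_one, contraction_one_re, contraction_one_im] <;>
      nlinarith
  · right
    refine ⟨?_, ?_, ?_⟩ <;> simp only [Fin.reduceFinMk, contraction_two_re, contraction_two_im] <;>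
      nlinarith
  · left
    refine ⟨?_, ?_, ?_⟩ <;> simp only [Fin.reduceFinMk, contraction_three_re, contraction_three_im] <;>
      linarith

lemma bumpTriangle_subset : bumpTriangle ⊆ contraction 1 '' innerTriangle := by
  rintro z ⟨h1, h2, h3⟩
  have h := sqrt_three_mul_self
  have h0 := sqrt_three_pos
  -- The preimage under the similarity `contraction 1`, that is `3 exp(-iπ/3) (z - 1/3)`.
  refine ⟨⟨(3 * (z.re - 1 / 3) + 3 * Real.sqrt 3 * z.im) / 2,
    (3 * z.im - 3 * Real.sqrt 3 * (z.re - 1 / 3)) / 2⟩, ⟨?_, ?_, ?_⟩, ?_⟩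
  · simp only; linarith
  · simp only; nlinarith
  · simp only; nlinarith
  · apply Complex.ext
    · rw [contraction_one_re]; simp only; nlinarith
    · rw [contraction_one_im]; simp only; nlinarith

/-- The two upper edges of the bump are new sides; the rest, including the open base, lies in the
open `middleRegion`. -/
lemma bumpTriangle_cases {z : ℂ} (hz : z ∈ bumpTriangle) :
    z ∈ middleRegion ∨ ∃ k, ∃ t ∈ Icc (0 : ℝ) 1, contraction k t = z := by
  obtain ⟨h1, h2, h3⟩ := hz
  have h := sqrt_three_mul_self
  have h0 := sqrt_three_pos
  by_cases h4 : 0 < Real.sqrt 3 * (z.re - 1 / 3) - z.im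
  · by_cases h5 : 0 < Real.sqrt 3 * (2 / 3 - z.re) - z.im
    · left
      refine ⟨h4, h5, ?_, ?_⟩ <;> nlinarith
    · right
      have h6 : z.im = Real.sqrt 3 * (2 / 3 - z.re) := by linarith
      refine ⟨2, 6 * (z.re - 1 / 2), ⟨?_, ?_⟩, ?_⟩
      · nlinarith
      · nlinarith
      · apply Complex.ext
        · rw [contraction_two_re]; simp
        · rw [contraction_two_im, h6]; simp; ring
  · right
    have h6 : z.im = Real.sqrt 3 * (z.re - 1 / 3) := by linarith
    refine ⟨1, 6 * (z.re - 1 / 3), ⟨?_, ?_⟩, ?_⟩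
    · nlinarith
    · nlinarith
    · apply Complex.ext
      · rw [contraction_one_re]; simp
      · rw [contraction_one_im, h6]; simp; ring

lemma segment_cases {t : ℝ} (ht : t ∈ Icc (0 : ℝ) 1) :
    (t : ℂ) ∈ middleRegion ∨ ∃ k, ∃ s ∈ Icc (0 : ℝ) 1, contraction k s = t := by
  have h0 := sqrt_three_pos
  obtain ⟨h1, h2⟩ := ht
  by_cases h3 : t ≤ 1 / 3
  · exact Or.inr ⟨0, 3 * t, ⟨by linarith, by linarith⟩, by simp [contraction]⟩
  · by_cases h4 : 2 / 3 ≤ t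
    · exact Or.inr ⟨3, 3 * t - 2, ⟨by linarith, by linarith⟩, by simp [contraction]; ring⟩
    · left
      push Not at h3 h4
      refine ⟨?_, ?_, ?_, ?_⟩ <;> simp only [Complex.ofReal_re, Complex.ofReal_im, sub_zero,
        add_zero] <;> apply mul_pos h0 <;> linarith

end Geometry

/-! ### A compact region whose frontier lies on the curve -/

section FilledRegion

lemma center_re : center.re = 1 / 2 := by
  simp [center, exp_neg_I_pi_div_three]; norm_num

lemma center_im : center.im = -(Real.sqrt 3 / 6) := by
  simp [center, exp_neg_I_pi_div_three]; ring

lemma rotate_zero (z : ℂ) : rotate 0 z = z := by simp [rotate]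

lemma exp_two_pi_div_three :
    Complex.exp (Complex.I * (2 * Real.pi * ((1 : Fin 3) : ℕ) / 3))
      = ⟨-(1 / 2), Real.sqrt 3 / 2⟩ := by
  have h := sqrt_three_mul_self
  rw [show Complex.I * (2 * (Real.pi : ℂ) * (((1 : Fin 3) : ℕ) : ℂ) / 3)
    = Complex.I * (Real.pi / 3) + Complex.I * (Real.pi / 3) by
      rw [Fin.val_one]; push_cast; ring, Complex.exp_add,
    exp_I_pi_div_three]
  apply Complex.ext
  · simp only [Complex.mul_re]; nlinarith
  · simp only [Complex.mul_im]; ring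

lemma exp_four_pi_div_three :
    Complex.exp (Complex.I * (2 * Real.pi * ((2 : Fin 3) : ℕ) / 3))
      = ⟨-(1 / 2), -(Real.sqrt 3 / 2)⟩ := by
  have h := sqrt_three_mul_self
  rw [show Complex.I * (2 * (Real.pi : ℂ) * (((2 : Fin 3) : ℕ) : ℂ) / 3)
    = Complex.I * (2 * Real.pi * ((1 : Fin 3) : ℕ) / 3)
      + Complex.I * (2 * Real.pi * ((1 : Fin 3) : ℕ) / 3) by
      rw [Fin.val_one, Fin.val_two]; push_cast; ring, Complex.exp_add,
    exp_two_pi_div_three]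
  apply Complex.ext
  · simp only [Complex.mul_re]; nlinarith
  · simp only [Complex.mul_im]; ring

lemma rotate_one_re (z : ℂ) :
    (rotate 1 z).re = 1 / 2 - (z.re - 1 / 2) / 2 - Real.sqrt 3 / 2 * (z.im + Real.sqrt 3 / 6) := by
  simp only [rotate, exp_two_pi_div_three, Complex.add_re, Complex.mul_re, Complex.sub_re,
    Complex.sub_im, center_re, center_im]
  ring

lemma rotate_one_im (z : ℂ) :
    (rotate 1 z).im = -(Real.sqrt 3 / 6) - (z.im + Real.sqrt 3 / 6) / 2
      + Real.sqrt 3 / 2 * (z.re - 1 / 2) := by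
  simp only [rotate, exp_two_pi_div_three, Complex.add_im, Complex.mul_im, Complex.sub_re,
    Complex.sub_im, center_re, center_im]
  ring

lemma rotate_two_re (z : ℂ) :
    (rotate 2 z).re = 1 / 2 - (z.re - 1 / 2) / 2 + Real.sqrt 3 / 2 * (z.im + Real.sqrt 3 / 6) := by
  simp only [rotate, exp_four_pi_div_three, Complex.add_re, Complex.mul_re, Complex.sub_re,
    Complex.sub_im, center_re, center_im]
  ring

lemma rotate_two_im (z : ℂ) :
    (rotate 2 z).im = -(Real.sqrt 3 / 6) - (z.im + Real.sqrt 3 / 6) / 2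
      - Real.sqrt 3 / 2 * (z.re - 1 / 2) := by
  simp only [rotate, exp_four_pi_div_three, Complex.add_im, Complex.mul_im, Complex.sub_re,
    Complex.sub_im, center_re, center_im]
  ring

lemma rotate_innerTriangle {z : ℂ} (hz : z ∈ innerTriangle) (j : Fin 3) :
    rotate j z ∈ innerTriangle := by
  obtain ⟨h1, h2, h3⟩ := hz
  have h := sqrt_three_mul_self
  have h0 := sqrt_three_pos
  fin_cases j
  · simpa [rotate_zero] using ⟨h1, h2, h3⟩
  · refine ⟨?_, ?_, ?_⟩ <;> simp only [Fin.mk_one, rotate_one_re, rotate_one_im] <;> nlinarith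
  · refine ⟨?_, ?_, ?_⟩ <;> simp only [Fin.reduceFinMk, rotate_two_re, rotate_two_im] <;> nlinarith

/-- The interior of the inner triangle. -/
def openTriangle : Set ℂ :=
  {z | z.im < 0 ∧ 0 < Real.sqrt 3 * z.re + z.im ∧ 0 < Real.sqrt 3 * (1 - z.re) + z.im}

lemma isOpen_openTriangle : IsOpen openTriangle := by
  unfold openTriangle
  simp only [ofPred_and]
  refine IsOpen.inter ?_ (IsOpen.inter ?_ ?_)
  · exact isOpen_lt (by fun_prop) continuous_const
  all_goals exact isOpen_lt continuous_const (by fun_prop)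

lemma openTriangle_subset : openTriangle ⊆ innerTriangle := fun _ h => ⟨h.1.le, h.2.1.le, h.2.2.le⟩

lemma isCompact_innerTriangle : IsCompact innerTriangle := by
  refine Metric.isCompact_of_isClosed_isBounded ?_ ?_
  · unfold innerTriangle
    simp only [ofPred_and]
    refine IsClosed.inter ?_ (IsClosed.inter ?_ ?_)
    · exact isClosed_le (by fun_prop) continuous_const
    all_goals exact isClosed_le continuous_const (by fun_prop)
  · refine (Metric.isBounded_closedBall (x := (0 : ℂ)) (r := 3)).subset fun z hz => ?_
    obtain ⟨h1, h2, h3⟩ := hz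
    have h := sqrt_three_mul_self
    have h0 := sqrt_three_pos
    rw [mem_closedBall_zero_iff]
    refine (Complex.norm_le_abs_re_add_abs_im z).trans ?_
    have h4 : 0 ≤ z.re := by nlinarith
    have h5 : z.re ≤ 1 := by nlinarith
    have h6 : Real.sqrt 3 ≤ 2 := by nlinarith
    rw [abs_of_nonneg h4, abs_of_nonpos h1]
    nlinarith

lemma innerTriangle_cases {z : ℂ} (hz : z ∈ innerTriangle) :
    z ∈ openTriangle ∨ ∃ j, ∃ t ∈ Icc (0 : ℝ) 1, rotate j t = z := by
  obtain ⟨h1, h2, h3⟩ := hz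
  have h := sqrt_three_mul_self
  have h0 := sqrt_three_pos
  by_cases h4 : z.im < 0
  · by_cases h5 : 0 < Real.sqrt 3 * z.re + z.im
    · by_cases h6 : 0 < Real.sqrt 3 * (1 - z.re) + z.im
      · exact Or.inl ⟨h4, h5, h6⟩
      · right
        have h7 : z.im = -(Real.sqrt 3 * (1 - z.re)) := by linarith
        refine ⟨2, 2 * (1 - z.re), ⟨by nlinarith, by nlinarith⟩, ?_⟩
        apply Complex.ext
        · rw [rotate_two_re]; simp only [Complex.ofReal_re, Complex.ofReal_im]; nlinarith
        · rw [rotate_two_im, h7]; simp only [Complex.ofReal_re, Complex.ofReal_im]; ring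
    · right
      have h7 : z.im = -(Real.sqrt 3 * z.re) := by linarith
      refine ⟨1, 1 - 2 * z.re, ⟨by nlinarith, by nlinarith⟩, ?_⟩
      apply Complex.ext
      · rw [rotate_one_re]; simp only [Complex.ofReal_re, Complex.ofReal_im]; nlinarith
      · rw [rotate_one_im, h7]; simp only [Complex.ofReal_re, Complex.ofReal_im]; ring
  · right
    have h7 : z.im = 0 := by linarith
    rw [h7, add_zero] at h2 h3
    refine ⟨0, z.re, ⟨nonneg_of_mul_nonneg_right h2 h0, ?_⟩, ?_⟩
    · linarith [nonneg_of_mul_nonneg_right h3 h0]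
    · rw [rotate_zero]; exact Complex.ext rfl h7.symm

/-- A compact set bounded by the prefractal curve. -/
noncomputable def filled : ℕ → Set ℂ
  | 0 => innerTriangle
  | n + 1 => filled n ∪ ⋃ i : SideIndex (n + 1), sideMap (n + 1) i '' innerTriangle

lemma continuous_sideMap (n : ℕ) (i : SideIndex n) : Continuous (sideMap n i) := by
  have : sideMap n i = fun z => sideBase n i + sideDir n i * ((3 ^ n)⁻¹ * z) :=
    funext (sideMap_eq n i)
  rw [this]; fun_prop

lemma isOpenMap_sideMap (n : ℕ) (i : SideIndex n) : IsOpenMap (sideMap n i) := by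
  have h : sideDir n i * (3 ^ n)⁻¹ ≠ 0 :=
    mul_ne_zero (sideDir_ne_zero n i) (inv_ne_zero (pow_ne_zero n (by norm_num)))
  have : sideMap n i = (fun z => sideBase n i + z) ∘ fun z => (sideDir n i * (3 ^ n)⁻¹) * z := by
    ext z; simp [sideMap_eq, mul_assoc]
  rw [this]
  exact (isOpenMap_add_left _).comp (isOpenMap_smul₀ h)

lemma isCompact_filled (n : ℕ) : IsCompact (filled n) := by
  induction n with
  | zero => exact isCompact_innerTriangle
  | succ n ih =>
    exact ih.union (isCompact_iUnion fun i =>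
      isCompact_innerTriangle.image (continuous_sideMap _ i))

lemma sideMap_mem_filled {n : ℕ} (i : SideIndex n) {z : ℂ} (hz : z ∈ innerTriangle) :
    sideMap n i z ∈ filled n := by
  cases n with
  | zero => exact rotate_innerTriangle hz i.1
  | succ n => exact Or.inr (mem_iUnion.2 ⟨i, z, hz, rfl⟩)

lemma sideMap_bump_mem_filled {n : ℕ} (i : SideIndex n) {z : ℂ} (hz : z ∈ bumpTriangle) :
    sideMap n i z ∈ filled (n + 1) := by
  obtain ⟨y, hy, rfl⟩ := bumpTriangle_subset hz
  rw [← sideMap_snoc]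
  exact sideMap_mem_filled _ hy

lemma sideMap_middleRegion {n : ℕ} (i : SideIndex n) {z : ℂ} (hz : z ∈ middleRegion) :
    sideMap n i z ∈ interior (filled (n + 1)) := by
  have h1 : sideMap n i '' middleRegion ⊆ filled (n + 1) := by
    rintro _ ⟨y, hy, rfl⟩
    rcases middleRegion_subset hy with h | h
    · exact Or.inl (sideMap_mem_filled i h)
    · exact sideMap_bump_mem_filled i h
  exact interior_maximal h1 (isOpenMap_sideMap n i _ isOpen_middleRegion) ⟨z, hz, rfl⟩

/-- Replaces the Jordan curve theorem. In passing from one generation to the next the open middle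
third of a side becomes interior, having the inner triangle on one side and the bump on the other.
What may remain of the frontier is covered by the four new segments. -/
lemma frontier_filled_subset (n : ℕ) : frontier (filled n) ⊆ snowflake n := by
  induction n with
  | zero =>
    intro x hx
    have hx1 : x ∈ innerTriangle := isCompact_innerTriangle.isClosed.frontier_subset hx
    rcases innerTriangle_cases hx1 with h | ⟨j, t, ht, rfl⟩
    · exact absurd (interior_maximal openTriangle_subset isOpen_openTriangle h) hx.2
    · exact (mem_snowflake_iff 0 _).2 ⟨(j, Fin.elim0), t, ht, rfl⟩
  | succ n ih =>
    intro x hx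
    have hmem : x ∈ filled (n + 1) := (isCompact_filled _).isClosed.frontier_subset hx
    have hsub : ∀ (i : SideIndex n) (k : Fin 4) (t : ℝ), t ∈ Icc (0 : ℝ) 1 →
        sideMap n i (contraction k t) ∈ snowflake (n + 1) := fun i k t ht => by
      rw [← sideMap_snoc]
      exact (mem_snowflake_iff _ _).2 ⟨_, t, ht, rfl⟩
    have hcase : x ∈ filled n ∨ ∃ i : SideIndex n, ∃ z ∈ bumpTriangle, sideMap n i z = x := by
      rcases hmem with h | h
      · exact Or.inl h
      · obtain ⟨i, z, hz, rfl⟩ := mem_iUnion.1 h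
        obtain ⟨j, k, rfl⟩ := exists_snoc n i
        rw [sideMap_snoc]
        rcases contraction_innerTriangle hz k with h' | h'
        · exact Or.inl (sideMap_mem_filled j h')
        · exact Or.inr ⟨j, _, h', rfl⟩
    rcases hcase with h | ⟨i, z, hz, rfl⟩
    -- A frontier point of the larger set that lies in the smaller one is a frontier point of the
    -- latter, so the induction hypothesis puts it on the old curve.
    · have hf : x ∈ frontier (filled n) :=
        ⟨subset_closure h, fun h' => hx.2 (interior_mono subset_union_left h')⟩
      obtain ⟨i, t, ht, rfl⟩ := (mem_snowflake_iff n x).1 (ih hf)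
      rcases segment_cases ht with h' | ⟨k, s, hs, h'⟩
      · exact absurd (sideMap_middleRegion i h') hx.2
      · rw [← h']; exact hsub i k s hs
    · rcases bumpTriangle_cases hz with h' | ⟨k, s, hs, h'⟩
      · exact absurd (sideMap_middleRegion i h') hx.2
      · rw [← h']; exact hsub i k s hs

/-- A connected set avoiding the curve cannot cross the frontier of `filled n`. The component of
such a point stays inside a compact set and is therefore bounded. -/
lemma interior_filled_diff_subset (n : ℕ) : interior (filled n) \ snowflake n ⊆ domain n := by
  rintro x ⟨hx, hK⟩
  refine ⟨hK, ((isCompact_filled n).isBounded).subset ?_⟩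
  intro y hy
  by_contra hn
  have hpre : IsPreconnected (connectedComponentIn (snowflake n)ᶜ x) :=
    isPreconnected_connectedComponentIn
  have hcov : connectedComponentIn (snowflake n)ᶜ x ⊆ interior (filled n) ∪ (filled n)ᶜ := by
    intro z hz
    by_contra hz'
    rw [mem_union, not_or, notMem_compl_iff] at hz'
    exact connectedComponentIn_subset _ _ hz
      (frontier_filled_subset n ⟨subset_closure hz'.2, hz'.1⟩)
  obtain ⟨z, -, hz1, hz2⟩ := hpre (interior (filled n)) (filled n)ᶜ isOpen_interior
    (isCompact_filled n).isClosed.isOpen_compl hcov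
    ⟨x, mem_connectedComponentIn hK, hx⟩ ⟨y, hy, hn⟩
  exact hz2 (interior_subset hz1)

/-- The points near a side on its inner side belong to the domain, unless they lie on the curve. -/
lemma sideMap_openTriangle {n : ℕ} (i : SideIndex n) {z : ℂ} (hz : z ∈ openTriangle)
    (hK : sideMap n i z ∉ snowflake n) : sideMap n i z ∈ domain n := by
  refine interior_filled_diff_subset n ⟨?_, hK⟩
  refine interior_maximal ?_ (isOpenMap_sideMap n i _ isOpen_openTriangle) ⟨z, hz, rfl⟩
  rintro _ ⟨y, hy, rfl⟩
  exact sideMap_mem_filled i (openTriangle_subset hy)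

end FilledRegion

/-! ### The domain near almost every boundary point -/

section LocalStructure

/-- Cartesian coordinates adapted to the line through `p` with direction `e`. -/
noncomputable def chart (p e : ℂ) (σ : ℝ) (q : ℝ × ℝ) : ℂ := p + e * (q.1 + σ * q.2 * Complex.I)

lemma continuous_chart (p e : ℂ) (σ : ℝ) : Continuous (chart p e σ) := by
  unfold chart; fun_prop

lemma norm_chart_sub {p e : ℂ} (he : ‖e‖ = 1) {σ : ℝ} (hσ : σ ^ 2 = 1) (q q' : ℝ × ℝ) :
    ‖chart p e σ q - chart p e σ q'‖ = Real.sqrt ((q.1 - q'.1) ^ 2 + (q.2 - q'.2) ^ 2) := by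
  have h1 : chart p e σ q - chart p e σ q'
      = e * (((q.1 - q'.1 : ℝ) : ℂ) + ((σ * (q.2 - q'.2) : ℝ) : ℂ) * Complex.I) := by
    simp only [chart]; push_cast; ring
  rw [h1, norm_mul, he, one_mul, Complex.norm_add_mul_I, mul_pow, hσ, one_mul]

lemma measurePreserving_chart {p e : ℂ} (he : ‖e‖ = 1) {σ : ℝ} (hσ : σ ^ 2 = 1) :
    MeasurePreserving (chart p e σ) := by
  have h1 : MeasurePreserving (fun t : ℝ => σ * t) := by
    rcases mul_self_eq_one_iff.1 (by rw [← hσ, sq]) with rfl | rfl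
    · simp_rw [one_mul]; exact MeasurePreserving.id volume
    · simpa only [neg_one_mul] using Measure.measurePreserving_neg (volume : Measure ℝ)
  have h2 : MeasurePreserving (Prod.map id fun t : ℝ => σ * t) (volume : Measure (ℝ × ℝ)) volume :=
    (MeasurePreserving.id volume).prod h1
  have h3 := Complex.volume_preserving_equiv_real_prod.symm
  have h4 : MeasurePreserving (fun z : ℂ => e * z) := by
    have := (rotation (⟨e, by simpa [Submonoid.unitSphere] using he⟩ : Circle)).measurePreserving
    exact this
  have h5 := measurePreserving_add_left (volume : Measure ℂ) p
  have := h5.comp (h4.comp (h3.comp h2))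
  suffices h : chart p e σ = _ from h ▸ this
  funext q
  have h6 : Complex.measurableEquivRealProd.symm (q.1, σ * q.2)
      = (q.1 : ℂ) + σ * q.2 * Complex.I := by
    apply Complex.ext <;> simp [Complex.measurableEquivRealProd]
  change p + e * _ = p + e * Complex.measurableEquivRealProd.symm (q.1, σ * q.2)
  rw [h6]

lemma sideParam_eq_chart (n : ℕ) (i : SideIndex n) (σ s : ℝ) :
    sideParam n i s = chart (sideBase n i) (sideDir n i) σ (s, 0) := by
  simp [sideParam_eq, chart]

/-- Near `sideParam n i s`, the curve is contained in the line through the side. -/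
def IsGoodPoint (n : ℕ) (i : SideIndex n) (s : ℝ) : Prop :=
  ∃ δ > 0, ∀ s' t : ℝ, |s' - s| < δ → t ≠ 0 → |t| < δ →
    chart (sideBase n i) (sideDir n i) 1 (s', t) ∉ snowflake n

/-- A side not contained in the line through side `i` meets that line at most once. There are
finitely many sides, so apart from a null set of parameters only collinear sides come near. Neither
simplicity of the curve nor disjointness of its sides is needed. -/
lemma ae_isGoodPoint (n : ℕ) (i : SideIndex n) : ∀ᵐ s : ℝ, IsGoodPoint n i s := by
  classical
  set p := sideBase n i
  set e := sideDir n i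
  set side : SideIndex n → Set ℂ := fun j => sideParam n j '' Icc 0 (sideLength n) with hside
  set bad : Set (SideIndex n) := {j | ¬ side j ⊆ range fun r : ℝ => p + e * r} with hbad
  have hsub : ∀ j ∈ bad, {s : ℝ | sideParam n i s ∈ side j}.Subsingleton := by
    rintro j hj s₁ ⟨τ₁, hτ₁, h₁⟩ s₂ ⟨τ₂, hτ₂, h₂⟩
    by_contra hne
    refine hj ?_
    rw [sideParam_eq, sideParam_eq] at h₁ h₂
    -- Two distinct common points would force the directions to be real multiples of each other, and
    -- the side `j` into the line.
    have hd : sideDir n j * ((τ₁ - τ₂ : ℝ) : ℂ) = e * ((s₁ - s₂ : ℝ) : ℂ) := by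
      push_cast; linear_combination h₁ - h₂
    have hτ : τ₁ - τ₂ ≠ 0 := by
      intro h0
      rw [h0, Complex.ofReal_zero, mul_zero, eq_comm, mul_eq_zero] at hd
      rcases hd with h | h
      · exact sideDir_ne_zero n i h
      · exact hne (sub_eq_zero.1 (Complex.ofReal_eq_zero.1 h))
    have hτ' : ((τ₁ - τ₂ : ℝ) : ℂ) ≠ 0 := Complex.ofReal_ne_zero.2 hτ
    have hdir : sideDir n j = e * (((s₁ - s₂) / (τ₁ - τ₂) : ℝ) : ℂ) := by
      rw [Complex.ofReal_div, mul_div_assoc', eq_div_iff hτ', hd]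
    rintro _ ⟨τ, -, rfl⟩
    refine ⟨s₁ + (s₁ - s₂) / (τ₁ - τ₂) * (τ - τ₁), ?_⟩
    simp only
    rw [sideParam_eq, Complex.ofReal_add, Complex.ofReal_mul]
    have h3 := h₁
    rw [hdir] at h3 ⊢
    push_cast
    push_cast at h3
    linear_combination -h3
  have hnull : volume (⋃ j ∈ bad, {s : ℝ | sideParam n i s ∈ side j}) = 0 :=
    (measure_biUnion_null_iff (to_countable _)).2 fun j hj => (hsub j hj).measure_zero _
  have hae : ∀ᵐ s : ℝ, s ∉ ⋃ j ∈ bad, {s : ℝ | sideParam n i s ∈ side j} :=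
    measure_eq_zero_iff_ae_notMem.1 hnull
  filter_upwards [hae] with s hs
  have hclosed : IsClosed (⋃ j ∈ bad, side j) :=
    (Set.toFinite bad).isClosed_biUnion fun j _ => (isCompact_side n j).isClosed
  have hx : sideParam n i s ∈ (⋃ j ∈ bad, side j)ᶜ := by
    intro h
    obtain ⟨j, hj, hmem⟩ := mem_iUnion₂.1 h
    exact hs (mem_iUnion₂.2 ⟨j, hj, hmem⟩)
  obtain ⟨δ, hδ, hball⟩ := Metric.isOpen_iff.1 hclosed.isOpen_compl _ hx
  refine ⟨δ / 2, by positivity, fun s' t hs' ht0 ht hK => ?_⟩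
  obtain ⟨j, hj⟩ := mem_iUnion.1 hK
  have hdist : chart p e 1 (s', t) ∈ Metric.ball (sideParam n i s) δ := by
    rw [Metric.mem_ball, dist_eq_norm, sideParam_eq_chart n i 1,
      norm_chart_sub (norm_sideDir n i) (one_pow 2), sub_zero]
    have h1 := sq_abs (s' - s)
    have h2 := sq_abs t
    rw [Real.sqrt_lt' hδ]
    nlinarith [abs_nonneg (s' - s), abs_nonneg t]
  by_cases hjb : j ∈ bad
  · exact hball hdist (mem_iUnion₂.2 ⟨j, hjb, hj⟩)
  · rw [hbad, mem_ofPred_eq, not_not] at hjb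
    obtain ⟨r, hr⟩ := hjb hj
    have h1 : e * ((r : ℂ)) = e * ((s' : ℂ) + t * Complex.I) := by
      have : p + e * r = chart p e 1 (s', t) := hr
      rw [chart] at this
      simpa using this
    have h2 := mul_left_cancel₀ (sideDir_ne_zero n i) h1
    have h3 := congrArg Complex.im h2
    simp at h3
    exact ht0 h3.symm

lemma subset_domain_of_isPreconnected {n : ℕ} {W : Set ℂ} (hW : IsPreconnected W)
    (hK : Disjoint W (snowflake n)) (hne : (W ∩ domain n).Nonempty) : W ⊆ domain n := by
  obtain ⟨x, hxW, hx⟩ := hne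
  intro y hy
  have hsub : W ⊆ (snowflake n)ᶜ := fun z hz hz' => disjoint_left.1 hK hz hz'
  have h1 := hW.subset_connectedComponentIn hxW hsub hy
  exact ⟨hsub hy, by rw [← connectedComponentIn_eq h1]; exact hx.2⟩

/-- The open rectangle over the interval of radius `δ` around `s`. -/
def window (s δ : ℝ) : Set (ℝ × ℝ) := Ioo (s - δ) (s + δ) ×ˢ Ioo 0 δ

lemma isPreconnected_window (p e : ℂ) (σ s δ : ℝ) : IsPreconnected (chart p e σ '' window s δ) :=
  (isPreconnected_Ioo.prod isPreconnected_Ioo).image _ (continuous_chart p e σ).continuousOn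

/-- Local structure of the domain at almost every point of the boundary. -/
lemma IsGoodPoint.exists_window {n : ℕ} {i : SideIndex n} {s : ℝ} (hg : IsGoodPoint n i s)
    (hs : s ∈ Ioo 0 (sideLength n)) : ∃ δ > 0, Ioo (s - δ) (s + δ) ⊆ Ioo 0 (sideLength n) ∧
      chart (sideBase n i) (sideDir n i) (-1) '' window s δ ⊆ domain n ∧
      (chart (sideBase n i) (sideDir n i) 1 '' window s δ ⊆ domain n ∨
        Disjoint (chart (sideBase n i) (sideDir n i) 1 '' window s δ) (domain n)) := by
  obtain ⟨δ₀, hδ₀, hg⟩ := hg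
  set δ := min δ₀ (min s (sideLength n - s)) with hδdef
  have hδ : 0 < δ := lt_min hδ₀ (lt_min hs.1 (sub_pos.2 hs.2))
  have hδ1 : δ ≤ δ₀ := min_le_left _ _
  have hδ2 : δ ≤ s := (min_le_right _ _).trans (min_le_left _ _)
  have hδ3 : δ ≤ sideLength n - s := (min_le_right _ _).trans (min_le_right _ _)
  have hdisj : ∀ σ : ℝ, σ ^ 2 = 1 →
      Disjoint (chart (sideBase n i) (sideDir n i) σ '' window s δ) (snowflake n) := by
    intro σ hσ
    rw [disjoint_left]
    rintro _ ⟨⟨s', t⟩, ⟨h1, h2⟩, rfl⟩ hK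
    have h1' : s - δ < s' ∧ s' < s + δ := h1
    have h2' : 0 < t ∧ t < δ := h2
    have hσ1 : |σ| = 1 := by rw [← sq_eq_sq₀ (abs_nonneg _) zero_le_one, sq_abs, hσ, one_pow]
    have hσ0 : σ ≠ 0 := by rintro rfl; simp at hσ
    refine hg s' (σ * t) ?_ (mul_ne_zero hσ0 h2'.1.ne') ?_ ?_
    · rw [abs_lt]; constructor <;> linarith [h1'.1, h1'.2]
    · rw [abs_mul, hσ1, one_mul, abs_of_pos h2'.1]; linarith [h2'.2]
    · convert hK using 1
      simp [chart]
  refine ⟨δ, hδ, fun r hr => ⟨by linarith [hr.1], by linarith [hr.2]⟩, ?_, ?_⟩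
  · refine subset_domain_of_isPreconnected (isPreconnected_window _ _ _ _ _)
      (hdisj (-1) (by norm_num)) ?_
    have hmem : chart (sideBase n i) (sideDir n i) (-1) (s, δ / 2)
        ∈ chart (sideBase n i) (sideDir n i) (-1) '' window s δ :=
      mem_image_of_mem _ ⟨⟨by simp [hδ], by simp [hδ]⟩, ⟨by simp [hδ], by simp [hδ]⟩⟩
    refine ⟨_, hmem, ?_⟩
    have h3 : (0 : ℝ) < 3 ^ n := by positivity
    -- One explicit point of the inner window is placed in the open triangle attached to the side;
    -- connectedness then carries the whole window into the domain. The depth `δ / 2` is small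
    -- enough since `δ` is at most the distance to either end and `√3 > 1`.
    have heq : chart (sideBase n i) (sideDir n i) (-1) (s, δ / 2)
        = sideMap n i ((3 ^ n : ℝ) * ⟨s, -(δ / 2)⟩) := by
      rw [sideMap_eq, chart]
      have h3' : (3 : ℂ) ^ n ≠ 0 := pow_ne_zero n (by norm_num)
      have : (⟨s, -(δ / 2)⟩ : ℂ) = (s : ℂ) + ((-1 : ℝ) : ℂ) * ((δ / 2 : ℝ) : ℂ) * Complex.I := by
        apply Complex.ext <;> simp
      rw [this]
      push_cast
      rw [inv_mul_cancel_left₀ h3']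
    rw [heq]
    refine sideMap_openTriangle i ?_ ?_
    · have h0 : 1 < Real.sqrt 3 := by
        rw [Real.lt_sqrt zero_le_one]; norm_num
      have hl : 3 ^ n * sideLength n = 1 := by
        rw [sideLength]; exact mul_inv_cancel₀ h3.ne'
      have hs1 := hs.1
      have hz : ((3 ^ n : ℝ) : ℂ) * ⟨s, -(δ / 2)⟩ = ⟨3 ^ n * s, -(3 ^ n * (δ / 2))⟩ := by
        apply Complex.ext <;> simp only [Complex.re_ofReal_mul, Complex.im_ofReal_mul, mul_neg]
      have h4 : 3 ^ n * δ ≤ 3 ^ n * s := by gcongr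
      have h5 : 3 ^ n * δ ≤ 1 - 3 ^ n * s := by
        rw [← hl, ← mul_sub]; gcongr
      have h6 : 0 < 3 ^ n * δ := by positivity
      rw [hz]
      refine ⟨?_, ?_, ?_⟩ <;> dsimp only
      · linarith
      · nlinarith
      · nlinarith
    · rw [← heq]
      exact disjoint_left.1 (hdisj (-1) (by norm_num)) hmem
  -- The outer window is connected and misses the curve, so it lies either inside or off the domain.
  -- Deciding which alternative holds is unnecessary: the trace formula covers both.
  · by_cases h : (chart (sideBase n i) (sideDir n i) 1 '' window s δ ∩ domain n).Nonempty
    · exact Or.inl (subset_domain_of_isPreconnected (isPreconnected_window _ _ _ _ _)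
        (hdisj 1 (by norm_num)) h)
    · exact Or.inr (disjoint_iff_inter_eq_empty.2 (not_nonempty_iff_eq_empty.1 h))

/-- Good points are dense in each side and are limits of inner windows. Continuity and positivity of
`b` on the closure are thereby available on the curve, and continuous functions have traces there.
-/
lemma snowflake_subset_closure_domain (n : ℕ) : snowflake n ⊆ closure (domain n) := by
  intro x hx
  obtain ⟨i, s, hs, rfl⟩ := mem_iUnion.1 hx
  have hdense : Dense {s : ℝ | IsGoodPoint n i s} := Measure.dense_of_ae (ae_isGoodPoint n i)
  have h1 : s ∈ closure (Ioo 0 (sideLength n) ∩ {s : ℝ | IsGoodPoint n i s}) := by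
    have := closure_mono (hdense.open_subset_closure_inter (isOpen_Ioo (a := 0) (b := sideLength n)))
    rw [closure_closure, closure_Ioo (sideLength_pos n).ne] at this
    exact this hs
  have h2 := image_closure_subset_closure_image (continuous_sideParam n i) (mem_image_of_mem _ h1)
  refine closure_minimal ?_ isClosed_closure h2
  rintro _ ⟨r, ⟨hr, hgood⟩, rfl⟩
  obtain ⟨δ, hδ, -, hw, -⟩ := hgood.exists_window hr
  have h3 : (r, (0 : ℝ)) ∈ closure (window r δ) := by
    rw [window, closure_prod_eq, closure_Ioo (by linarith), closure_Ioo hδ.ne]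
    exact ⟨⟨by linarith, by linarith⟩, ⟨le_rfl, hδ.le⟩⟩
  rw [sideParam_eq_chart n i (-1)]
  exact closure_mono hw (image_closure_subset_closure_image (continuous_chart _ _ _)
    (mem_image_of_mem _ h3))

end LocalStructure

/-! ### Arc length measure and restriction to sides -/

section ArcMeasure

lemma sideParam_isometry (n : ℕ) (i : SideIndex n) : Isometry (sideParam n i) :=
  Isometry.of_dist_eq fun s t => by rw [dist_eq_norm, dist_sideParam, Real.dist_eq]

lemma measurableEmbedding_sideParam (n : ℕ) (i : SideIndex n) :
    MeasurableEmbedding (sideParam n i) :=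
  (sideParam_isometry n i).isClosedEmbedding.measurableEmbedding

lemma arcMeasure_eq_sum (n : ℕ) : arcMeasure n
    = Measure.sum fun i => (volume.restrict (Ioo 0 (sideLength n))).map (sideParam n i) := by
  rw [Measure.sum_fintype]; rfl

/-- The side parametrizations are measurable embeddings, so the reduction to one variable needs no
measurability of `P`. -/
lemma ae_arcMeasure_iff {n : ℕ} {P : ℂ → Prop} :
    (∀ᵐ x ∂arcMeasure n, P x) ↔ ∀ i, ∀ᵐ s ∂volume.restrict (Ioo 0 (sideLength n)),
      P (sideParam n i s) := by
  rw [arcMeasure_eq_sum, Measure.ae_sum_iff]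
  exact forall_congr' fun i => (measurableEmbedding_sideParam n i).ae_map_iff

instance isFiniteMeasure_arcMeasure (n : ℕ) : IsFiniteMeasure (arcMeasure n) := by
  unfold arcMeasure; infer_instance

lemma map_sideParam_le (n : ℕ) (i : SideIndex n) :
    (volume.restrict (Ioo 0 (sideLength n))).map (sideParam n i) ≤ arcMeasure n := by
  rw [arcMeasure_eq_sum]
  exact Measure.le_sum _ i

lemma ae_mem_snowflake (n : ℕ) : ∀ᵐ x ∂arcMeasure n, x ∈ snowflake n := by
  refine ae_arcMeasure_iff.2 fun i => ?_
  filter_upwards [ae_restrict_mem measurableSet_Ioo] with s hs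
  exact mem_iUnion.2 ⟨i, mem_image_of_mem _ (Ioo_subset_Icc_self hs)⟩

instance isFiniteMeasure_volume_domain (n : ℕ) :
    IsFiniteMeasure ((volume : Measure ℂ).restrict (domain n)) :=
  ⟨by rw [Measure.restrict_apply_univ]; exact (isBounded_domain n).measure_lt_top⟩

instance isFiniteMeasure_mMeasure (n : ℕ) : IsFiniteMeasure (mMeasure n) := by
  unfold mMeasure; infer_instance

lemma volume_domain_le_mMeasure (n : ℕ) : volume.restrict (domain n) ≤ mMeasure n :=
  Measure.le_add_right le_rfl

lemma arcMeasure_le_mMeasure (n : ℕ) : arcMeasure n ≤ mMeasure n :=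
  Measure.le_add_left le_rfl

lemma memLp_comp_sideParam {n : ℕ} {u : ℂ → ℝ} (hu : MemLp u 2 (arcMeasure n)) (i : SideIndex n) :
    MemLp (u ∘ sideParam n i) 2 (volume.restrict (Ioo 0 (sideLength n))) :=
  (measurableEmbedding_sideParam n i).memLp_map_measure_iff.1 (hu.mono_measure (map_sideParam_le n i))

lemma eLpNorm_comp_sideParam_le {n : ℕ} (u : ℂ → ℝ) (i : SideIndex n) :
    eLpNorm (u ∘ sideParam n i) 2 (volume.restrict (Ioo 0 (sideLength n)))
      ≤ eLpNorm u 2 (arcMeasure n) := by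
  rw [← (measurableEmbedding_sideParam n i).eLpNorm_map_measure]
  exact eLpNorm_mono_measure _ (map_sideParam_le n i)

lemma aestronglyMeasurable_of_continuousOn_snowflake {n : ℕ} {g : ℂ → ℝ}
    (hg : ContinuousOn g (snowflake n)) : AEStronglyMeasurable g (arcMeasure n) := by
  have h1 := hg.aestronglyMeasurable (μ := arcMeasure n) (isCompact_snowflake n).measurableSet
  rwa [Measure.restrict_eq_self_of_ae_mem (ae_mem_snowflake n)] at h1

lemma continuousOn_comp_sideParam {n : ℕ} {g : ℂ → ℝ} (hg : ContinuousOn g (snowflake n))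
    (i : SideIndex n) : ContinuousOn (g ∘ sideParam n i) (Icc 0 (sideLength n)) :=
  hg.comp (continuous_sideParam n i).continuousOn fun _ hs =>
    mem_iUnion.2 ⟨i, mem_image_of_mem _ hs⟩

end ArcMeasure

/-! ### One-sided traces on a flat boundary -/

section Slab

lemma integral_primitive {h : ℝ → ℝ} {q : ℝ} (hi : IntervalIntegrable h volume 0 q) :
    ∫ t in (0 : ℝ)..q, (∫ r in (0 : ℝ)..t, h r) = ∫ t in (0 : ℝ)..q, (q - t) * h t := by
  have h1 := (hi.absolutelyContinuousOnInterval_intervalIntegral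
    (c := 0) left_mem_uIcc).integral_mul_deriv_eq_deriv_mul
    ((by fun_prop : ContDiff ℝ 1 fun t : ℝ => t - q).contDiffOn.absolutelyContinuousOnInterval
      (a := 0) (b := q))
  have hd : ∀ t : ℝ, deriv (fun t : ℝ => t - q) t = 1 := fun t => by
    simp
  have h2 : ∫ s in (0 : ℝ)..q, deriv (fun x => ∫ r in (0 : ℝ)..x, h r) s * (s - q)
      = ∫ s in (0 : ℝ)..q, h s * (s - q) := by
    refine intervalIntegral.integral_congr_ae ?_
    filter_upwards [hi.ae_hasDerivAt_integral] with s hs hs'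
    rw [(hs (uIoc_subset_uIcc hs') 0 left_mem_uIcc).deriv]
  simp only [hd, mul_one, sub_self, mul_zero, intervalIntegral.integral_same, zero_mul, zero_sub]
    at h1
  rw [h1, h2, ← intervalIntegral.integral_neg]
  congr 1
  ext t; ring

/-- The left side is the integral of `g` minus that of the primitive of `h`, which is `c` times the
length. The boundary value `c` is thus expressed by integrals alone, and such a formula can be
averaged over a parameter. -/
lemma exists_integral_eq_of_weakDeriv {ℓ : ℝ} (hℓ : 0 < ℓ) {g h : ℝ → ℝ}
    (hg : IntegrableOn g (Ioo 0 ℓ)) (hh : IntegrableOn h (Ioo 0 ℓ))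
    (hw : ∀ φ : ℝ → ℝ, ContDiff ℝ ∞ φ → HasCompactSupport φ → tsupport φ ⊆ Ioo 0 ℓ →
      ∫ s in Ioo 0 ℓ, g s * deriv φ s = -∫ s in Ioo 0 ℓ, h s * φ s) :
    ∃ c, ∀ q ∈ Icc 0 ℓ, ∫ t in Ioo 0 q, (g t - (q - t) * h t) = q * c := by
  obtain ⟨c, hc⟩ := ae_eq_primitive_of_weakDeriv hℓ hg hh hw
  refine ⟨c, fun q hq => ?_⟩
  have hsub : Ioo 0 q ⊆ Ioo 0 ℓ := Ioo_subset_Ioo_right hq.2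
  have hii : ∀ {F : ℝ → ℝ}, IntegrableOn F (Ioo 0 ℓ) → IntervalIntegrable F volume 0 q :=
    fun hF => (intervalIntegrable_iff_integrableOn_Ioo_of_le hq.1).2 (hF.mono_set hsub)
  have hprim : IntervalIntegrable (fun t => ∫ r in (0 : ℝ)..t, h r) volume 0 q :=
    ((hii hh).absolutelyContinuousOnInterval_intervalIntegral
      (c := 0) left_mem_uIcc).continuousOn.intervalIntegrable
  have hm : IntervalIntegrable (fun t => (q - t) * h t) volume 0 q :=
    (hii hh).continuousOn_mul (by fun_prop)
  rw [← integral_Ioc_eq_integral_Ioo, ← intervalIntegral.integral_of_le hq.1,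
    intervalIntegral.integral_sub (hii hg) hm, ← integral_primitive (hii hh),
    ← intervalIntegral.integral_sub (hii hg) hprim]
  have : ∫ t in (0 : ℝ)..q, (g t - ∫ r in (0 : ℝ)..t, h r) = ∫ t in (0 : ℝ)..q, c := by
    rw [intervalIntegral.integral_of_le hq.1, intervalIntegral.integral_of_le hq.1,
      integral_Ioc_eq_integral_Ioo, integral_Ioc_eq_integral_Ioo]
    refine setIntegral_congr_ae measurableSet_Ioo ?_
    filter_upwards [hc] with t ht ht'
    rw [ht (hsub ht')]; ring
  rw [this]; simp

/-- Only countably many upper limits are tested, so exceptional null sets depending on the limit can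
be united beforehand. -/
lemma ae_eq_zero_of_forall_rat_integral_eq_zero {ℓ : ℝ} {W : ℝ → ℝ}
    (hW : IntegrableOn W (Ioo 0 ℓ)) (h : ∀ q : ℚ, (q : ℝ) ∈ Ioo 0 ℓ → ∫ t in Ioo 0 (q : ℝ), W t = 0) :
    ∀ᵐ t, t ∈ Ioo 0 ℓ → W t = 0 := by
  rcases le_or_gt ℓ 0 with hℓ | hℓ
  · rw [Ioo_eq_empty (not_lt.2 hℓ)]; simp
  have hi : IntervalIntegrable W volume 0 ℓ :=
    (intervalIntegrable_iff_integrableOn_Ioo_of_le hℓ.le).2 hW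
  have hc : ContinuousOn (fun q => ∫ t in (0 : ℝ)..q, W t) (Icc 0 ℓ) := by
    have := (hi.absolutelyContinuousOnInterval_intervalIntegral (c := 0) left_mem_uIcc).continuousOn
    rwa [uIcc_of_le hℓ.le] at this
  have hzero : ∀ q ∈ Ioo 0 ℓ, ∫ t in (0 : ℝ)..q, W t = 0 := by
    intro q hq
    by_contra hne
    obtain ⟨r, hr⟩ := Rat.denseRange_cast.exists_mem_open
      ((hc.mono Ioo_subset_Icc_self).isOpen_inter_preimage isOpen_Ioo isOpen_ne) ⟨q, hq, hne⟩
    refine hr.2 ?_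
    change ∫ t in (0 : ℝ)..(r : ℝ), W t = 0
    rw [intervalIntegral.integral_of_le hr.1.1.le, integral_Ioc_eq_integral_Ioo]
    exact h r hr.1
  filter_upwards [hi.ae_hasDerivAt_integral] with t ht ht'
  have h1 := ht (by rw [uIcc_of_le hℓ.le]; exact Ioo_subset_Icc_self ht') 0 left_mem_uIcc
  have h2 : (fun x => ∫ r in (0 : ℝ)..x, W r) =ᶠ[𝓝 t] fun _ => 0 := by
    filter_upwards [isOpen_Ioo.mem_nhds ht'] with x hx using hzero x hx
  exact h1.unique ((hasDerivAt_const t (0 : ℝ)).congr_of_eventuallyEq h2)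

/-- The trace on `{t = 0}` of a function on the slab `0 < t < δ` whose weak derivative with respect
to the second variable is `g`. -/
noncomputable def slabTrace (δ : ℝ) (U g : ℝ × ℝ → ℝ) (s : ℝ) : ℝ :=
  δ⁻¹ * ∫ t in Ioo 0 δ, (U (s, t) - (δ - t) * g (s, t))

variable {a b δ : ℝ} {U g : ℝ × ℝ → ℝ}

lemma integrable_slab {F : ℝ × ℝ → ℝ} (hF : IntegrableOn F (Ioo a b ×ˢ Ioo 0 δ)) {q : ℝ}
    (hq : q ≤ δ) :
    Integrable F ((volume.restrict (Ioo a b)).prod (volume.restrict (Ioo 0 q))) := by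
  rw [Measure.prod_restrict]
  exact hF.mono_set (prod_mono_right (Ioo_subset_Ioo_right hq))

lemma integrable_slab_moment (hU : IntegrableOn U (Ioo a b ×ˢ Ioo 0 δ))
    (hg : IntegrableOn g (Ioo a b ×ˢ Ioo 0 δ)) {q : ℝ} (hq : q ≤ δ) :
    Integrable (fun x : ℝ × ℝ => U x - (q - x.2) * g x)
      ((volume.restrict (Ioo a b)).prod (volume.restrict (Ioo 0 q))) := by
  refine (integrable_slab hU hq).sub ?_
  refine (integrable_slab hg hq).bdd_mul (c := |q|) (by fun_prop) ?_
  rw [Measure.prod_restrict]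
  filter_upwards [ae_restrict_mem (measurableSet_Ioo.prod measurableSet_Ioo)] with x hx
  have h1 : 0 < x.2 ∧ x.2 < q := hx.2
  rw [Real.norm_eq_abs, abs_of_nonneg (by linarith), abs_of_nonneg (by linarith)]
  linarith

lemma integrableOn_slabTrace (hU : IntegrableOn U (Ioo a b ×ˢ Ioo 0 δ))
    (hg : IntegrableOn g (Ioo a b ×ˢ Ioo 0 δ)) : IntegrableOn (slabTrace δ U g) (Ioo a b) :=
  (integrable_slab_moment hU hg le_rfl).integral_prod_left.const_mul _

lemma integral_mul_slab_moment (hU : IntegrableOn U (Ioo a b ×ˢ Ioo 0 δ))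
    (hg : IntegrableOn g (Ioo a b ×ˢ Ioo 0 δ)) {α : ℝ → ℝ} (hα : Continuous α) {C : ℝ} (hC : ∀ s, ‖α s‖ ≤ C) {q : ℝ} (hq : q ≤ δ) :
    ∫ s in Ioo a b, α s * ∫ t in Ioo 0 q, (U (s, t) - (q - t) * g (s, t))
      = ∫ x in Ioo a b ×ˢ Ioo 0 q, α x.1 * (U x - (q - x.2) * g x) := by
  have h1 : Integrable (fun x : ℝ × ℝ => α x.1 * (U x - (q - x.2) * g x))
      ((volume.restrict (Ioo a b)).prod (volume.restrict (Ioo 0 q))) :=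
    (integrable_slab_moment hU hg hq).bdd_mul (c := C) (by fun_prop) (Eventually.of_forall fun x => hC _)
  rw [Measure.volume_eq_prod, ← Measure.prod_restrict, integral_prod _ h1]
  simp_rw [integral_const_mul]

/-- The weak derivative with respect to the second variable of a function on a slab. -/
def IsSlabDeriv (a b δ : ℝ) (U g : ℝ × ℝ → ℝ) : Prop :=
  ∀ α p : ℝ → ℝ, ContDiff ℝ ∞ α → HasCompactSupport α → tsupport α ⊆ Ioo a b →
    ContDiff ℝ ∞ p → HasCompactSupport p → tsupport p ⊆ Ioo 0 δ →
    ∫ x in Ioo a b ×ˢ Ioo 0 δ, U x * (α x.1 * deriv p x.2)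
      = -∫ x in Ioo a b ×ˢ Ioo 0 δ, g x * (α x.1 * p x.2)

/-- Pairing with a test function `α` of the first variable reduces to one dimension: `t ↦ ∫ α U` has
weak derivative `∫ α g`. Its moments at heights `q` and `δ` are `q` and `δ` times the same constant,
and `α` is arbitrary. -/
lemma IsSlabDeriv.integral_eq (hδ : 0 < δ) (hw : IsSlabDeriv a b δ U g)
    (hU : IntegrableOn U (Ioo a b ×ˢ Ioo 0 δ)) (hg : IntegrableOn g (Ioo a b ×ˢ Ioo 0 δ))
    {q : ℝ} (hq : q ∈ Icc 0 δ) :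
    ∀ᵐ s, s ∈ Ioo a b →
      ∫ t in Ioo 0 q, (U (s, t) - (q - t) * g (s, t)) = q * slabTrace δ U g s := by
  have hτ := integrableOn_slabTrace hU hg
  have hq' : IntegrableOn (fun s => ∫ t in Ioo 0 q, (U (s, t) - (q - t) * g (s, t))) (Ioo a b) :=
    (integrable_slab_moment hU hg hq.2).integral_prod_left
  have key := isOpen_Ioo.ae_eq_zero_of_integral_contDiff_smul_eq_zero (μ := volume)
    (hq'.sub (hτ.const_mul q)).locallyIntegrableOn fun α hα hαc hαs => ?_
  · filter_upwards [key] with s hs hs'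
    exact sub_eq_zero.1 (hs hs')
  obtain ⟨C, hC⟩ := hαc.exists_bound_of_continuous hα.continuous
  have hαm : ∀ {F : ℝ × ℝ → ℝ}, IntegrableOn F (Ioo a b ×ˢ Ioo 0 δ) →
      Integrable (fun x : ℝ × ℝ => α x.1 * F x)
        ((volume.restrict (Ioo a b)).prod (volume.restrict (Ioo 0 δ))) := fun hF =>
    (integrable_slab hF le_rfl).bdd_mul (c := C) (by fun_prop) (Eventually.of_forall fun x => hC _)
  obtain ⟨c, hc⟩ := exists_integral_eq_of_weakDeriv hδ
    (g := fun t => ∫ s in Ioo a b, α s * U (s, t)) (h := fun t => ∫ s in Ioo a b, α s * g (s, t))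
    (hαm hU).integral_prod_right (hαm hg).integral_prod_right fun p hp hpc hps => by
      obtain ⟨C₁, hC₁⟩ := hpc.exists_bound_of_continuous hp.continuous
      have hpd := hp.continuous_deriv (by simp)
      obtain ⟨C₂, hC₂⟩ := hpc.deriv.exists_bound_of_continuous hpd
      have h1 := hw α p hα hαc hαs hp hpc hps
      rw [Measure.volume_eq_prod, ← Measure.prod_restrict] at h1
      have e1 : ∀ x : ℝ × ℝ, U x * (α x.1 * deriv p x.2) = (α x.1 * U x) * deriv p x.2 :=
        fun x => by ring
      have e2 : ∀ x : ℝ × ℝ, g x * (α x.1 * p x.2) = (α x.1 * g x) * p x.2 :=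
        fun x => by ring
      simp_rw [e1, e2] at h1
      rw [integral_prod_symm, integral_prod_symm] at h1
      · simpa only [integral_mul_const] using h1
      · exact (hαm hg).mul_bdd (c := C₁) (by fun_prop) (Eventually.of_forall fun x => hC₁ _)
      · exact (hαm hU).mul_bdd (c := C₂) (by fun_prop) (Eventually.of_forall fun x => hC₂ _)
  have hmom : ∀ r ∈ Icc 0 δ,
      ∫ s in Ioo a b, α s * ∫ t in Ioo 0 r, (U (s, t) - (r - t) * g (s, t)) = r * c := by
    intro r hr
    have hsub : Ioo a b ×ˢ Ioo 0 r ⊆ Ioo a b ×ˢ Ioo 0 δ := prod_mono_right (Ioo_subset_Ioo_right hr.2)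
    have iU := integrable_slab (q := r) (a := a) (b := b) (δ := δ)
      (by rw [IntegrableOn, Measure.volume_eq_prod, ← Measure.prod_restrict]; exact hαm hU) hr.2
    have ig := integrable_slab (q := r) (a := a) (b := b) (δ := δ)
      (by rw [IntegrableOn, Measure.volume_eq_prod, ← Measure.prod_restrict]; exact hαm hg) hr.2
    have igm : Integrable (fun x : ℝ × ℝ => (r - x.2) * (α x.1 * g x))
        ((volume.restrict (Ioo a b)).prod (volume.restrict (Ioo 0 r))) := by
      refine ig.bdd_mul (c := |r|) (by fun_prop) ?_
      rw [Measure.prod_restrict]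
      filter_upwards [ae_restrict_mem (measurableSet_Ioo.prod measurableSet_Ioo)] with x hx
      have h1 : 0 < x.2 ∧ x.2 < r := hx.2
      rw [Real.norm_eq_abs, abs_of_nonneg (by linarith), abs_of_nonneg (by linarith)]
      linarith
    rw [integral_mul_slab_moment hU hg hα.continuous hC hr.2, Measure.volume_eq_prod,
      ← Measure.prod_restrict, ← hc r hr]
    have e : ∀ x : ℝ × ℝ, α x.1 * (U x - (r - x.2) * g x)
        = α x.1 * U x - (r - x.2) * (α x.1 * g x) := fun x => by ring
    simp_rw [e]
    have hint := igm.integral_prod_right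
    rw [integral_sub iU igm, integral_prod_symm _ iU, integral_prod_symm _ igm,
      ← integral_sub iU.integral_prod_right hint]
    simp_rw [integral_const_mul]
  have hα1 : ∀ {F : ℝ → ℝ}, IntegrableOn F (Ioo a b) → IntegrableOn (fun s => α s * F s) (Ioo a b) :=
    fun hF => hF.bdd_mul (c := C) hα.continuous.aestronglyMeasurable (Eventually.of_forall hC)
  simp only [smul_eq_mul]
  rw [← setIntegral_eq_integral_of_forall_compl_eq_zero (s := Ioo a b) fun s hs => by
    rw [image_eq_zero_of_notMem_tsupport fun h => hs (hαs h), zero_mul]]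
  have e : ∀ s, α s * ((∫ t in Ioo 0 q, (U (s, t) - (q - t) * g (s, t))) - q * slabTrace δ U g s)
      = α s * (∫ t in Ioo 0 q, (U (s, t) - (q - t) * g (s, t)))
        - q * δ⁻¹ * (α s * ∫ t in Ioo 0 δ, (U (s, t) - (δ - t) * g (s, t))) := fun s => by
    rw [slabTrace]; ring
  have hδm : IntegrableOn (fun s => ∫ t in Ioo 0 δ, (U (s, t) - (δ - t) * g (s, t))) (Ioo a b) :=
    (integrable_slab_moment hU hg le_rfl).integral_prod_left
  calc _ = ∫ s in Ioo a b, (α s * (∫ t in Ioo 0 q, (U (s, t) - (q - t) * g (s, t)))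
        - q * δ⁻¹ * (α s * ∫ t in Ioo 0 δ, (U (s, t) - (δ - t) * g (s, t)))) := by
        refine setIntegral_congr_fun measurableSet_Ioo fun s _ => ?_
        exact e s
    _ = 0 := by
        rw [integral_sub (hα1 hq') ((hα1 hδm).const_mul _), integral_const_mul, hmom q hq,
          hmom δ ⟨hδ.le, le_rfl⟩]
        field_simp
        ring

/-- A function on a slab with an integrable weak derivative in the second variable is almost
everywhere the primitive of this derivative. -/
lemma IsSlabDeriv.ae_eq (hδ : 0 < δ) (hw : IsSlabDeriv a b δ U g)
    (hU : IntegrableOn U (Ioo a b ×ˢ Ioo 0 δ)) (hg : IntegrableOn g (Ioo a b ×ˢ Ioo 0 δ)) :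
    ∀ᵐ s, s ∈ Ioo a b → IntegrableOn (fun t => g (s, t)) (Ioo 0 δ) ∧
      ∀ᵐ t, t ∈ Ioo 0 δ → U (s, t) = slabTrace δ U g s + ∫ r in (0 : ℝ)..t, g (s, r) := by
  -- Rational heights give a single null set of exceptional lines.
  have h1 : ∀ᵐ s, ∀ q : ℚ, (q : ℝ) ∈ Icc 0 δ → s ∈ Ioo a b →
      ∫ t in Ioo 0 (q : ℝ), (U (s, t) - (q - t) * g (s, t)) = q * slabTrace δ U g s :=
    ae_all_iff.2 fun q => by
      by_cases hq : (q : ℝ) ∈ Icc 0 δ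
      · filter_upwards [hw.integral_eq hδ hU hg hq] with s hs _ using hs
      · exact Eventually.of_forall fun s h => (hq h).elim
  have h2 := (ae_restrict_iff' measurableSet_Ioo).1 (integrable_slab hU le_rfl).prod_right_ae
  have h3 := (ae_restrict_iff' measurableSet_Ioo).1 (integrable_slab hg le_rfl).prod_right_ae
  filter_upwards [h1, h2, h3] with s hs hUs hgs hsI
  replace hUs : IntegrableOn (fun t => U (s, t)) (Ioo 0 δ) := hUs hsI
  replace hgs : IntegrableOn (fun t => g (s, t)) (Ioo 0 δ) := hgs hsI
  refine ⟨hgs, ?_⟩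
  have hi : IntervalIntegrable (fun t => g (s, t)) volume 0 δ :=
    (intervalIntegrable_iff_integrableOn_Ioo_of_le hδ.le).2 hgs
  have hpc : ContinuousOn (fun t => ∫ r in (0 : ℝ)..t, g (s, r)) (Icc 0 δ) := by
    have := (hi.absolutelyContinuousOnInterval_intervalIntegral (c := 0) left_mem_uIcc).continuousOn
    rwa [uIcc_of_le hδ.le] at this
  have hpi : IntegrableOn (fun t => ∫ r in (0 : ℝ)..t, g (s, r)) (Ioo 0 δ) :=
    (hpc.integrableOn_compact isCompact_Icc).mono_set Ioo_subset_Icc_self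
  have key := ae_eq_zero_of_forall_rat_integral_eq_zero
    (W := fun t => U (s, t) - slabTrace δ U g s - ∫ r in (0 : ℝ)..t, g (s, r))
    ((hUs.sub (integrableOn_const (by simp))).sub hpi) fun q hq => ?_
  · filter_upwards [key] with t ht ht'
    linarith [ht ht']
  have hsub : Ioo 0 (q : ℝ) ⊆ Ioo 0 δ := Ioo_subset_Ioo_right hq.2.le
  have hii : ∀ {F : ℝ → ℝ}, IntegrableOn F (Ioo 0 δ) → IntervalIntegrable F volume 0 q :=
    fun hF => (intervalIntegrable_iff_integrableOn_Ioo_of_le hq.1.le).2 (hF.mono_set hsub)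
  have hm : IntervalIntegrable (fun t => (q - t) * g (s, t)) volume 0 q :=
    (hii hgs).continuousOn_mul (by fun_prop)
  have h4 := hs q ⟨hq.1.le, hq.2.le⟩ hsI
  rw [← integral_Ioc_eq_integral_Ioo, ← intervalIntegral.integral_of_le hq.1.le] at h4 ⊢
  rw [intervalIntegral.integral_sub (hii hUs) hm] at h4
  rw [intervalIntegral.integral_sub ((hii hUs).sub intervalIntegrable_const) (hii hpi),
    intervalIntegral.integral_sub (hii hUs) intervalIntegrable_const, integral_primitive (hii hgs),
    intervalIntegral.integral_const]
  simp only [sub_zero, smul_eq_mul]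
  linarith

end Slab

/-! ### Averages over shrinking boxes at the boundary -/

section HalfDisc

lemma ae_tendsto_integral_sub {a b : ℝ} {τ : ℝ → ℝ} (hτ : IntegrableOn τ (Ioo a b)) :
    ∀ᵐ s, s ∈ Ioo a b → Tendsto (fun r : ℝ => r⁻¹ * ∫ x in Ioo (s - r) (s + r), |τ x - τ s|)
      (𝓝[>] 0) (𝓝 0) := by
  have h1 : Integrable ((Ioo a b).indicator τ) := (integrable_indicator_iff measurableSet_Ioo).2 hτ
  filter_upwards [IsUnifLocDoublingMeasure.ae_tendsto_average_norm_sub volume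
    h1.locallyIntegrable 1] with s hs hsI
  have h2 := hs (fun _ : ℝ => s) (fun r : ℝ => r) tendsto_id (by
    filter_upwards [self_mem_nhdsWithin] with r hr
    exact Metric.mem_closedBall_self (by simpa using (mem_Ioi.1 hr).le))
  have h3 := h2.const_mul 2
  rw [mul_zero] at h3
  refine h3.congr' ?_
  have hnear : ∀ᶠ r : ℝ in 𝓝[>] 0, r < min (s - a) (b - s) :=
    nhdsWithin_le_nhds (gt_mem_nhds (lt_min (sub_pos.2 hsI.1) (sub_pos.2 hsI.2)))
  filter_upwards [self_mem_nhdsWithin, hnear] with r hr hr'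
  have hr0 : 0 < r := hr
  rw [setAverage_eq, Real.closedBall_eq_Icc, integral_Icc_eq_integral_Ioo, measureReal_def,
    Real.volume_Icc, ENNReal.toReal_ofReal (by linarith), smul_eq_mul]
  have h4 : ∫ x in Ioo (s - r) (s + r), ‖(Ioo a b).indicator τ x - (Ioo a b).indicator τ s‖
      = ∫ x in Ioo (s - r) (s + r), |τ x - τ s| := by
    refine setIntegral_congr_fun measurableSet_Ioo fun x hx => ?_
    have hx' : x ∈ Ioo a b := ⟨by linarith [hx.1, hr'.trans_le (min_le_left _ _)],
      by linarith [hx.2, hr'.trans_le (min_le_right _ _)]⟩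
    simp only [indicator_of_mem hx', indicator_of_mem hsI, Real.norm_eq_abs]
  rw [h4]
  have : s + r - (s - r) = 2 * r := by ring
  rw [this, mul_inv]
  ring

/-- The open box of size `r` over the point `s` of the boundary. -/
def box (s r : ℝ) : Set (ℝ × ℝ) := Ioo (s - r) (s + r) ×ˢ Ioo 0 r

lemma volume_box (s : ℝ) {r : ℝ} (hr : 0 ≤ r) : volume (box s r) = ENNReal.ofReal (2 * r ^ 2) := by
  rw [box, Measure.volume_eq_prod, Measure.prod_prod, Real.volume_Ioo, Real.volume_Ioo,
    ← ENNReal.ofReal_mul (by linarith)]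
  congr 1; ring

/-- Cauchy–Schwarz heuristics: the box has area of order `r²` and the `L²` mass of `g` on it
vanishes, so the integral of `|g|` is `o(r)`. -/
lemma tendsto_integral_box {D : Set (ℝ × ℝ)} {g : ℝ × ℝ → ℝ} (hg : MemLp g 2 (volume.restrict D)) {s : ℝ}
    (hs : ∀ᶠ r in 𝓝[>] (0 : ℝ), box s r ⊆ D) :
    Tendsto (fun r : ℝ => r⁻¹ * ∫ x in box s r, |g x|) (𝓝[>] 0) (𝓝 0) := by
  have h2 : IntegrableOn (fun x => g x ^ 2) D := hg.integrable_sq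
  have hv : Tendsto (fun r : ℝ => (volume.restrict D) (box s r)) (𝓝[>] 0) (𝓝 0) := by
    have : Tendsto (fun r : ℝ => ENNReal.ofReal (2 * r ^ 2)) (𝓝[>] 0) (𝓝 0) := by
      have h : Tendsto (fun r : ℝ => ENNReal.ofReal (2 * r ^ 2)) (𝓝 0) (𝓝 (ENNReal.ofReal (2 * 0 ^ 2))) :=
        (ENNReal.continuous_ofReal.comp (by fun_prop : Continuous fun r : ℝ => 2 * r ^ 2)).tendsto 0
      simpa using h.mono_left nhdsWithin_le_nhds
    refine tendsto_of_tendsto_of_tendsto_of_le_of_le' tendsto_const_nhds this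
      (Eventually.of_forall fun _ => zero_le) ?_
    filter_upwards [self_mem_nhdsWithin] with r hr
    rw [← volume_box s (mem_Ioi.1 hr).le]
    exact Measure.restrict_apply_le _ _
  have hG := h2.tendsto_setIntegral_nhds_zero hv
  rw [Metric.tendsto_nhds]
  intro ε hε
  have h3 := (hG.eventually (gt_mem_nhds (show (0 : ℝ) < ε ^ 2 / 4 by positivity)))
  filter_upwards [self_mem_nhdsWithin, hs, h3] with r hr hrD hrG
  have hr0 : 0 < r := hr
  rw [Measure.restrict_restrict_of_subset hrD] at hrG
  have hi2 : IntegrableOn (fun x => g x ^ 2) (box s r) := h2.mono_set hrD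
  have hfin : volume (box s r) ≠ ⊤ := by rw [volume_box s hr0.le]; exact ENNReal.ofReal_ne_top
  have hpt : ∫ x in box s r, |g x| ≤ ∫ x in box s r, (ε / (4 * r) + r / ε * g x ^ 2) := by
    refine integral_mono_of_nonneg (Eventually.of_forall fun x => abs_nonneg _)
      ((integrableOn_const hfin).add (hi2.const_mul _)) (Eventually.of_forall fun x => ?_)
    -- Young's inequality as a completed square, with weight `r / ε`, so that both resulting terms
    -- have order `r ε`.
    have h5 : 0 ≤ (r / ε) * (|g x| - ε / (2 * r)) ^ 2 := by positivity
    have h6 : (r / ε) * (|g x| - ε / (2 * r)) ^ 2 = r / ε * g x ^ 2 - |g x| + ε / (4 * r) := by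
      rw [← sq_abs (g x)]; field_simp; ring
    simp only
    linarith
  have hci : IntegrableOn (fun _ : ℝ × ℝ => ε / (4 * r)) (box s r) := integrableOn_const hfin
  rw [integral_add hci (hi2.const_mul _), integral_const_mul,
    setIntegral_const, measureReal_def, volume_box s hr0.le,
    ENNReal.toReal_ofReal (by positivity), smul_eq_mul] at hpt
  rw [Real.dist_eq, sub_zero, abs_of_nonneg (mul_nonneg (inv_nonneg.2 hr0.le)
    (integral_nonneg fun _ => abs_nonneg _)), inv_mul_lt_iff₀ hr0]
  have h7 : r / ε * ∫ x in box s r, g x ^ 2 < r / ε * (ε ^ 2 / 4) := by gcongr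
  have h8 : 2 * r ^ 2 * (ε / (4 * r)) + r / ε * (ε ^ 2 / 4) = 3 / 4 * (r * ε) := by
    field_simp; ring
  nlinarith [mul_pos hr0 hε]

variable {a b δ : ℝ} {U g : ℝ × ℝ → ℝ}

/-- Along almost every vertical line `U` differs from its trace by at most the integral of `|g|`.
Over the box this leaves the oscillation of the trace, which vanishes at its Lebesgue points, and
the `o(r)` contribution of `tendsto_integral_box`. -/
lemma IsSlabDeriv.tendsto_box (hδ : 0 < δ) (hw : IsSlabDeriv a b δ U g)
    (hU : MemLp U 2 (volume.restrict (Ioo a b ×ˢ Ioo 0 δ)))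
    (hg : MemLp g 2 (volume.restrict (Ioo a b ×ˢ Ioo 0 δ))) :
    ∀ᵐ s, s ∈ Ioo a b → Tendsto (fun r : ℝ => (r ^ 2)⁻¹ * ∫ x in box s r, |U x - slabTrace δ U g s|)
      (𝓝[>] 0) (𝓝 0) := by
  have hfin : volume (Ioo a b ×ˢ Ioo 0 δ) ≠ ⊤ :=
    ((Metric.isBounded_Ioo a b).prod (Metric.isBounded_Ioo 0 δ)).measure_lt_top.ne
  have hfm : IsFiniteMeasure (volume.restrict (Ioo a b ×ˢ Ioo 0 δ)) :=
    ⟨by rw [Measure.restrict_apply_univ]; exact hfin.lt_top⟩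
  have hU1 : IntegrableOn U (Ioo a b ×ˢ Ioo 0 δ) := hU.integrable one_le_two
  have hg1 : IntegrableOn g (Ioo a b ×ˢ Ioo 0 δ) := hg.integrable one_le_two
  have hτ := integrableOn_slabTrace hU1 hg1
  have hae := hw.ae_eq hδ hU1 hg1
  filter_upwards [ae_tendsto_integral_sub hτ] with s hs hsI
  have hnear : ∀ᶠ r : ℝ in 𝓝[>] 0, r < min (min (s - a) (b - s)) δ :=
    nhdsWithin_le_nhds (gt_mem_nhds (lt_min (lt_min (sub_pos.2 hsI.1) (sub_pos.2 hsI.2)) hδ))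
  have hbox : ∀ᶠ r : ℝ in 𝓝[>] 0, Ioo (s - r) (s + r) ⊆ Ioo a b ∧ Ioo 0 r ⊆ Ioo 0 δ := by
    filter_upwards [hnear] with r hr
    simp only [lt_min_iff] at hr
    exact ⟨Ioo_subset_Ioo (by linarith) (by linarith), Ioo_subset_Ioo_right hr.2.le⟩
  have hlim := (hs hsI).add (tendsto_integral_box hg (hbox.mono fun r hr => prod_mono hr.1 hr.2))
  rw [add_zero] at hlim
  refine tendsto_of_tendsto_of_tendsto_of_le_of_le' tendsto_const_nhds hlim
    (Eventually.of_forall fun r => mul_nonneg (inv_nonneg.2 (sq_nonneg r))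
      (integral_nonneg fun _ => abs_nonneg _)) ?_
  filter_upwards [self_mem_nhdsWithin, hbox] with r hr hr'
  have hr0 : 0 < r := hr
  have hsub : box s r ⊆ Ioo a b ×ˢ Ioo 0 δ := prod_mono hr'.1 hr'.2
  have hpi : ∀ {F : ℝ × ℝ → ℝ}, IntegrableOn F (box s r) → Integrable F
      ((volume.restrict (Ioo (s - r) (s + r))).prod (volume.restrict (Ioo 0 r))) := fun hF => by
    rwa [Measure.prod_restrict]
  have hfinb : volume (box s r) ≠ ⊤ := by rw [volume_box s hr0.le]; exact ENNReal.ofReal_ne_top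
  have hUb : IntegrableOn (fun x => |U x - slabTrace δ U g s|) (box s r) :=
    ((hU1.mono_set hsub).sub (integrableOn_const hfinb)).abs
  have hgb : IntegrableOn (fun x => |g x|) (box s r) := (hg1.mono_set hsub).abs
  have hτb : IntegrableOn (fun x => |slabTrace δ U g x - slabTrace δ U g s|) (Ioo (s - r) (s + r)) :=
    ((hτ.mono_set hr'.1).sub (integrableOn_const (by simp))).abs
  have hfub : ∀ {F : ℝ × ℝ → ℝ}, IntegrableOn F (box s r) → ∫ x in box s r, F x
      = ∫ x in Ioo (s - r) (s + r), ∫ t in Ioo 0 r, F (x, t) := fun hF => by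
    rw [box, Measure.volume_eq_prod, ← Measure.prod_restrict, integral_prod _ (hpi hF)]
  have hmain : ∫ x in box s r, |U x - slabTrace δ U g s|
      ≤ r * ∫ x in Ioo (s - r) (s + r), (|slabTrace δ U g x - slabTrace δ U g s|
        + ∫ t in Ioo 0 r, |g (x, t)|) := by
    rw [hfub hUb, ← integral_const_mul]
    refine integral_mono_ae (hpi hUb).integral_prod_left
      ((hτb.add (hpi hgb).integral_prod_left).const_mul r) ?_
    refine (ae_restrict_iff' measurableSet_Ioo).2 ?_
    filter_upwards [hae] with x hx hxI
    obtain ⟨hgx, hUx⟩ := hx (hr'.1 hxI)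
    have hgx' : IntegrableOn (fun t => |g (x, t)|) (Ioo 0 r) := (hgx.mono_set hr'.2).abs
    have hb : ∫ t in Ioo 0 r, |U (x, t) - slabTrace δ U g s|
        ≤ ∫ _ in Ioo 0 r, (|slabTrace δ U g x - slabTrace δ U g s| + ∫ t in Ioo 0 r, |g (x, t)|) := by
      refine integral_mono_of_nonneg (Eventually.of_forall fun _ => abs_nonneg _)
        (integrableOn_const (by simp)) ((ae_restrict_iff' measurableSet_Ioo).2 ?_)
      filter_upwards [hUx] with t ht htI
      have e : U (x, t) - slabTrace δ U g s
          = (slabTrace δ U g x - slabTrace δ U g s) + ∫ r in (0 : ℝ)..t, g (x, r) := by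
        rw [ht (hr'.2 htI)]; ring
      rw [e]
      refine (abs_add_le _ _).trans (add_le_add le_rfl ?_)
      rw [intervalIntegral.integral_of_le htI.1.le]
      refine (norm_integral_le_integral_norm (fun y => g (x, y))).trans ?_
      exact setIntegral_mono_set hgx' (Eventually.of_forall fun _ => abs_nonneg _)
        (LE.le.eventuallyLE fun y hy => ⟨hy.1, hy.2.trans_lt htI.2⟩)
    refine hb.trans (le_of_eq ?_)
    rw [setIntegral_const, measureReal_def, Real.volume_Ioo, sub_zero,
      ENNReal.toReal_ofReal hr0.le, smul_eq_mul]
  rw [integral_add hτb (hpi hgb).integral_prod_left, ← hfub hgb] at hmain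
  calc (r ^ 2)⁻¹ * ∫ x in box s r, |U x - slabTrace δ U g s| ≤ (r ^ 2)⁻¹ * _ :=
        mul_le_mul_of_nonneg_left hmain (by positivity)
    _ = _ := by field_simp

end HalfDisc

/-! ### Passing between the plane and adapted coordinates -/

section ChartTransfer

/-- The inverse of `chart p e σ`. -/
noncomputable def chartInv (p e : ℂ) (σ : ℝ) (z : ℂ) : ℝ × ℝ :=
  ((conj e * (z - p)).re, σ * (conj e * (z - p)).im)

variable {p e : ℂ} {σ : ℝ}

lemma chartInv_chart (he : ‖e‖ = 1) (hσ : σ ^ 2 = 1) (q : ℝ × ℝ) :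
    chartInv p e σ (chart p e σ q) = q := by
  have h1 : conj e * (chart p e σ q - p) = q.1 + ((σ * q.2 : ℝ) : ℂ) * Complex.I := by
    have : conj e * e = 1 := by rw [Complex.conj_mul', he]; simp
    rw [chart]
    push_cast
    linear_combination (q.1 + σ * q.2 * Complex.I) * this
  rw [chartInv, h1]
  ext
  · simp
  · have : ((q.1 : ℂ) + ((σ * q.2 : ℝ) : ℂ) * Complex.I).im = σ * q.2 := by simp
    rw [this, ← mul_assoc, ← sq, hσ, one_mul]

lemma chart_chartInv (he : ‖e‖ = 1) (hσ : σ ^ 2 = 1) (z : ℂ) :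
    chart p e σ (chartInv p e σ z) = z := by
  have h0 : e * conj e = 1 := by rw [Complex.mul_conj', he]; simp
  have h1 : ((σ : ℂ)) * σ = 1 := by rw [← sq]; exact_mod_cast hσ
  have h2 := Complex.re_add_im (conj e * (z - p))
  rw [chart, chartInv]
  push_cast
  rw [← mul_assoc (σ : ℂ), h1, one_mul, h2, ← mul_assoc, h0]
  ring

lemma chart_injective (he : ‖e‖ = 1) (hσ : σ ^ 2 = 1) : Function.Injective (chart p e σ) :=
  Function.LeftInverse.injective (chartInv_chart he hσ)

lemma measurableEmbedding_chart (he : ‖e‖ = 1) (hσ : σ ^ 2 = 1) :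
    MeasurableEmbedding (chart p e σ) :=
  (continuous_chart p e σ).measurableEmbedding (chart_injective he hσ)

/-- The vector `σ e i` is the normal pointing into the half plane of the chart; derivatives along it
become derivatives in the second coordinate. -/
lemma chartInv_add_smul (he : ‖e‖ = 1) (hσ : σ ^ 2 = 1) (z : ℂ) (r : ℝ) :
    chartInv p e σ (z + r • (σ * e * Complex.I)) = chartInv p e σ z + (0, r) := by
  obtain ⟨q, rfl⟩ : ∃ q, chart p e σ q = z := ⟨_, chart_chartInv he hσ z⟩
  have : chart p e σ q + r • (σ * e * Complex.I) = chart p e σ (q + (0, r)) := by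
    simp only [chart, Prod.fst_add, Prod.snd_add, Complex.real_smul]; push_cast; ring
  rw [this, chartInv_chart he hσ, chartInv_chart he hσ]

lemma setIntegral_eq_setIntegral_chart (he : ‖e‖ = 1) (hσ : σ ^ 2 = 1) {D : Set ℂ}
    (hD : MeasurableSet D) {R : Set (ℝ × ℝ)} (hR : chart p e σ '' R ⊆ D) {F : ℂ → ℝ}
    (hF : ∀ z ∉ chart p e σ '' R, F z = 0) :
    ∫ z in D, F z = ∫ q in R, F (chart p e σ q) := by
  rw [← (measurePreserving_chart he hσ).setIntegral_image_emb (measurableEmbedding_chart he hσ)]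
  exact setIntegral_eq_of_subset_of_forall_sdiff_eq_zero hD hR fun z hz => hF z hz.2

lemma measurePreserving_restrict_chart (he : ‖e‖ = 1) (hσ : σ ^ 2 = 1) (R : Set (ℝ × ℝ)) :
    MeasurePreserving (chart p e σ) (volume.restrict R) (volume.restrict (chart p e σ '' R)) :=
  (measurePreserving_chart he hσ).restrict_image_emb (measurableEmbedding_chart he hσ) R

lemma memLp_comp_chart {F : Type*} [NormedAddCommGroup F] (he : ‖e‖ = 1) (hσ : σ ^ 2 = 1)
    {D : Set ℂ} {R : Set (ℝ × ℝ)} (hR : chart p e σ '' R ⊆ D) {u : ℂ → F}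
    (hu : MemLp u 2 (volume.restrict D)) : MemLp (fun q => u (chart p e σ q)) 2 (volume.restrict R) :=
  (hu.mono_measure (Measure.restrict_mono_set _ hR)).comp_measurePreserving
    (measurePreserving_restrict_chart he hσ R)

lemma eLpNorm_comp_chart_le {F : Type*} [NormedAddCommGroup F] (he : ‖e‖ = 1) (hσ : σ ^ 2 = 1)
    {D : Set ℂ} {R : Set (ℝ × ℝ)} (hR : chart p e σ '' R ⊆ D) {u : ℂ → F}
    (hu : AEStronglyMeasurable u (volume.restrict D)) :
    eLpNorm (fun q => u (chart p e σ q)) 2 (volume.restrict R) ≤ eLpNorm u 2 (volume.restrict D) := by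
  have h1 := Measure.restrict_mono_set (volume : Measure ℂ) hR
  exact (eLpNorm_comp_measurePreserving (hu.mono_measure h1)
    (measurePreserving_restrict_chart he hσ R)).trans_le (eLpNorm_mono_measure _ h1)

/-- Products of one-variable test functions, pulled back by the chart, are admissible in the plane,
and their derivative along the normal falls on the second factor alone. -/
lemma IsWeakGrad.isSlabDeriv (he : ‖e‖ = 1) (hσ : σ ^ 2 = 1) {D : Set ℂ} (hD : IsOpen D) {a b δ : ℝ}
    (hR : chart p e σ '' (Ioo a b ×ˢ Ioo 0 δ) ⊆ D) {u : ℂ → ℝ} {G : ℂ → ℂ}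
    (hw : IsWeakGrad D u G) : IsSlabDeriv a b δ (fun q => u (chart p e σ q))
      (fun q => inner ℝ (G (chart p e σ q)) (σ * e * Complex.I)) := by
  intro α π hα hαc hαs hπ hπc hπs
  set φ : ℂ → ℝ := fun z => α (chartInv p e σ z).1 * π (chartInv p e σ z).2 with hφ
  have hK : IsCompact (chart p e σ '' (tsupport α ×ˢ tsupport π)) :=
    (hαc.isCompact.prod hπc.isCompact).image (continuous_chart p e σ)
  have hsupp : Function.support φ ⊆ chart p e σ '' (tsupport α ×ˢ tsupport π) := by
    intro z hz
    have hz' := mul_ne_zero_iff.1 hz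
    exact ⟨_, ⟨subset_tsupport _ hz'.1, subset_tsupport _ hz'.2⟩, chart_chartInv he hσ z⟩
  have hKR : chart p e σ '' (tsupport α ×ˢ tsupport π) ⊆ chart p e σ '' (Ioo a b ×ˢ Ioo 0 δ) :=
    image_mono (prod_mono hαs hπs)
  have hts : tsupport φ ⊆ chart p e σ '' (Ioo a b ×ˢ Ioo 0 δ) :=
    (closure_minimal hsupp hK.isClosed).trans hKR
  have hsmooth : ContDiff ℝ ∞ φ := by
    have h1 : ContDiff ℝ ∞ fun z : ℂ => (conj e * (z - p)) := by fun_prop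
    exact (hα.comp (Complex.reCLM.contDiff.comp h1)).mul
      (hπ.comp (contDiff_const.mul (Complex.imCLM.contDiff.comp h1)))
  have hder : ∀ z, fderiv ℝ φ z (σ * e * Complex.I)
      = α (chartInv p e σ z).1 * deriv π (chartInv p e σ z).2 := by
    intro z
    rw [← ((hsmooth.differentiable (by simp)) z).lineDeriv_eq_fderiv, lineDeriv]
    simp only [hφ, chartInv_add_smul he hσ, Prod.fst_add, Prod.snd_add, add_zero]
    rw [deriv_const_mul_field, deriv_comp_const_add, add_zero]
  have key := hw.2 φ hsmooth (HasCompactSupport.of_support_subset_isCompact hK hsupp)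
    (hts.trans hR) (σ * e * Complex.I)
  have hφ0 : ∀ z ∉ chart p e σ '' (Ioo a b ×ˢ Ioo 0 δ), φ z = 0 := fun z hz =>
    image_eq_zero_of_notMem_tsupport fun h => hz (hts h)
  have hφ1 : ∀ z ∉ chart p e σ '' (Ioo a b ×ˢ Ioo 0 δ), fderiv ℝ φ z = 0 := fun z hz =>
    image_eq_zero_of_notMem_tsupport fun h => hz (hts (tsupport_fderiv_subset ℝ h))
  rw [setIntegral_eq_setIntegral_chart he hσ hD.measurableSet hR fun z hz => by rw [hφ1 z hz]; simp,
    setIntegral_eq_setIntegral_chart he hσ hD.measurableSet hR fun z hz => by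
      rw [hφ0 z hz, mul_zero]] at key
  simp only [hder] at key
  simpa only [hφ, chartInv_chart he hσ] using key

/-- The open upper half disc of radius `r` centred at `(s, 0)`. -/
def halfDisc (s r : ℝ) : Set (ℝ × ℝ) := {q | (q.1 - s) ^ 2 + q.2 ^ 2 < r ^ 2 ∧ 0 < q.2}

lemma measurableSet_halfDisc (s r : ℝ) : MeasurableSet (halfDisc s r) :=
  ((isOpen_lt (by fun_prop : Continuous fun q : ℝ × ℝ => (q.1 - s) ^ 2 + q.2 ^ 2)
    continuous_const).inter (isOpen_lt continuous_const continuous_snd)).measurableSet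

lemma halfDisc_subset_box {s r : ℝ} (hr : 0 < r) : halfDisc s r ⊆ box s r := by
  rintro ⟨x, y⟩ ⟨h1, h2⟩
  have h3 := abs_lt_of_sq_lt_sq (a := x - s) (b := r) (by nlinarith [sq_nonneg y]) hr.le
  have h4 := abs_lt_of_sq_lt_sq (a := y) (b := r) (by nlinarith [sq_nonneg (x - s)]) hr.le
  rw [abs_lt] at h3 h4
  exact ⟨⟨by linarith, by linarith⟩, ⟨h2, h4.2⟩⟩

lemma le_volume_halfDisc (s : ℝ) {r : ℝ} (hr : 0 < r) :
    r ^ 2 / 2 ≤ volume.real (halfDisc s r) := by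
  -- The inscribed box of half size has area `2 (r / 2)² = r² / 2`.
  have h1 : box s (r / 2) ⊆ halfDisc s r := by
    rintro ⟨x, y⟩ ⟨h1, h2⟩
    have h1' : s - r / 2 < x ∧ x < s + r / 2 := h1
    have h2' : 0 < y ∧ y < r / 2 := h2
    refine ⟨?_, h2'.1⟩
    dsimp only
    nlinarith [mul_pos (sub_pos.2 h1'.1) (sub_pos.2 h1'.2), mul_pos h2'.1 (sub_pos.2 h2'.2)]
  have hfin : volume (halfDisc s r) ≠ ⊤ :=
    ne_top_of_le_ne_top (by rw [volume_box s hr.le]; exact ENNReal.ofReal_ne_top)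
      (measure_mono (halfDisc_subset_box hr))
  refine le_trans (le_of_eq ?_) (measureReal_mono h1 hfin)
  rw [measureReal_def, volume_box s (by positivity), ENNReal.toReal_ofReal (by positivity)]
  ring

/-- The half disc sits in the box and its area is at least `r² / 2`, so mean `L¹` deviation over
boxes controls that over half discs. -/
lemma tendsto_average_halfDisc {U : ℝ × ℝ → ℝ} {s c : ℝ}
    (hU : ∀ᶠ r in 𝓝[>] (0 : ℝ), IntegrableOn U (box s r))
    (h : Tendsto (fun r : ℝ => (r ^ 2)⁻¹ * ∫ x in box s r, |U x - c|) (𝓝[>] 0) (𝓝 0)) :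
    Tendsto (fun r : ℝ => ⨍ x in halfDisc s r, U x) (𝓝[>] 0) (𝓝 c) := by
  rw [tendsto_iff_dist_tendsto_zero]
  have h2 := h.const_mul 2
  rw [mul_zero] at h2
  refine tendsto_of_tendsto_of_tendsto_of_le_of_le' tendsto_const_nhds h2
    (Eventually.of_forall fun _ => dist_nonneg) ?_
  filter_upwards [self_mem_nhdsWithin, hU] with r hr hUr
  have hr0 : 0 < r := hr
  have hv := le_volume_halfDisc s hr0
  have hv0 : 0 < volume.real (halfDisc s r) := lt_of_lt_of_le (by positivity) hv
  have hbf : volume (box s r) ≠ ⊤ := by rw [volume_box s hr0.le]; exact ENNReal.ofReal_ne_top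
  have hfin : volume (halfDisc s r) ≠ ⊤ :=
    ne_top_of_le_ne_top hbf (measure_mono (halfDisc_subset_box hr0))
  have hUd : IntegrableOn U (halfDisc s r) := hUr.mono_set (halfDisc_subset_box hr0)
  have hcd : IntegrableOn (fun _ => c) (halfDisc s r) := integrableOn_const hfin
  have hcb : IntegrableOn (fun _ => c) (box s r) := integrableOn_const hbf
  have e1 : (⨍ x in halfDisc s r, U x) - c
      = (volume.real (halfDisc s r))⁻¹ * ∫ x in halfDisc s r, (U x - c) := by
    rw [integral_sub hUd hcd, setIntegral_const, setAverage_eq, smul_eq_mul, smul_eq_mul]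
    field_simp
  rw [Real.dist_eq, e1, abs_mul, abs_of_pos (inv_pos.2 hv0)]
  have hib : IntegrableOn (fun x => |U x - c|) (box s r) := (hUr.sub hcb).abs
  have e2 : |∫ x in halfDisc s r, (U x - c)| ≤ ∫ x in box s r, |U x - c| :=
    (norm_integral_le_integral_norm fun x => U x - c).trans (setIntegral_mono_set hib
      (Eventually.of_forall fun _ => abs_nonneg _) (LE.le.eventuallyLE (halfDisc_subset_box hr0)))
  have e3 : (volume.real (halfDisc s r))⁻¹ ≤ 2 * (r ^ 2)⁻¹ := by
    rw [inv_le_comm₀ hv0 (by positivity)]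
    refine le_trans (le_of_eq ?_) hv
    field_simp
  calc _ ≤ 2 * (r ^ 2)⁻¹ * ∫ x in box s r, |U x - c| := by gcongr
    _ = _ := by ring

end ChartTransfer

/-! ### Local formula for the trace on the curve -/

section BoundaryTrace

variable {p e : ℂ} {σ : ℝ}

lemma volume_real_image_chart (he : ‖e‖ = 1) (hσ : σ ^ 2 = 1) (R : Set (ℝ × ℝ)) :
    volume.real (chart p e σ '' R) = volume.real R := by
  rw [measureReal_def, measureReal_def,
    ← (measurePreserving_chart he hσ).measure_preimage_emb (measurableEmbedding_chart he hσ),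
    preimage_image_eq _ (chart_injective he hσ)]

lemma setAverage_image_chart (he : ‖e‖ = 1) (hσ : σ ^ 2 = 1) (R : Set (ℝ × ℝ)) (u : ℂ → ℝ) :
    ⨍ z in chart p e σ '' R, u z = ⨍ q in R, u (chart p e σ q) := by
  rw [setAverage_eq, setAverage_eq, volume_real_image_chart he hσ,
    (measurePreserving_chart he hσ).setIntegral_image_emb (measurableEmbedding_chart he hσ)]

lemma chart_halfDisc_subset_ball (he : ‖e‖ = 1) (hσ : σ ^ 2 = 1) (s : ℝ) {r : ℝ} (hr : 0 < r) :
    chart p e σ '' halfDisc s r ⊆ Metric.ball (chart p e σ (s, 0)) r := by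
  rintro _ ⟨q, hq, rfl⟩
  rw [Metric.mem_ball, dist_eq_norm, norm_chart_sub he hσ, Real.sqrt_lt' hr, sub_zero]
  exact hq.1

lemma disjoint_image_chart (he : ‖e‖ = 1) (s r : ℝ) :
    Disjoint (chart p e (-1) '' halfDisc s r) (chart p e 1 '' halfDisc s r) := by
  rw [disjoint_left]
  rintro _ ⟨q, hq, rfl⟩ ⟨q', hq', h⟩
  have h1 : chart p e (-1) q = chart p e 1 (q.1, -q.2) := by simp [chart]
  rw [h1] at h
  have h2 := chart_injective he (one_pow 2) h
  have h3 : q'.2 = -q.2 := by rw [h2]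
  linarith [hq.2, hq'.2]

/-- The trace on the side `i` of a Sobolev function, from the side of the curve given by `σ`. -/
noncomputable def sideTrace (n : ℕ) (i : SideIndex n) (σ δ : ℝ) (u : ℂ → ℝ) (G : ℂ → ℂ) (s : ℝ) : ℝ :=
  slabTrace δ (fun q => u (chart (sideBase n i) (sideDir n i) σ q))
    (fun q => inner ℝ (G (chart (sideBase n i) (sideDir n i) σ q)) (σ * sideDir n i * Complex.I)) s

/-- The diameter separating the two half discs consists of points of the side itself, which are not
in the domain. -/
lemma ball_inter_domain_subset {n : ℕ} {i : SideIndex n} {s r : ℝ}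
    (hr : Ioo (s - r) (s + r) ⊆ Ioo 0 (sideLength n)) :
    Metric.ball (sideParam n i s) r ∩ domain n
      ⊆ chart (sideBase n i) (sideDir n i) (-1) '' halfDisc s r
        ∪ chart (sideBase n i) (sideDir n i) 1 '' halfDisc s r := by
  rintro z ⟨hz, hzD⟩
  have hr0 : 0 < r := Metric.nonempty_ball.1 ⟨z, hz⟩
  have he := norm_sideDir n i
  obtain ⟨⟨x, y⟩, rfl⟩ : ∃ q, chart (sideBase n i) (sideDir n i) 1 q = z :=
    ⟨_, chart_chartInv he (one_pow 2) z⟩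
  rw [Metric.mem_ball, dist_eq_norm, sideParam_eq_chart n i 1, norm_chart_sub he (one_pow 2),
    Real.sqrt_lt' hr0, sub_zero] at hz
  rcases lt_trichotomy y 0 with hy | hy | hy
  · refine Or.inl ⟨(x, -y), ⟨by simpa using hz, by simpa using hy⟩, by simp [chart]⟩
  · exfalso
    subst hy
    have h3 := abs_lt_of_sq_lt_sq (a := x - s) (b := r) (by simpa using hz) hr0.le
    rw [abs_lt] at h3
    refine hzD.1 ?_
    rw [← sideParam_eq_chart]
    exact mem_iUnion.2 ⟨i, mem_image_of_mem _ (Ioo_subset_Icc_self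
      (hr ⟨by linarith, by linarith⟩))⟩
  · exact Or.inr ⟨(x, y), ⟨hz, hy⟩, rfl⟩

lemma tendsto_average_chart {n : ℕ} {i : SideIndex n} (hσ : σ ^ 2 = 1) {s₀ δ : ℝ} (hδ : 0 < δ)
    (hR : chart (sideBase n i) (sideDir n i) σ '' window s₀ δ ⊆ domain n) {u : ℂ → ℝ} {G : ℂ → ℂ}
    (hu : MemLp u 2 (volume.restrict (domain n))) (hw : IsWeakGrad (domain n) u G) :
    ∀ᵐ s, s ∈ Ioo (s₀ - δ) (s₀ + δ) → Tendsto (fun r : ℝ =>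
      ⨍ z in chart (sideBase n i) (sideDir n i) σ '' halfDisc s r, u z) (𝓝[>] 0)
      (𝓝 (sideTrace n i σ δ u G s)) := by
  have he := norm_sideDir n i
  have hU := memLp_comp_chart he hσ hR hu
  have hg := (memLp_comp_chart he hσ hR hw.1).inner_const (𝕜 := ℝ) (σ * sideDir n i * Complex.I)
  filter_upwards [(hw.isSlabDeriv he hσ (isOpen_domain n) hR).tendsto_box hδ hU hg] with s hs hsI
  simp_rw [setAverage_image_chart he hσ]
  refine tendsto_average_halfDisc ?_ (hs hsI)
  have hnear : ∀ᶠ r : ℝ in 𝓝[>] 0, r < min (min (s - (s₀ - δ)) (s₀ + δ - s)) δ :=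
    nhdsWithin_le_nhds (gt_mem_nhds (lt_min (lt_min (sub_pos.2 hsI.1) (sub_pos.2 hsI.2)) hδ))
  filter_upwards [hnear, self_mem_nhdsWithin] with r hr hr0
  simp only [lt_min_iff] at hr
  have hsub : box s r ⊆ window s₀ δ :=
    prod_mono (Ioo_subset_Ioo (by linarith) (by linarith)) (Ioo_subset_Ioo_right hr.2.le)
  have : IsFiniteMeasure (volume.restrict (box s r)) :=
    ⟨by rw [Measure.restrict_apply_univ, volume_box s (mem_Ioi.1 hr0).le]; exact ENNReal.ofReal_lt_top⟩
  exact (hU.mono_measure (Measure.restrict_mono_set _ hsub)).integrable one_le_two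

/-- Near a good point of a side, the trace of a Sobolev function exists almost everywhere and is
the average of the traces from the sides of the curve lying in the domain. -/
lemma IsGoodPoint.exists_hasTraceAt {n : ℕ} {i : SideIndex n} {s₀ : ℝ} (hg : IsGoodPoint n i s₀)
    (hs : s₀ ∈ Ioo 0 (sideLength n)) : ∃ δ > 0, ∃ c : ℝ,
      Ioo (s₀ - δ) (s₀ + δ) ⊆ Ioo 0 (sideLength n) ∧
      chart (sideBase n i) (sideDir n i) (-1) '' window s₀ δ ⊆ domain n ∧
      (c ≠ 0 → chart (sideBase n i) (sideDir n i) 1 '' window s₀ δ ⊆ domain n) ∧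
      ∀ u G, MemLp u 2 (volume.restrict (domain n)) → IsWeakGrad (domain n) u G →
        ∀ᵐ s, s ∈ Ioo (s₀ - δ) (s₀ + δ) → HasTraceAt (domain n) u (sideParam n i s)
          ((1 - c) * sideTrace n i (-1) δ u G s + c * sideTrace n i 1 δ u G s) := by
  obtain ⟨δ, hδ, hI, hin, hout⟩ := hg.exists_window hs
  have he := norm_sideDir n i
  have h1 : (-1 : ℝ) ^ 2 = 1 := by norm_num
  have hnear : ∀ s ∈ Ioo (s₀ - δ) (s₀ + δ), ∀ᶠ r : ℝ in 𝓝[>] 0,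
      0 < r ∧ Ioo (s - r) (s + r) ⊆ Ioo (s₀ - δ) (s₀ + δ) ∧ halfDisc s r ⊆ window s₀ δ := by
    intro s hsI
    have hnear : ∀ᶠ r : ℝ in 𝓝[>] 0, r < min (min (s - (s₀ - δ)) (s₀ + δ - s)) δ :=
      nhdsWithin_le_nhds (gt_mem_nhds (lt_min (lt_min (sub_pos.2 hsI.1) (sub_pos.2 hsI.2)) hδ))
    filter_upwards [hnear, self_mem_nhdsWithin] with r hr hr0
    simp only [lt_min_iff] at hr
    have h2 : Ioo (s - r) (s + r) ⊆ Ioo (s₀ - δ) (s₀ + δ) :=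
      Ioo_subset_Ioo (by linarith) (by linarith)
    exact ⟨hr0, h2, (halfDisc_subset_box hr0).trans (prod_mono h2 (Ioo_subset_Ioo_right hr.2.le))⟩
  have hball : ∀ {s r : ℝ} (σ : ℝ), σ ^ 2 = 1 → 0 < r →
      chart (sideBase n i) (sideDir n i) σ '' halfDisc s r ⊆ Metric.ball (sideParam n i s) r := by
    intro s r σ hσ hr
    rw [sideParam_eq_chart n i σ]
    exact chart_halfDisc_subset_ball he hσ s hr
  rcases hout with hout | hout
  -- If both windows lie in the domain, the averages run over two half discs of equal area, and the
  -- trace is the mean of the one-sided traces. The weight does not depend on `u`, which keeps the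
  -- formula linear.
  · refine ⟨δ, hδ, 1 / 2, hI, hin, fun _ => hout, fun u G hu hw => ?_⟩
    filter_upwards [tendsto_average_chart h1 hδ hin hu hw,
      tendsto_average_chart (one_pow 2) hδ hout hu hw] with s hs₁ hs₂ hsI
    refine (((hs₁ hsI).const_mul (1 - 1 / 2)).add ((hs₂ hsI).const_mul (1 / 2))).congr' ?_
    filter_upwards [hnear s hsI] with r hr
    have e1 : Metric.ball (sideParam n i s) r ∩ domain n
        = chart (sideBase n i) (sideDir n i) (-1) '' halfDisc s r
        ∪ chart (sideBase n i) (sideDir n i) 1 '' halfDisc s r := by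
      refine (ball_inter_domain_subset (hr.2.1.trans hI)).antisymm (union_subset ?_ ?_)
      · exact subset_inter (hball _ h1 hr.1) ((image_mono hr.2.2).trans hin)
      · exact subset_inter (hball _ (one_pow 2) hr.1) ((image_mono hr.2.2).trans hout)
    have hi : ∀ {S : Set ℂ}, S ⊆ domain n → IntegrableOn u S := fun hS =>
      IntegrableOn.mono_set (hu.integrable one_le_two : IntegrableOn u (domain n) volume) hS
    have hS₁ : MeasurableSet (chart (sideBase n i) (sideDir n i) 1 '' halfDisc s r) :=
      (measurableEmbedding_chart he (one_pow 2)).measurableSet_image.2 (measurableSet_halfDisc s r)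
    have hfin : ∀ σ : ℝ, σ ^ 2 = 1 →
        volume (chart (sideBase n i) (sideDir n i) σ '' halfDisc s r) ≠ ⊤ := fun σ hσ =>
      ne_top_of_le_ne_top measure_ball_lt_top.ne (measure_mono (hball σ hσ hr.1))
    have hd := disjoint_image_chart (p := sideBase n i) he s r
    have hv := le_volume_halfDisc s hr.1
    have hv0 : 0 < volume.real (halfDisc s r) :=
      lt_of_lt_of_le (div_pos (pow_pos hr.1 2) two_pos) hv
    rw [e1, setAverage_eq, setAverage_eq, setAverage_eq, measureReal_union hd hS₁ (hfin _ h1)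
      (hfin _ (one_pow 2)), setIntegral_union hd hS₁ (hi ((image_mono hr.2.2).trans hin))
      (hi ((image_mono hr.2.2).trans hout)), volume_real_image_chart he h1,
      volume_real_image_chart he (one_pow 2)]
    simp only [smul_eq_mul]
    field_simp
    ring
  · refine ⟨δ, hδ, 0, hI, hin, fun h => (h rfl).elim, fun u G hu hw => ?_⟩
    filter_upwards [tendsto_average_chart h1 hδ hin hu hw] with s hs₁ hsI
    rw [sub_zero, one_mul, zero_mul, add_zero]
    refine (hs₁ hsI).congr' ?_
    filter_upwards [hnear s hsI] with r hr
    have e1 : Metric.ball (sideParam n i s) r ∩ domain n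
        = chart (sideBase n i) (sideDir n i) (-1) '' halfDisc s r := by
      refine Subset.antisymm (fun z hz => ?_)
        (subset_inter (hball _ h1 hr.1) ((image_mono hr.2.2).trans hin))
      rcases ball_inter_domain_subset (hr.2.1.trans hI) hz with h | h
      · exact h
      · exact (disjoint_left.1 hout (image_mono hr.2.2 h) hz.2).elim
    rw [e1]

lemma tendsto_eLpNorm_comp_chart {F : Type*} [NormedAddCommGroup F] (he : ‖e‖ = 1) (hσ : σ ^ 2 = 1)
    {D : Set ℂ} {R : Set (ℝ × ℝ)} (hR : chart p e σ '' R ⊆ D) {v : ℕ → ℂ → F} {v' : ℂ → F}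
    (hv : ∀ k, MemLp (v k) 2 (volume.restrict D)) (hv' : MemLp v' 2 (volume.restrict D))
    (hl : Tendsto (fun k => eLpNorm (v k - v') 2 (volume.restrict D)) atTop (𝓝 0)) :
    Tendsto (fun k => eLpNorm ((fun x => v k (chart p e σ x)) - fun x => v' (chart p e σ x)) 2
      (volume.restrict R)) atTop (𝓝 0) := by
  have h : ∀ k, eLpNorm (fun q => (v k - v') (chart p e σ q)) 2 (volume.restrict R)
      ≤ eLpNorm (v k - v') 2 (volume.restrict D) := fun k =>
    eLpNorm_comp_chart_le he hσ hR ((hv k).sub hv').1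
  have h2 : Tendsto (fun k => eLpNorm (fun q => (v k - v') (chart p e σ q)) 2 (volume.restrict R))
      atTop (𝓝 0) :=
    tendsto_of_tendsto_of_tendsto_of_le_of_le tendsto_const_nhds hl (fun _ => zero_le) h
  exact h2

/-- By Fubini, pairing the one-sided trace with `α` amounts to pairing `u` and its gradient with
fixed `L²` functions on the window. It is therefore continuous for convergence in `H¹`. -/
lemma tendsto_integral_sideTrace {n : ℕ} {i : SideIndex n} (hσ : σ ^ 2 = 1) {s₀ δ : ℝ}
    (hR : chart (sideBase n i) (sideDir n i) σ '' window s₀ δ ⊆ domain n)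
    {u : ℕ → ℂ → ℝ} {G : ℕ → ℂ → ℂ} {u' : ℂ → ℝ} {G' : ℂ → ℂ}
    (hu : ∀ k, MemLp (u k) 2 (volume.restrict (domain n)))
    (hG : ∀ k, MemLp (G k) 2 (volume.restrict (domain n)))
    (hu' : MemLp u' 2 (volume.restrict (domain n)))
    (hG' : MemLp G' 2 (volume.restrict (domain n)))
    (hulim : Tendsto (fun k => eLpNorm (u k - u') 2 (volume.restrict (domain n))) atTop (𝓝 0))
    (hGlim : Tendsto (fun k => eLpNorm (G k - G') 2 (volume.restrict (domain n))) atTop (𝓝 0))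
    {α : ℝ → ℝ} (hα : Continuous α) {C : ℝ} (hC : ∀ s, ‖α s‖ ≤ C) :
    Tendsto (fun k => ∫ s in Ioo (s₀ - δ) (s₀ + δ), α s * sideTrace n i σ δ (u k) (G k) s) atTop
      (𝓝 (∫ s in Ioo (s₀ - δ) (s₀ + δ), α s * sideTrace n i σ δ u' G' s)) := by
  have he := norm_sideDir n i
  set ξ : ℂ := σ * sideDir n i * Complex.I
  set μ : Measure (ℝ × ℝ) := volume.restrict (window s₀ δ) with hμ
  have hfm : IsFiniteMeasure μ := ⟨by
    rw [hμ, Measure.restrict_apply_univ]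
    exact ((Metric.isBounded_Ioo _ _).prod (Metric.isBounded_Ioo _ _)).measure_lt_top⟩
  have hψ₁ : MemLp (fun x : ℝ × ℝ => α x.1) 2 μ :=
    MemLp.of_bound (by fun_prop) C (Eventually.of_forall fun x => hC _)
  have hψ₂ : MemLp (fun x : ℝ × ℝ => ((δ - x.2) * α x.1) • ξ) 2 μ := by
    refine MemLp.of_bound (by fun_prop) (δ * C * ‖ξ‖) ?_
    rw [hμ]
    filter_upwards [ae_restrict_mem (measurableSet_Ioo.prod measurableSet_Ioo)] with x hx
    have h2 : 0 < x.2 ∧ x.2 < δ := hx.2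
    rw [norm_smul, norm_mul, Real.norm_eq_abs (δ - x.2), abs_of_nonneg (by linarith)]
    have := hC x.1
    gcongr
    · linarith
    · linarith
  have hform : ∀ {v : ℂ → ℝ} {F : ℂ → ℂ}, MemLp v 2 (volume.restrict (domain n)) →
      MemLp F 2 (volume.restrict (domain n)) →
      ∫ s in Ioo (s₀ - δ) (s₀ + δ), α s * sideTrace n i σ δ v F s
        = δ⁻¹ * ((∫ x, v (chart (sideBase n i) (sideDir n i) σ x) * α x.1 ∂μ)
          - ∫ x, inner ℝ (((δ - x.2) * α x.1) • ξ) (F (chart (sideBase n i) (sideDir n i) σ x)) ∂μ) := by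
    intro v F hv hF
    have hv' := memLp_comp_chart he hσ hR hv
    have hF' := memLp_comp_chart he hσ hR hF
    have hF'' := hF'.inner_const (𝕜 := ℝ) ξ
    have h1 := integral_mul_slab_moment (hv'.integrable one_le_two) (hF''.integrable one_le_two)
      hα hC (le_refl δ)
    have hi : Integrable (fun x => inner ℝ (((δ - x.2) * α x.1) • ξ)
        (F (chart (sideBase n i) (sideDir n i) σ x))) μ :=
      (hψ₂.norm.integrable_mul hF'.norm).mono (hψ₂.1.inner hF'.1)
        (Eventually.of_forall fun x => (norm_inner_le_norm _ _).trans (Real.le_norm_self _))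
    rw [← integral_sub (integrable_mul_of_memLp hv' hψ₁) hi]
    simp only [sideTrace, slabTrace, mul_left_comm _ δ⁻¹, integral_const_mul]
    rw [h1]
    congr 1
    refine integral_congr_ae (Eventually.of_forall fun x => ?_)
    simp only [real_inner_smul_left, real_inner_comm]
    ring
  simp_rw [hform (hu _) (hG _), hform hu' hG']
  have t1 := tendsto_integral_mul
    (f := fun k x => u k (chart (sideBase n i) (sideDir n i) σ x))
    (g := fun x => u' (chart (sideBase n i) (sideDir n i) σ x))
    (fun k => memLp_comp_chart he hσ hR (hu k)) (memLp_comp_chart he hσ hR hu') hψ₁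
    (tendsto_eLpNorm_comp_chart he hσ hR hu hu' hulim)
  have t2 := tendsto_integral_inner
    (f := fun k x => G k (chart (sideBase n i) (sideDir n i) σ x))
    (g := fun x => G' (chart (sideBase n i) (sideDir n i) σ x))
    (fun k => memLp_comp_chart he hσ hR (hG k)) (memLp_comp_chart he hσ hR hG') hψ₂
    (tendsto_eLpNorm_comp_chart he hσ hR hG hG' hGlim)
  exact (t1.sub t2).const_mul _

end BoundaryTrace

/-! ### Stability of the trace condition under limits -/

section TraceClosed

lemma integrableOn_sideTrace {n : ℕ} {i : SideIndex n} {σ : ℝ} (hσ : σ ^ 2 = 1) {s₀ δ : ℝ}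
    (hR : chart (sideBase n i) (sideDir n i) σ '' window s₀ δ ⊆ domain n) {u : ℂ → ℝ} {G : ℂ → ℂ}
    (hu : MemLp u 2 (volume.restrict (domain n))) (hG : MemLp G 2 (volume.restrict (domain n))) :
    IntegrableOn (sideTrace n i σ δ u G) (Ioo (s₀ - δ) (s₀ + δ)) := by
  have he := norm_sideDir n i
  have hfm : IsFiniteMeasure (volume.restrict (window s₀ δ)) := ⟨by
    rw [Measure.restrict_apply_univ]
    exact ((Metric.isBounded_Ioo _ _).prod (Metric.isBounded_Ioo _ _)).measure_lt_top⟩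
  exact integrableOn_slabTrace ((memLp_comp_chart he hσ hR hu).integrable one_le_two)
    (((memLp_comp_chart he hσ hR hG).inner_const (𝕜 := ℝ) _).integrable one_le_two)

/-- The trace condition is closed under convergence in `H¹(Ω)` and in `L²(K)`. -/
theorem hasTraceAt_of_tendsto {n : ℕ} {u : ℕ → ℂ → ℝ} {G : ℕ → ℂ → ℂ} {u' : ℂ → ℝ} {G' : ℂ → ℂ}
    (hu : ∀ k, MemLp (u k) 2 (volume.restrict (domain n)))
    (hw : ∀ k, IsWeakGrad (domain n) (u k) (G k))
    (hu' : MemLp u' 2 (volume.restrict (domain n))) (hw' : IsWeakGrad (domain n) u' G')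
    (hulim : Tendsto (fun k => eLpNorm (u k - u') 2 (volume.restrict (domain n))) atTop (𝓝 0))
    (hGlim : Tendsto (fun k => eLpNorm (G k - G') 2 (volume.restrict (domain n))) atTop (𝓝 0))
    (ha : ∀ k, MemLp (u k) 2 (arcMeasure n)) (ha' : MemLp u' 2 (arcMeasure n))
    (halim : Tendsto (fun k => eLpNorm (u k - u') 2 (arcMeasure n)) atTop (𝓝 0))
    (htr : ∀ k, ∀ᵐ x ∂arcMeasure n, HasTraceAt (domain n) (u k) x (u k x)) :
    ∀ᵐ x ∂arcMeasure n, HasTraceAt (domain n) u' x (u' x) := by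
  refine ae_arcMeasure_iff.2 fun i => (ae_restrict_iff' measurableSet_Ioo).2 ?_
  set P : ℝ → Prop := fun s => HasTraceAt (domain n) u' (sideParam n i s) (u' (sideParam n i s))
    with hP
  -- The trace formula is local, with window and weight depending on the point, so the exceptional
  -- set is shown to be locally null.
  have hnull : volume {s | s ∈ Ioo 0 (sideLength n) ∧ IsGoodPoint n i s ∧ ¬ P s} = 0 := by
    refine measure_null_of_locally_null _ fun s₀ hs₀ => ?_
    obtain ⟨δ, hδ, c, hI, hin, hout, htrace⟩ := hs₀.2.1.exists_hasTraceAt hs₀.1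
    set J := Ioo (s₀ - δ) (s₀ + δ) with hJ
    refine ⟨J ∩ {s | ¬ P s}, ?_, ?_⟩
    · rw [inter_comm]
      refine inter_mem (mem_of_superset self_mem_nhdsWithin fun s hs => hs.2.2)
        (mem_nhdsWithin_of_mem_nhds (Ioo_mem_nhds (by linarith) (by linarith)))
    have h1 : (-1 : ℝ) ^ 2 = 1 := by norm_num
    have hside : ∀ {v : ℂ → ℝ}, MemLp v 2 (arcMeasure n) →
        MemLp (v ∘ sideParam n i) 2 (volume.restrict J) := fun hv =>
      (memLp_comp_sideParam hv i).mono_measure (Measure.restrict_mono_set _ hI)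
    set θ : (ℂ → ℝ) → (ℂ → ℂ) → ℝ → ℝ := fun v F s =>
      (1 - c) * sideTrace n i (-1) δ v F s + c * sideTrace n i 1 δ v F s with hθ
    have hθk : ∀ k, ∀ᵐ s, s ∈ J → u k (sideParam n i s) = θ (u k) (G k) s := by
      intro k
      have h2 := (ae_restrict_iff' measurableSet_Ioo).1 (ae_arcMeasure_iff.1 (htr k) i)
      filter_upwards [htrace _ _ (hu k) (hw k), h2] with s hs hs' hsJ
      exact tendsto_nhds_unique (hs' (hI hsJ)) (hs hsJ)
    have hint : ∀ {v : ℂ → ℝ} {F : ℂ → ℂ}, MemLp v 2 (volume.restrict (domain n)) →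
        MemLp F 2 (volume.restrict (domain n)) →
        IntegrableOn (fun s => (1 - c) * sideTrace n i (-1) δ v F s) J ∧
          IntegrableOn (fun s => c * sideTrace n i 1 δ v F s) J := by
      intro v F hv hF
      refine ⟨(integrableOn_sideTrace h1 hin hv hF).const_mul _, ?_⟩
      -- For `c = 0` the outer window may lie off the domain, where nothing is known about the
      -- integrand; the factor removes it.
      by_cases hc : c = 0
      · simp only [hc, zero_mul]; exact integrableOn_const (by simp [hJ])
      · exact (integrableOn_sideTrace (one_pow 2) (hout hc) hv hF).const_mul _
    have hus : IntegrableOn (u' ∘ sideParam n i) J := (hside ha').integrable one_le_two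
    -- Boundary values converge in `L²` of the side, and the local trace expressions converge weakly
    -- when tested against `α`. They agree for each `k`, so the two limits agree almost everywhere.
    have hkey : ∀ᵐ s, s ∈ J → θ u' G' s - u' (sideParam n i s) = 0 := by
      refine isOpen_Ioo.ae_eq_zero_of_integral_contDiff_smul_eq_zero
        (((hint hu' hw'.1).1.add (hint hu' hw'.1).2).sub hus).locallyIntegrableOn
        fun α hα hαc hαs => ?_
      obtain ⟨C, hC⟩ := hαc.exists_bound_of_continuous hα.continuous
      have hαm : ∀ {F : ℝ → ℝ}, IntegrableOn F J → IntegrableOn (fun s => α s * F s) J :=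
        fun hF => hF.bdd_mul (c := C) hα.continuous.aestronglyMeasurable (Eventually.of_forall hC)
      have hform : ∀ {v : ℂ → ℝ} {F : ℂ → ℂ}, MemLp v 2 (volume.restrict (domain n)) →
          MemLp F 2 (volume.restrict (domain n)) → ∫ s in J, α s * θ v F s
          = (1 - c) * (∫ s in J, α s * sideTrace n i (-1) δ v F s)
            + c * ∫ s in J, α s * sideTrace n i 1 δ v F s := by
        intro v F hv hF
        simp only [hθ, mul_add]
        rw [integral_add (hαm (hint hv hF).1) (hαm (hint hv hF).2), ← integral_const_mul,
          ← integral_const_mul]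
        simp only [mul_left_comm]
      have t1 : Tendsto (fun k => ∫ s in J, α s * θ (u k) (G k) s) atTop
          (𝓝 (∫ s in J, α s * θ u' G' s)) := by
        simp_rw [hform (hu _) (hw _).1, hform hu' hw'.1]
        refine ((tendsto_integral_sideTrace h1 hin hu (fun k => (hw k).1) hu' hw'.1 hulim hGlim
          hα.continuous hC).const_mul _).add ?_
        by_cases hc : c = 0
        · simp only [hc, zero_mul]; exact tendsto_const_nhds
        · exact (tendsto_integral_sideTrace (one_pow 2) (hout hc) hu (fun k => (hw k).1) hu' hw'.1
            hulim hGlim hα.continuous hC).const_mul _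
      have hslim : Tendsto (fun k => eLpNorm ((u k ∘ sideParam n i) - u' ∘ sideParam n i) 2
          (volume.restrict J)) atTop (𝓝 0) := by
        refine tendsto_of_tendsto_of_tendsto_of_le_of_le tendsto_const_nhds halim
          (fun _ => zero_le) fun k => ?_
        exact (eLpNorm_mono_measure _ (Measure.restrict_mono_set _ hI)).trans
          (eLpNorm_comp_sideParam_le (u k - u') i)
      have t2 := tendsto_integral_mul (fun k => hside (ha k)) (hside ha')
        (memLp_testFunction hα.continuous hαc J) hslim
      have heq : ∀ k, ∫ s in J, (u k ∘ sideParam n i) s * α s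
          = ∫ s in J, α s * θ (u k) (G k) s := fun k => by
        refine setIntegral_congr_ae measurableSet_Ioo ?_
        filter_upwards [hθk k] with s hs hsJ
        rw [← hs hsJ, Function.comp_apply, mul_comm]
      simp_rw [heq] at t2
      have h3 := tendsto_nhds_unique t1 t2
      rw [← setIntegral_eq_integral_of_forall_compl_eq_zero (s := J) fun s hs => by
        rw [image_eq_zero_of_notMem_tsupport fun h => hs (hαs h), zero_smul]]
      have hi1 : IntegrableOn (fun s => α s * θ u' G' s) J :=
        hαm ((hint hu' hw'.1).1.add (hint hu' hw'.1).2)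
      have hi2 : IntegrableOn (fun s => α s * (u' ∘ sideParam n i) s) J := hαm hus
      calc _ = ∫ s in J, (α s * θ u' G' s - α s * (u' ∘ sideParam n i) s) := by
            refine setIntegral_congr_fun measurableSet_Ioo fun s _ => ?_
            exact mul_sub _ _ _
        _ = 0 := by
            rw [integral_sub hi1 hi2, h3, sub_eq_zero]
            simp only [mul_comm]
    refine measure_mono_null (fun s hs => ?_) (measure_eq_zero_iff_ae_notMem.2
      ((htrace _ _ hu' hw').and hkey |>.mono fun s hs => ?_ : ∀ᵐ s, s ∉ J ∩ {s | ¬ P s}))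
    · exact hs
    · rintro ⟨hsJ, hsP⟩
      refine hsP ?_
      have h := hs.1 hsJ
      change HasTraceAt (domain n) u' (sideParam n i s) (θ u' G' s) at h
      rwa [sub_eq_zero.1 (hs.2 hsJ)] at h
  filter_upwards [measure_eq_zero_iff_ae_notMem.1 hnull, ae_isGoodPoint n i] with s hs hg hsI
  by_contra hne
  exact hs ⟨hsI, hg, hne⟩

end TraceClosed

/-! ### Square-integrable difference quotients on one line -/

section FractionalOneDim

/-- The weight `|x|^{-1/2}`. -/
noncomputable def halfWeight (x : ℝ) : ℝ≥0∞ := ENNReal.ofReal (Real.sqrt |x|)⁻¹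

lemma measurable_halfWeight : Measurable halfWeight := by
  unfold halfWeight; fun_prop

lemma halfWeight_neg (x : ℝ) : halfWeight (-x) = halfWeight x := by
  rw [halfWeight, abs_neg, halfWeight]

/-- The weight is at most `1` off the unit interval and integrable near `0`; translation invariance
makes the bound independent of the centre. -/
lemma exists_lintegral_halfWeight_le (ℓ : ℝ) : ∃ C : ℝ≥0∞, C ≠ ⊤ ∧
    ∀ c, ∫⁻ s in Ioo 0 ℓ, halfWeight (s - c) ≤ C := by
  set v : ℝ → ℝ≥0∞ := (Ioo 0 1).indicator fun x => ENNReal.ofReal (x ^ (-(1 / 2) : ℝ)) with hv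
  have hvm : Measurable v := by
    refine Measurable.indicator ?_ measurableSet_Ioo
    fun_prop
  have hvi : ∫⁻ x, v x ≠ ⊤ := by
    rw [hv, lintegral_indicator measurableSet_Ioo]
    have h1 : IntegrableOn (fun x : ℝ => x ^ (-(1 / 2) : ℝ)) (Ioo 0 1) := by
      rw [← intervalIntegrable_iff_integrableOn_Ioo_of_le zero_le_one]
      exact intervalIntegral.intervalIntegrable_rpow' (by norm_num)
    exact h1.lintegral_lt_top.ne
  have hpos : ∀ x, 0 < x → x < 1 → halfWeight x = v x := fun x h0 h1 => by
    rw [hv, indicator_of_mem (show x ∈ Ioo (0 : ℝ) 1 from ⟨h0, h1⟩), halfWeight, abs_of_pos h0,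
      Real.sqrt_eq_rpow, ← Real.rpow_neg h0.le]
  have hle : ∀ x, halfWeight x ≤ 1 + (v x + v (-x)) := by
    intro x
    rcases le_or_gt 1 |x| with h | h
    · refine le_add_right ?_
      rw [halfWeight, ← ENNReal.ofReal_one]
      exact ENNReal.ofReal_le_ofReal (inv_le_one_of_one_le₀ (by rwa [Real.one_le_sqrt]))
    · rw [abs_lt] at h
      refine le_add_left ?_
      rcases lt_trichotomy x 0 with hx | hx | hx
      · rw [← halfWeight_neg, hpos (-x) (by linarith) (by linarith)]
        exact le_add_left le_rfl
      · simp [hx, halfWeight]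
      · rw [hpos x hx h.2]
        exact le_add_right le_rfl
  refine ⟨ENNReal.ofReal ℓ + ((∫⁻ x, v x) + ∫⁻ x, v x), ?_, fun c => ?_⟩
  · exact ENNReal.add_ne_top.2 ⟨ENNReal.ofReal_ne_top, ENNReal.add_ne_top.2 ⟨hvi, hvi⟩⟩
  calc ∫⁻ s in Ioo 0 ℓ, halfWeight (s - c)
      ≤ ∫⁻ s in Ioo 0 ℓ, (1 + (v (s - c) + v (-(s - c)))) := lintegral_mono fun s => hle _
    _ = (∫⁻ s in Ioo 0 ℓ, 1) + ((∫⁻ s in Ioo 0 ℓ, v (s - c)) + ∫⁻ s in Ioo 0 ℓ, v (-(s - c))) := by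
        rw [lintegral_add_left measurable_const, lintegral_add_left (by fun_prop)]
    _ ≤ _ := by
        refine add_le_add (by simp) (add_le_add ?_ ?_)
        · refine (setLIntegral_le_lintegral _ _).trans (le_of_eq ?_)
          exact lintegral_sub_right_eq_self v c
        · refine (setLIntegral_le_lintegral _ _).trans (le_of_eq ?_)
          simp only [neg_sub]
          exact lintegral_sub_left_eq_self v c

lemma sq_integral_le {h : ℝ → ℝ} {a b : ℝ} (hab : a ≤ b) (h1 : IntegrableOn h (Ioo a b))
    (h2 : IntegrableOn (fun x => h x ^ 2) (Ioo a b)) :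
    (∫ r in a..b, h r) ^ 2 ≤ (b - a) * ∫ r in Ioo a b, h r ^ 2 := by
  rcases hab.eq_or_lt with rfl | hab
  · simp
  rw [intervalIntegral.integral_of_le hab.le, integral_Ioc_eq_integral_Ioo]
  have hL : 0 < b - a := sub_pos.2 hab
  set m := (∫ r in Ioo a b, h r) / (b - a) with hm
  have hmul : ∫ r in Ioo a b, h r = m * (b - a) := by rw [hm]; field_simp
  have hpos : 0 ≤ ∫ r in Ioo a b, (h r - m) ^ 2 := integral_nonneg fun _ => sq_nonneg _
  have hc : IntegrableOn (fun _ : ℝ => m ^ 2) (Ioo a b) := integrableOn_const (by simp)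
  have e : ∫ r in Ioo a b, (h r - m) ^ 2
      = (∫ r in Ioo a b, h r ^ 2) - 2 * m * (∫ r in Ioo a b, h r) + m ^ 2 * (b - a) := by
    have e1 : ∀ r, (h r - m) ^ 2 = h r ^ 2 - 2 * m * h r + m ^ 2 := fun r => by ring
    simp_rw [e1]
    have h3 : IntegrableOn (fun r => h r ^ 2 - 2 * m * h r) (Ioo a b) := h2.sub (h1.const_mul _)
    rw [integral_add h3 hc, integral_sub h2 (h1.const_mul _),
      integral_const_mul, setIntegral_const, measureReal_def, Real.volume_Ioo,
      ENNReal.toReal_ofReal hL.le, smul_eq_mul, mul_comm (b - a)]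
  rw [e, hmul] at hpos
  rw [hmul]
  nlinarith

/-- The arithmetic–geometric inequality factors the critical kernel `1/(|x| + |y|)` into one
integrable weight per variable. -/
lemma inv_add_le_mul_halfWeight {x y : ℝ} (hx : x ≠ 0) (hy : y ≠ 0) {c : ℝ} (hc : 0 ≤ c) :
    ENNReal.ofReal (c / (|x| + |y|)) ≤ ENNReal.ofReal c * (halfWeight x * halfWeight y) := by
  rw [halfWeight, halfWeight, ← ENNReal.ofReal_mul (by positivity), ← ENNReal.ofReal_mul hc,
    ← mul_inv, ← div_eq_mul_inv]
  refine ENNReal.ofReal_le_ofReal ?_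
  have h1 : 0 < Real.sqrt |x| := Real.sqrt_pos.2 (abs_pos.2 hx)
  have h2 : 0 < Real.sqrt |y| := Real.sqrt_pos.2 (abs_pos.2 hy)
  refine div_le_div_of_nonneg_left hc (mul_pos h1 h2) ?_
  have h3 := Real.sq_sqrt (abs_nonneg x)
  have h4 := Real.sq_sqrt (abs_nonneg y)
  nlinarith [sq_nonneg (Real.sqrt |x| - Real.sqrt |y|), mul_pos h1 h2]

/-- The kernel dominating the difference quotients of a function with derivative `h`. -/
noncomputable def quotientKernel (ℓ : ℝ) (h : ℝ → ℝ) (s t : ℝ) : ℝ≥0∞ :=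
  ∫⁻ r in Ioo 0 ℓ, ENNReal.ofReal (h r ^ 2) * (halfWeight (s - r) * halfWeight (t - r))

variable {ℓ : ℝ} {G h : ℝ → ℝ}

lemma sq_sub_le (hh : MemLp h 2 (volume.restrict (Ioo 0 ℓ)))
    (hG : ∀ s ∈ Icc 0 ℓ, ∀ t ∈ Icc 0 ℓ, G t - G s = ∫ r in s..t, h r) {s t : ℝ} (hs : s ∈ Icc 0 ℓ)
    (ht : t ∈ Icc 0 ℓ) (hst : s ≤ t) : (G t - G s) ^ 2 ≤ (t - s) * ∫ r in Ioo s t, h r ^ 2 := by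
  rw [hG s hs t ht]
  have hfin : IsFiniteMeasure (volume.restrict (Ioo 0 ℓ)) := ⟨by simp⟩
  have hsub : Ioo s t ⊆ Ioo 0 ℓ := Ioo_subset_Ioo hs.1 ht.2
  have h1 : IntegrableOn h (Ioo 0 ℓ) := hh.integrable one_le_two
  have h2 : IntegrableOn (fun x => h x ^ 2) (Ioo 0 ℓ) := hh.integrable_sq
  exact sq_integral_le hst (h1.mono_set hsub) (h2.mono_set hsub)

lemma sq_sub_le_mul_abs (hh : MemLp h 2 (volume.restrict (Ioo 0 ℓ)))
    (hG : ∀ s ∈ Icc 0 ℓ, ∀ t ∈ Icc 0 ℓ, G t - G s = ∫ r in s..t, h r) {s t : ℝ} (hs : s ∈ Icc 0 ℓ)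
    (ht : t ∈ Icc 0 ℓ) : (G t - G s) ^ 2 ≤ (∫ r in Ioo 0 ℓ, h r ^ 2) * |t - s| := by
  wlog hst : s ≤ t generalizing s t
  · rw [abs_sub_comm, ← neg_sub (G s), neg_sq]
    exact this ht hs (not_le.1 hst).le
  have h2 : IntegrableOn (fun x => h x ^ 2) (Ioo 0 ℓ) := hh.integrable_sq
  rw [abs_of_nonneg (sub_nonneg.2 hst), mul_comm]
  refine (sq_sub_le hh hG hs ht hst).trans ?_
  refine mul_le_mul_of_nonneg_left ?_ (sub_nonneg.2 hst)
  exact setIntegral_mono_set h2 (Eventually.of_forall fun _ => sq_nonneg _)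
    (LE.le.eventuallyLE (Ioo_subset_Ioo hs.1 ht.2))

lemma quotientKernel_comm (s t : ℝ) : quotientKernel ℓ h s t = quotientKernel ℓ h t s := by
  simp only [quotientKernel, mul_comm (halfWeight (s - _))]

/-- Cauchy–Schwarz bounds the squared quotient by the mean of `h²` between `s` and `t`. For `r`
between them, `t - s = |s - r| + |t - r|`, so `inv_add_le_mul_halfWeight` separates the variables.
-/
lemma sq_quotient_le_kernel (hh : MemLp h 2 (volume.restrict (Ioo 0 ℓ)))
    (hG : ∀ s ∈ Icc 0 ℓ, ∀ t ∈ Icc 0 ℓ, G t - G s = ∫ r in s..t, h r) {s t : ℝ} (hs : s ∈ Icc 0 ℓ)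
    (ht : t ∈ Icc 0 ℓ) :
    ENNReal.ofReal (((G s - G t) / |s - t|) ^ 2) ≤ quotientKernel ℓ h s t := by
  wlog hst : s ≤ t generalizing s t
  · rw [quotientKernel_comm, abs_sub_comm, ← neg_sub (G t), neg_div, neg_sq]
    exact this ht hs (not_le.1 hst).le
  rcases hst.eq_or_lt with rfl | hst
  · simp
  have hL : 0 < t - s := sub_pos.2 hst
  have hsub : Ioo s t ⊆ Ioo 0 ℓ := Ioo_subset_Ioo hs.1 ht.2
  have h2 : IntegrableOn (fun x => h x ^ 2) (Ioo s t) :=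
    IntegrableOn.mono_set (show IntegrableOn (fun x => h x ^ 2) (Ioo 0 ℓ) volume from
      hh.integrable_sq) hsub
  have h3 : ((G s - G t) / |s - t|) ^ 2 ≤ ∫ r in Ioo s t, h r ^ 2 / (t - s) := by
    rw [abs_sub_comm, abs_of_pos hL, ← neg_sub (G t), neg_div, neg_sq, div_pow, integral_div,
      div_le_div_iff₀ (by positivity) hL]
    nlinarith [sq_sub_le hh hG hs ht hst.le]
  calc ENNReal.ofReal (((G s - G t) / |s - t|) ^ 2)
      ≤ ENNReal.ofReal (∫ r in Ioo s t, h r ^ 2 / (t - s)) := ENNReal.ofReal_le_ofReal h3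
    _ = ∫⁻ r in Ioo s t, ENNReal.ofReal (h r ^ 2 / (t - s)) :=
        ofReal_integral_eq_lintegral_ofReal (h2.div_const _)
          (Eventually.of_forall fun r => div_nonneg (sq_nonneg _) hL.le)
    _ ≤ ∫⁻ r in Ioo s t,
          ENNReal.ofReal (h r ^ 2) * (halfWeight (s - r) * halfWeight (t - r)) := by
        refine setLIntegral_mono' measurableSet_Ioo fun r hr => ?_
        have hr1 : s - r < 0 := by linarith [hr.1]
        have hr2 : 0 < t - r := by linarith [hr.2]
        have := inv_add_le_mul_halfWeight hr1.ne hr2.ne' (sq_nonneg (h r))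
        rwa [abs_of_neg hr1, abs_of_pos hr2, show -(s - r) + (t - r) = t - s by ring] at this
    _ ≤ _ := lintegral_mono_set hsub

lemma measurable_quotientKernel (hh : AEStronglyMeasurable h (volume.restrict (Ioo 0 ℓ))) :
    Measurable (Function.uncurry (quotientKernel ℓ h)) := by
  have e : quotientKernel ℓ h = quotientKernel ℓ (hh.mk h) := by
    funext s t
    refine lintegral_congr_ae ?_
    filter_upwards [hh.ae_eq_mk] with r hr
    rw [hr]
  have hm := hh.stronglyMeasurable_mk.measurable
  have hmw := measurable_halfWeight
  rw [e]
  have h1 : Measurable fun x : (ℝ × ℝ) × ℝ => ENNReal.ofReal (hh.mk h x.2 ^ 2)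
      * (halfWeight (x.1.1 - x.2) * halfWeight (x.1.2 - x.2)) := by fun_prop
  exact h1.lintegral_prod_right'

/-- The kernel is integrable, also along affine reparametrizations. -/
lemma lintegral_quotientKernel_lt_top (hh : MemLp h 2 (volume.restrict (Ioo 0 ℓ))) {ε : ℝ}
    (hε : |ε| = 1) (c : ℝ) :
    ∫⁻ s in Ioo 0 ℓ, ∫⁻ t in Ioo 0 ℓ, quotientKernel ℓ h s (ε * t + c) < ⊤ := by
  obtain ⟨C, hC, hCw⟩ := exists_lintegral_halfWeight_le ℓ
  have hm : AEMeasurable (fun r => ENNReal.ofReal (h r ^ 2)) (volume.restrict (Ioo 0 ℓ)) :=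
    (hh.1.aemeasurable.pow_const 2).ennreal_ofReal
  have hε2 : ε * ε = 1 := by rw [← abs_mul_abs_self, hε, one_mul]
  have hw : ∀ r, ∫⁻ t in Ioo 0 ℓ, halfWeight (ε * t + c - r) ≤ C := by
    intro r
    refine le_trans (le_of_eq ?_) (hCw (ε * (r - c)))
    refine lintegral_congr fun t => ?_
    rw [halfWeight, halfWeight, ← one_mul |t - ε * (r - c)|, ← hε, ← abs_mul]
    congr 4
    linear_combination (r - c) * hε2
  have hmw := measurable_halfWeight
  -- Tonelli: integrating the weights first, in `t` and then in `s`, costs the constant `C` each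
  -- time and leaves the integral of `h²`.
  have hinner : ∀ s, ∫⁻ t in Ioo 0 ℓ, quotientKernel ℓ h s (ε * t + c)
      ≤ C * ∫⁻ r in Ioo 0 ℓ, ENNReal.ofReal (h r ^ 2) * halfWeight (s - r) := by
    intro s
    simp only [quotientKernel]
    rw [lintegral_lintegral_swap, mul_comm C, ← lintegral_mul_const' _ _ hC]
    · refine lintegral_mono fun r => ?_
      simp only [← mul_assoc]
      rw [lintegral_const_mul _ (by fun_prop)]
      gcongr
      exact hw r
    · refine AEMeasurable.mul (hm.comp_quasiMeasurePreserving Measure.quasiMeasurePreserving_snd) ?_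
      exact Measurable.aemeasurable (by fun_prop)
  calc ∫⁻ s in Ioo 0 ℓ, ∫⁻ t in Ioo 0 ℓ, quotientKernel ℓ h s (ε * t + c)
      ≤ ∫⁻ s in Ioo 0 ℓ, C * ∫⁻ r in Ioo 0 ℓ, ENNReal.ofReal (h r ^ 2) * halfWeight (s - r) :=
        lintegral_mono fun s => hinner s
    _ = C * ∫⁻ r in Ioo 0 ℓ, ∫⁻ s in Ioo 0 ℓ, ENNReal.ofReal (h r ^ 2) * halfWeight (s - r) := by
        rw [lintegral_const_mul' _ _ hC, lintegral_lintegral_swap]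
        refine AEMeasurable.mul (hm.comp_quasiMeasurePreserving Measure.quasiMeasurePreserving_snd) ?_
        exact Measurable.aemeasurable (by fun_prop)
    _ ≤ C * ∫⁻ r in Ioo 0 ℓ, ENNReal.ofReal (h r ^ 2) * C := by
        gcongr with r
        rw [lintegral_const_mul _ (by fun_prop)]
        gcongr
        exact hCw r
    _ < ⊤ := by
        rw [lintegral_mul_const' _ _ hC]
        have h2 : Integrable (fun x => h x ^ 2) (volume.restrict (Ioo 0 ℓ)) := hh.integrable_sq
        exact ENNReal.mul_lt_top hC.lt_top (ENNReal.mul_lt_top h2.lintegral_lt_top hC.lt_top)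

end FractionalOneDim

/-! ### Difference quotients between two sides of the curve -/

section FractionalBoundary

/-- The squared difference quotient of `g` between points of two sides. -/
noncomputable def sqQuotient (n : ℕ) (g : ℂ → ℝ) (i j : SideIndex n) (s t : ℝ) : ℝ≥0∞ :=
  ENNReal.ofReal (((g (sideParam n i s) - g (sideParam n j t))
    / ‖sideParam n i s - sideParam n j t‖) ^ 2)

variable {n : ℕ} {g : ℂ → ℝ} {h : SideIndex n → ℝ → ℝ}

lemma sub_eq_integral_side (hgc : ContinuousOn g (snowflake n))
    (hw : ∀ i, IsWeakDeriv (sideLength n) (g ∘ sideParam n i) (h i)) (i : SideIndex n) :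
    ∀ s ∈ Icc 0 (sideLength n), ∀ t ∈ Icc 0 (sideLength n),
      (g ∘ sideParam n i) t - (g ∘ sideParam n i) s = ∫ r in s..t, h i r := fun _ hs _ ht =>
  (hw i).sub_eq_integral (sideLength_pos n) (continuousOn_comp_sideParam hgc i) hs ht

/-- Both values are compared with the value at the common point. Functions in `H¹` of an interval
are Hölder of order `1/2`, so the squared difference is linear in `|s - s₀| + |t - t₀|`, against a
quadratic denominator. -/
lemma sqQuotient_le_of_corner (hgc : ContinuousOn g (snowflake n))
    (hw : ∀ i, IsWeakDeriv (sideLength n) (g ∘ sideParam n i) (h i)) {i j : SideIndex n}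
    {s t s₀ t₀ : ℝ} (hs : s ∈ Icc 0 (sideLength n)) (ht : t ∈ Icc 0 (sideLength n))
    (hs₀ : s₀ ∈ Icc 0 (sideLength n)) (ht₀ : t₀ ∈ Icc 0 (sideLength n))
    (h0 : sideParam n i s₀ = sideParam n j t₀) (hss : s ≠ s₀) (htt : t ≠ t₀) {c : ℝ} (hc : 0 < c)
    (hle : c * (|s - s₀| + |t - t₀|) ≤ ‖sideParam n i s - sideParam n j t‖) :
    sqQuotient n g i j s t ≤ ENNReal.ofReal (2 * ((∫ r in Ioo 0 (sideLength n), h i r ^ 2)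
        + ∫ r in Ioo 0 (sideLength n), h j r ^ 2) / c ^ 2)
      * (halfWeight (s - s₀) * halfWeight (t - t₀)) := by
  have h1 := sq_sub_le_mul_abs (hw i).1 (sub_eq_integral_side hgc hw i) hs₀ hs
  have h2 := sq_sub_le_mul_abs (hw j).1 (sub_eq_integral_side hgc hw j) ht₀ ht
  simp only [Function.comp_apply] at h1 h2
  rw [← h0] at h2
  set M₁ := ∫ r in Ioo 0 (sideLength n), h i r ^ 2
  set M₂ := ∫ r in Ioo 0 (sideLength n), h j r ^ 2
  have hM₁ : 0 ≤ M₁ := integral_nonneg fun _ => sq_nonneg _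
  have hM₂ : 0 ≤ M₂ := integral_nonneg fun _ => sq_nonneg _
  have ha : 0 < |s - s₀| := abs_pos.2 (sub_ne_zero.2 hss)
  have hb : 0 < |t - t₀| := abs_pos.2 (sub_ne_zero.2 htt)
  refine le_trans ?_ (inv_add_le_mul_halfWeight (sub_ne_zero.2 hss) (sub_ne_zero.2 htt)
    (by positivity))
  refine ENNReal.ofReal_le_ofReal ?_
  set A := g (sideParam n i s)
  set B := g (sideParam n j t)
  set Q := g (sideParam n i s₀)
  set N := ‖sideParam n i s - sideParam n j t‖
  set S := |s - s₀| + |t - t₀| with hS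
  have hS0 : 0 < S := add_pos ha hb
  have hN : 0 < N := lt_of_lt_of_le (mul_pos hc hS0) hle
  have h3 : (A - B) ^ 2 ≤ 2 * (M₁ + M₂) * S := by
    have : (A - B) ^ 2 ≤ 2 * (A - Q) ^ 2 + 2 * (B - Q) ^ 2 := by
      nlinarith [sq_nonneg ((A - Q) + (B - Q))]
    nlinarith [mul_nonneg hM₁ hb.le, mul_nonneg hM₂ ha.le]
  have h4 : (c * S) ^ 2 ≤ N ^ 2 := by gcongr
  rw [div_pow, div_div, div_le_div_iff₀ (by positivity) (by positivity)]
  calc (A - B) ^ 2 * (c ^ 2 * S) ≤ 2 * (M₁ + M₂) * S * (c ^ 2 * S) := by gcongr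
    _ = 2 * (M₁ + M₂) * (c * S) ^ 2 := by ring
    _ ≤ _ := by gcongr

lemma lintegral_mul_halfWeight_lt_top (ℓ s₀ t₀ : ℝ) (M : ℝ) :
    ∫⁻ s in Ioo 0 ℓ, ∫⁻ t in Ioo 0 ℓ,
      ENNReal.ofReal M * (halfWeight (s - s₀) * halfWeight (t - t₀)) < ⊤ := by
  obtain ⟨C, hC, hCw⟩ := exists_lintegral_halfWeight_le ℓ
  have hmw := measurable_halfWeight
  have e : ∀ s, ∫⁻ t in Ioo 0 ℓ, ENNReal.ofReal M * (halfWeight (s - s₀) * halfWeight (t - t₀))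
      = ENNReal.ofReal M * halfWeight (s - s₀) * ∫⁻ t in Ioo 0 ℓ, halfWeight (t - t₀) := fun s => by
    simp only [← mul_assoc]
    rw [lintegral_const_mul _ (by fun_prop)]
  simp_rw [e]
  rw [lintegral_mul_const _ (by fun_prop), lintegral_const_mul _ (by fun_prop)]
  exact ENNReal.mul_lt_top (ENNReal.mul_lt_top ENNReal.ofReal_lt_top ((hCw _).trans_lt hC.lt_top))
    ((hCw _).trans_lt hC.lt_top)

/-- Two lines which are not parallel diverge linearly from their intersection. -/
lemma exists_le_norm_sub_of_not_parallel {i j : SideIndex n}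
    (hij : ∀ ε : ℝ, |ε| = 1 → sideDir n j ≠ sideDir n i * ε) :
    ∃ c > 0, ∀ s t s₀ t₀ : ℝ, sideParam n i s₀ = sideParam n j t₀ →
      c * (|s - s₀| + |t - t₀|) ≤ ‖sideParam n i s - sideParam n j t‖ := by
  -- Independence of the directions makes this linear map injective, hence bounded below in finite
  -- dimension.
  set L : ℝ × ℝ →ₗ[ℝ] ℂ :=
    (LinearMap.fst ℝ ℝ ℝ).smulRight (sideDir n i) - (LinearMap.snd ℝ ℝ ℝ).smulRight (sideDir n j)
    with hL
  have hLv : ∀ q, L q = sideDir n i * q.1 - sideDir n j * q.2 := fun q => by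
    simp [hL, mul_comm]
  have hker : LinearMap.ker L = ⊥ := by
    rw [LinearMap.ker_eq_bot']
    intro q hq
    rw [hLv, sub_eq_zero] at hq
    have hn := congrArg norm hq
    rw [norm_mul, norm_mul, norm_sideDir, norm_sideDir, one_mul, one_mul, Complex.norm_real,
      Complex.norm_real, Real.norm_eq_abs, Real.norm_eq_abs] at hn
    by_cases h2 : q.2 = 0
    · rw [h2, abs_zero, abs_eq_zero] at hn
      exact Prod.ext hn h2
    · exfalso
      refine hij (q.1 / q.2) (by rw [abs_div, hn, div_self (abs_ne_zero.2 h2)]) ?_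
      rw [Complex.ofReal_div, mul_div_assoc', hq, mul_div_cancel_right₀ _ (Complex.ofReal_ne_zero.2 h2)]
  obtain ⟨K, hK, hanti⟩ := L.exists_antilipschitzWith hker
  refine ⟨(2 * K)⁻¹, by positivity, fun s t s₀ t₀ h0 => ?_⟩
  have h1 := hanti.le_mul_dist (s - s₀, t - t₀) 0
  rw [map_zero, dist_zero_right, dist_zero_right, hLv] at h1
  have h2 : sideParam n i s - sideParam n j t
      = sideDir n i * ((s - s₀ : ℝ) : ℂ) - sideDir n j * ((t - t₀ : ℝ) : ℂ) := by
    rw [sideParam_eq, sideParam_eq] at h0 ⊢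
    push_cast
    linear_combination h0
  rw [h2, inv_mul_le_iff₀ (by positivity)]
  have h3 : |s - s₀| ≤ ‖((s - s₀, t - t₀) : ℝ × ℝ)‖ := norm_fst_le ((s - s₀, t - t₀) : ℝ × ℝ)
  have h4 : |t - t₀| ≤ ‖((s - s₀, t - t₀) : ℝ × ℝ)‖ := norm_snd_le ((s - s₀, t - t₀) : ℝ × ℝ)
  linarith

lemma ae_restrict_ne (ℓ c : ℝ) : ∀ᵐ s ∂volume.restrict (Ioo 0 ℓ), s ∈ Ioo 0 ℓ ∧ s ≠ c := by
  filter_upwards [ae_restrict_mem measurableSet_Ioo, ae_restrict_of_ae (Measure.ae_ne volume c)] with s h1 h2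
  exact ⟨h1, h2⟩

lemma lintegral_lintegral_add_lt_top {μ : Measure ℝ} [SFinite μ] {f₁ f₂ f₃ : ℝ → ℝ → ℝ≥0∞}
    (m₁ : Measurable (Function.uncurry f₁)) (m₂ : Measurable (Function.uncurry f₂))
    (m₃ : Measurable (Function.uncurry f₃)) (h₁ : ∫⁻ s, ∫⁻ t, f₁ s t ∂μ ∂μ < ⊤)
    (h₂ : ∫⁻ s, ∫⁻ t, f₂ s t ∂μ ∂μ < ⊤) (h₃ : ∫⁻ s, ∫⁻ t, f₃ s t ∂μ ∂μ < ⊤) :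
    ∫⁻ s, ∫⁻ t, (f₁ s t + f₂ s t + f₃ t s) ∂μ ∂μ < ⊤ := by
  have k₁ : Measurable fun s => ∫⁻ t, f₁ s t ∂μ := m₁.lintegral_prod_right'
  have k₂ : Measurable fun s => ∫⁻ t, f₂ s t ∂μ := m₂.lintegral_prod_right'
  have e1 : ∀ s, ∫⁻ t, (f₁ s t + f₂ s t + f₃ t s) ∂μ
      = (∫⁻ t, f₁ s t ∂μ) + (∫⁻ t, f₂ s t ∂μ) + ∫⁻ t, f₃ t s ∂μ := fun s => by
    have a₁ : Measurable fun t => f₁ s t := m₁.of_uncurry_left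
    have a₂ : Measurable fun t => f₂ s t := m₂.of_uncurry_left
    have a₁₂ : Measurable fun t => f₁ s t + f₂ s t := a₁.add a₂
    rw [lintegral_add_left a₁₂, lintegral_add_left a₁]
  have k₁₂ : Measurable fun s => (∫⁻ t, f₁ s t ∂μ) + ∫⁻ t, f₂ s t ∂μ := k₁.add k₂
  simp_rw [e1]
  rw [lintegral_add_left k₁₂, lintegral_add_left k₁, lintegral_lintegral_swap
    (f := fun s t => f₃ t s) (m₃.comp measurable_swap).aemeasurable]
  exact ENNReal.add_lt_top.2 ⟨ENNReal.add_lt_top.2 ⟨h₁, h₂⟩, h₃⟩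

/-- Disjoint sides have positive distance, so the quotient is bounded. Sides meeting at an angle are
handled by the corner estimate. Meeting parallel sides, which include the case `i = j`, lie on one
line and need the kernel estimate as well. -/
lemma lintegral_sqQuotient_lt_top (hgc : ContinuousOn g (snowflake n))
    (hw : ∀ i, IsWeakDeriv (sideLength n) (g ∘ sideParam n i) (h i)) (i j : SideIndex n) :
    ∫⁻ s in Ioo 0 (sideLength n), ∫⁻ t in Ioo 0 (sideLength n), sqQuotient n g i j s t < ⊤ := by
  have hmemi : ∀ (i : SideIndex n) {s : ℝ}, s ∈ Icc 0 (sideLength n) → sideParam n i s ∈ snowflake n :=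
    fun i s hs => mem_iUnion.2 ⟨i, mem_image_of_mem _ hs⟩
  by_cases hint : ∃ s₀ ∈ Icc 0 (sideLength n), ∃ t₀ ∈ Icc 0 (sideLength n),
    sideParam n i s₀ = sideParam n j t₀
  swap
  · obtain ⟨M, hM⟩ := (isCompact_snowflake n).exists_bound_of_continuousOn hgc
    have hM0 : 0 ≤ M := (norm_nonneg _).trans (hM _ (hmemi i ⟨le_rfl, (sideLength_pos n).le⟩))
    have hd : Disjoint (sideParam n i '' Icc 0 (sideLength n)) (sideParam n j '' Icc 0 (sideLength n)) := by
      rw [disjoint_left]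
      rintro _ ⟨s, hs, rfl⟩ ⟨t, ht, h⟩
      exact hint ⟨s, hs, t, ht, h.symm⟩
    obtain ⟨r, hr, hsep⟩ := hd.exists_thickenings (isCompact_side n i) (isCompact_side n j).isClosed
    have hN : ∀ s ∈ Icc 0 (sideLength n), ∀ t ∈ Icc 0 (sideLength n),
        r ≤ ‖sideParam n i s - sideParam n j t‖ := by
      intro s hs t ht
      by_contra! hlt
      refine disjoint_left.1 hsep (Metric.mem_thickening_iff.2 ⟨_, mem_image_of_mem _ hs, ?_⟩)
        (Metric.self_subset_thickening hr _ (mem_image_of_mem _ ht))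
      rwa [dist_comm, dist_eq_norm]
    have hb : ∀ s ∈ Ioo 0 (sideLength n), ∀ t ∈ Ioo 0 (sideLength n),
        sqQuotient n g i j s t ≤ ENNReal.ofReal ((2 * M / r) ^ 2) := by
      intro s hs t ht
      refine ENNReal.ofReal_le_ofReal ?_
      rw [← sq_abs, abs_div, abs_of_nonneg (norm_nonneg _)]
      have h1 := hM _ (hmemi i (Ioo_subset_Icc_self hs))
      have h2 := hM _ (hmemi j (Ioo_subset_Icc_self ht))
      have h3 := hN s (Ioo_subset_Icc_self hs) t (Ioo_subset_Icc_self ht)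
      have h4 : |g (sideParam n i s) - g (sideParam n j t)| ≤ 2 * M := by
        refine (abs_sub _ _).trans ?_
        rw [Real.norm_eq_abs] at h1 h2
        linarith
      gcongr
    calc _ ≤ ∫⁻ s in Ioo 0 (sideLength n), ∫⁻ t in Ioo 0 (sideLength n),
          ENNReal.ofReal ((2 * M / r) ^ 2) :=
          setLIntegral_mono' measurableSet_Ioo fun s hs =>
            setLIntegral_mono' measurableSet_Ioo fun t ht => hb s hs t ht
      _ < ⊤ := by simp [ENNReal.mul_lt_top]
  obtain ⟨s₀, hs₀, t₀, ht₀, h0⟩ := hint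
  set M := 2 * ((∫ r in Ioo 0 (sideLength n), h i r ^ 2)
        + ∫ r in Ioo 0 (sideLength n), h j r ^ 2) with hM
  by_cases hpar : ∃ ε : ℝ, |ε| = 1 ∧ sideDir n j = sideDir n i * ε
  swap
  · push Not at hpar
    obtain ⟨c, hc, hle⟩ := exists_le_norm_sub_of_not_parallel hpar
    refine lt_of_le_of_lt ?_ (lintegral_mul_halfWeight_lt_top (sideLength n) s₀ t₀ (M / c ^ 2))
    refine lintegral_mono_ae ?_
    filter_upwards [ae_restrict_ne (sideLength n) s₀] with s hs
    refine lintegral_mono_ae ?_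
    filter_upwards [ae_restrict_ne (sideLength n) t₀] with t ht
    exact sqQuotient_le_of_corner hgc hw (Ioo_subset_Icc_self hs.1) (Ioo_subset_Icc_self ht.1)
      hs₀ ht₀ h0 hs.2 ht.2 hc (hle s t s₀ t₀ h0)
  obtain ⟨ε, hε, hdir⟩ := hpar
  have hε2 : ε * ε = 1 := by rw [← abs_mul_abs_self, hε, one_mul]
  set c := s₀ - ε * t₀ with hc
  have hj : ∀ t, sideParam n j t = sideParam n i (ε * t + c) := by
    intro t
    rw [sideParam_eq, sideParam_eq] at h0 ⊢
    rw [hdir] at h0 ⊢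
    rw [hc]; push_cast
    linear_combination -h0
  have hi : ∀ s, sideParam n i s = sideParam n j (ε * s + (-(ε * c))) := by
    intro s
    rw [hj]
    congr 1
    linear_combination (c - s) * hε2
  -- Collinear sides may overlap. If one of the two points lies on the other side, a one-line kernel
  -- applies; otherwise the common point lies between them and the distance is exactly `|s - s₀| +
  -- |t - t₀|`.
  have hbound : ∀ s ∈ Ioo 0 (sideLength n), s ≠ s₀ → ∀ t ∈ Ioo 0 (sideLength n), t ≠ t₀ →
      sqQuotient n g i j s t ≤ ENNReal.ofReal (M / 1 ^ 2) * (halfWeight (s - s₀) * halfWeight (t - t₀))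
        + quotientKernel (sideLength n) (h i) s (ε * t + c)
        + quotientKernel (sideLength n) (h j) t (ε * s + (-(ε * c))) := by
    intro s hs hss t ht htt
    have hnorm : ‖sideParam n i s - sideParam n j t‖ = |s - (ε * t + c)| := by
      rw [hj, dist_sideParam]
    by_cases hi1 : ε * t + c ∈ Icc 0 (sideLength n)
    · refine le_add_right (le_add_left ?_)
      rw [sqQuotient, hnorm, hj]
      exact sq_quotient_le_kernel (hw i).1 (sub_eq_integral_side hgc hw i)
        (Ioo_subset_Icc_self hs) hi1
    by_cases hj1 : ε * s + (-(ε * c)) ∈ Icc 0 (sideLength n)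
    · refine le_add_left ?_
      rw [sqQuotient, ← norm_neg, ← neg_sq, ← neg_div, neg_sub, neg_sub, hi, dist_sideParam]
      exact sq_quotient_le_kernel (hw j).1 (sub_eq_integral_side hgc hw j)
        (Ioo_subset_Icc_self ht) hj1
    · refine le_add_right (le_add_right ?_)
      refine sqQuotient_le_of_corner hgc hw (Ioo_subset_Icc_self hs) (Ioo_subset_Icc_self ht)
        hs₀ ht₀ h0 hss htt one_pos ?_
      rw [one_mul, hnorm]
      have hs1 : 0 < s ∧ s < sideLength n := hs
      have ht1 : 0 < t ∧ t < sideLength n := ht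
      have hs2 : 0 ≤ s₀ ∧ s₀ ≤ sideLength n := hs₀
      have ht2 : 0 ≤ t₀ ∧ t₀ ≤ sideLength n := ht₀
      simp only [mem_Icc, not_and_or, not_le] at hi1 hj1
      rcases abs_eq (zero_le_one) |>.1 hε with rfl | rfl
      all_goals
        rcases hi1 with h1 | h1 <;> rcases hj1 with h2 | h2 <;>
          rcases abs_cases (s - s₀) with h3 | h3 <;> rcases abs_cases (t - t₀) with h4 | h4
        all_goals refine le_abs.2 ?_
        all_goals first | (left; linarith) | (right; linarith)
  have hmw := measurable_halfWeight
  have hmi := measurable_quotientKernel (hw i).1.1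
  have hmj := measurable_quotientKernel (hw j).1.1
  have hf₂ := lintegral_quotientKernel_lt_top (hw i).1 hε c
  have hf₃ := lintegral_quotientKernel_lt_top (hw j).1 hε (-(ε * c))
  have hf₁ := lintegral_mul_halfWeight_lt_top (sideLength n) s₀ t₀ (M / 1 ^ 2)
  set f₁ : ℝ → ℝ → ℝ≥0∞ := fun s t =>
    ENNReal.ofReal (M / 1 ^ 2) * (halfWeight (s - s₀) * halfWeight (t - t₀)) with hf₁d
  set f₂ : ℝ → ℝ → ℝ≥0∞ := fun s t => quotientKernel (sideLength n) (h i) s (ε * t + c) with hf₂d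
  set f₃ : ℝ → ℝ → ℝ≥0∞ := fun t s =>
    quotientKernel (sideLength n) (h j) t (ε * s + (-(ε * c))) with hf₃d
  have m₁ : Measurable (Function.uncurry f₁) := by
    simp only [hf₁d, Function.uncurry_def]; fun_prop
  have m₂ : Measurable (Function.uncurry f₂) :=
    hmi.comp (by fun_prop : Measurable fun p : ℝ × ℝ => (p.1, ε * p.2 + c))
  have m₃ : Measurable (Function.uncurry f₃) :=
    hmj.comp (by fun_prop : Measurable fun p : ℝ × ℝ => (p.1, ε * p.2 + (-(ε * c))))
  have hle : ∫⁻ s in Ioo 0 (sideLength n), ∫⁻ t in Ioo 0 (sideLength n), sqQuotient n g i j s t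
      ≤ ∫⁻ s in Ioo 0 (sideLength n), ∫⁻ t in Ioo 0 (sideLength n),
        (f₁ s t + f₂ s t + f₃ t s) := by
    refine lintegral_mono_ae ?_
    filter_upwards [ae_restrict_ne (sideLength n) s₀] with s hs
    refine lintegral_mono_ae ?_
    filter_upwards [ae_restrict_ne (sideLength n) t₀] with t ht
    exact hbound s hs.1 hs.2 t ht.1 ht.2
  exact hle.trans_lt (lintegral_lintegral_add_lt_top m₁ m₂ m₃ hf₁ hf₂ hf₃)

end FractionalBoundary

/-! ### Finiteness of the nonlocal energy -/

section Gagliardo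

variable {n : ℕ}

/-- The difference quotient of order `1/2` entering the nonlocal term of the energy. -/
noncomputable def quotient (u : ℂ → ℝ) (p : ℂ × ℂ) : ℝ := (u p.1 - u p.2) / ‖p.1 - p.2‖

lemma quotient_congr {u v : ℂ → ℝ} (h : u =ᵐ[arcMeasure n] v) :
    quotient u =ᵐ[(arcMeasure n).prod (arcMeasure n)] quotient v := by
  filter_upwards [Measure.quasiMeasurePreserving_fst.ae_eq_comp h,
    Measure.quasiMeasurePreserving_snd.ae_eq_comp h] with p h1 h2
  simp only [Function.comp_apply] at h1 h2
  rw [quotient, quotient, h1, h2]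

lemma aestronglyMeasurable_quotient {u : ℂ → ℝ} (hu : AEStronglyMeasurable u (arcMeasure n)) :
    AEStronglyMeasurable (quotient u) ((arcMeasure n).prod (arcMeasure n)) := by
  unfold quotient
  refine AEStronglyMeasurable.div₀ ?_ ?_
  · exact hu.comp_fst.sub hu.comp_snd
  · exact Continuous.aestronglyMeasurable (by fun_prop)

/-- Functions in `H¹(K)` have finite Gagliardo seminorm of order `1/2`. -/
lemma memLp_quotient {u : ℂ → ℝ} (hu : MemH1Boundary n u) :
    MemLp (quotient u) 2 ((arcMeasure n).prod (arcMeasure n)) := by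
  obtain ⟨g, hgc, hug, hd⟩ := hu
  choose h hw using hd
  refine (memLp_congr_ae (quotient_congr hug)).2 ?_
  have hm := aestronglyMeasurable_quotient (aestronglyMeasurable_of_continuousOn_snowflake hgc)
  refine (memLp_two_iff_integrable_sq hm).2 ⟨hm.pow 2, ?_⟩
  have hm2 : AEMeasurable (fun p => ‖quotient g p ^ 2‖ₑ) ((arcMeasure n).prod (arcMeasure n)) :=
    (hm.pow 2).enorm
  rw [hasFiniteIntegral_iff_enorm]
  rw [arcMeasure_eq_sum, Measure.prod_sum] at hm2 ⊢
  rw [lintegral_sum_measure, tsum_fintype]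
  refine ENNReal.sum_lt_top.2 fun p _ => ?_
  have hm3 := hm2.mono_measure (Measure.le_sum _ p)
  rw [lintegral_prod _ hm3, (measurableEmbedding_sideParam n p.1).lintegral_map]
  simp_rw [(measurableEmbedding_sideParam n p.2).lintegral_map]
  refine lt_of_eq_of_lt ?_ (lintegral_sqQuotient_lt_top hgc hw p.1 p.2)
  refine lintegral_congr fun s => lintegral_congr fun t => ?_
  rw [sqQuotient, Real.enorm_eq_ofReal (sq_nonneg _), quotient]

end Gagliardo

/-! ### Form domain elements with their energy data -/

section Lift

/-- `u` belongs to the form domain, with gradient `G` and tangential derivatives `h`; moreover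
`q` and `r` are the functions entering the zero order and nonlocal terms of the energy. -/
structure IsLift (n : ℕ) (b u : ℂ → ℝ) (G : ℂ → ℂ) (h : SideIndex n → ℝ → ℝ) (q : ℂ → ℝ)
    (r : ℂ × ℂ → ℝ) : Prop where
  memLp : MemLp u 2 (mMeasure n)
  grad : IsWeakGrad (domain n) u G
  trace : ∀ᵐ x ∂arcMeasure n, HasTraceAt (domain n) u x (u x)
  cont : ∃ g, ContinuousOn g (snowflake n) ∧ u =ᵐ[arcMeasure n] g
  deriv : ∀ i, IsWeakDeriv (sideLength n) (u ∘ sideParam n i) (h i)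
  zeroth : q =ᵐ[arcMeasure n] fun x => Real.sqrt (b x) * u x
  nonlocal : r =ᵐ[(arcMeasure n).prod (arcMeasure n)] quotient u

variable {n : ℕ} {b u v : ℂ → ℝ} {G G' : ℂ → ℂ} {h h' : SideIndex n → ℝ → ℝ} {q q' : ℂ → ℝ}
  {r r' : ℂ × ℂ → ℝ}

lemma ae_domain_of_ae_mMeasure {P : ℂ → Prop} (hP : ∀ᵐ x ∂mMeasure n, P x) :
    ∀ᵐ x ∂volume.restrict (domain n), P x :=
  (Measure.absolutelyContinuous_of_le (volume_domain_le_mMeasure n)).ae_le hP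

lemma ae_arc_of_ae_mMeasure {P : ℂ → Prop} (hP : ∀ᵐ x ∂mMeasure n, P x) :
    ∀ᵐ x ∂arcMeasure n, P x :=
  (Measure.absolutelyContinuous_of_le (arcMeasure_le_mMeasure n)).ae_le hP

lemma hasTraceAt_congr (huv : u =ᵐ[volume.restrict (domain n)] v) (x : ℂ) (c : ℝ) :
    HasTraceAt (domain n) u x c ↔ HasTraceAt (domain n) v x c := by
  unfold HasTraceAt
  have : ∀ r : ℝ, ⨍ y in Metric.ball x r ∩ domain n, u y
      = ⨍ y in Metric.ball x r ∩ domain n, v y := fun r => by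
    rw [setAverage_eq, setAverage_eq]
    congr 1
    exact integral_congr_ae (ae_restrict_of_ae_restrict_of_subset inter_subset_right huv)
  simp_rw [this]

lemma HasTraceAt.add (hu : IntegrableOn u (domain n)) (hv : IntegrableOn v (domain n)) {x : ℂ}
    {c d : ℝ} (h1 : HasTraceAt (domain n) u x c) (h2 : HasTraceAt (domain n) v x d) :
    HasTraceAt (domain n) (fun y => u y + v y) x (c + d) := by
  refine (Tendsto.add h1 h2).congr fun r => ?_
  rw [setAverage_eq, setAverage_eq, setAverage_eq, integral_add (hu.mono_set inter_subset_right)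
    (hv.mono_set inter_subset_right), smul_add]

lemma HasTraceAt.const_mul {D : Set ℂ} {x : ℂ} {c : ℝ} (h1 : HasTraceAt D u x c) (k : ℝ) :
    HasTraceAt D (fun y => k * u y) x (k * c) := by
  refine (Tendsto.const_mul k h1).congr fun r => ?_
  rw [setAverage_eq, setAverage_eq, integral_const_mul, smul_eq_mul, smul_eq_mul]
  ring

lemma IsLift.memLp_domain (hl : IsLift n b u G h q r) : MemLp u 2 (volume.restrict (domain n)) :=
  hl.memLp.mono_measure (volume_domain_le_mMeasure n)

lemma IsLift.memLp_arc (hl : IsLift n b u G h q r) : MemLp u 2 (arcMeasure n) :=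
  hl.memLp.mono_measure (arcMeasure_le_mMeasure n)

lemma ae_side_of_ae_arc {P : ℂ → Prop} (hP : ∀ᵐ x ∂arcMeasure n, P x) (i : SideIndex n) :
    ∀ᵐ s ∂volume.restrict (Ioo 0 (sideLength n)), P (sideParam n i s) :=
  ae_arcMeasure_iff.1 hP i

lemma IsLift.congr (hl : IsLift n b u G h q r) (hu : u =ᵐ[mMeasure n] v)
    (hG : G =ᵐ[volume.restrict (domain n)] G')
    (hh : ∀ i, h i =ᵐ[volume.restrict (Ioo 0 (sideLength n))] h' i)
    (hq : q =ᵐ[arcMeasure n] q') (hr : r =ᵐ[(arcMeasure n).prod (arcMeasure n)] r') :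
    IsLift n b v G' h' q' r' := by
  have huΩ : u =ᵐ[volume.restrict (domain n)] v := ae_domain_of_ae_mMeasure hu
  have hua : u =ᵐ[arcMeasure n] v := ae_arc_of_ae_mMeasure hu
  refine ⟨hl.memLp.ae_eq hu, hl.grad.congr huΩ hG, ?_, ?_, fun i => ?_, ?_, ?_⟩
  · filter_upwards [hl.trace, hua] with x hx hx'
    rwa [← hx', ← hasTraceAt_congr huΩ]
  · obtain ⟨g, hg, hug⟩ := hl.cont
    exact ⟨g, hg, hua.symm.trans hug⟩
  · exact (hl.deriv i).congr (ae_side_of_ae_arc hua i) (hh i)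
  · filter_upwards [hq, hl.zeroth, hua] with x h1 h2 h3
    rw [← h1, h2, h3]
  · exact hr.symm.trans (hl.nonlocal.trans (quotient_congr hua))

lemma IsLift.add (hl : IsLift n b u G h q r) (hl' : IsLift n b v G' h' q' r') :
    IsLift n b (fun x => u x + v x) (fun x => G x + G' x) (fun i s => h i s + h' i s)
      (fun x => q x + q' x) (fun p => r p + r' p) := by
  refine ⟨hl.memLp.add hl'.memLp, hl.grad.add hl.memLp_domain hl'.memLp_domain hl'.grad, ?_, ?_,
    fun i => ?_, ?_, ?_⟩
  · filter_upwards [hl.trace, hl'.trace] with x h1 h2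
    exact h1.add (hl.memLp_domain.integrable one_le_two) (hl'.memLp_domain.integrable one_le_two) h2
  · obtain ⟨g, hg, hug⟩ := hl.cont
    obtain ⟨g', hg', hug'⟩ := hl'.cont
    exact ⟨_, hg.add hg', hug.add hug'⟩
  · exact (hl.deriv i).add (memLp_comp_sideParam hl.memLp_arc i)
      (memLp_comp_sideParam hl'.memLp_arc i) (hl'.deriv i)
  · filter_upwards [hl.zeroth, hl'.zeroth] with x h1 h2
    rw [h1, h2, mul_add]
  · filter_upwards [hl.nonlocal, hl'.nonlocal] with p h1 h2
    rw [h1, h2]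
    simp only [quotient]
    ring

lemma IsLift.const_mul (hl : IsLift n b u G h q r) (c : ℝ) :
    IsLift n b (fun x => c * u x) (fun x => c • G x) (fun i s => c * h i s)
      (fun x => c * q x) (fun p => c * r p) := by
  refine ⟨hl.memLp.const_mul c, hl.grad.smul c, ?_, ?_, fun i => (hl.deriv i).smul c, ?_, ?_⟩
  · filter_upwards [hl.trace] with x h1 using h1.const_mul c
  · obtain ⟨g, hg, hug⟩ := hl.cont
    exact ⟨fun x => c * g x, continuousOn_const.mul hg, hug.fun_comp (c * ·)⟩
  · filter_upwards [hl.zeroth] with x h1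
    rw [h1]; ring
  · filter_upwards [hl.nonlocal] with p h1
    rw [h1]
    simp only [quotient]
    ring

/-- A Sobolev inequality on an interval. -/
lemma sq_le_of_weakDeriv {ℓ : ℝ} (hℓ : 0 < ℓ) {f k : ℝ → ℝ}
    (hf : MemLp f 2 (volume.restrict (Ioo 0 ℓ))) (hk : MemLp k 2 (volume.restrict (Ioo 0 ℓ)))
    (hd : ∀ s ∈ Icc 0 ℓ, ∀ t ∈ Icc 0 ℓ, f t - f s = ∫ r in s..t, k r) {t : ℝ} (ht : t ∈ Icc 0 ℓ) :
    f t ^ 2 ≤ 2 / ℓ * (∫ s in Ioo 0 ℓ, f s ^ 2) + 2 * ℓ * ∫ s in Ioo 0 ℓ, k s ^ 2 := by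
  have h1 : ∀ s ∈ Ioo 0 ℓ, f t ^ 2 ≤ 2 * f s ^ 2 + 2 * ((∫ s in Ioo 0 ℓ, k s ^ 2) * ℓ) := by
    intro s hs
    have h2 := sq_sub_le_mul_abs hk hd (Ioo_subset_Icc_self hs) ht
    have h3 : |t - s| ≤ ℓ := by
      have hs1 : 0 < s ∧ s < ℓ := hs
      rw [abs_le]; constructor <;> linarith [ht.1, ht.2]
    have h4 : (∫ s in Ioo 0 ℓ, k s ^ 2) * |t - s| ≤ (∫ s in Ioo 0 ℓ, k s ^ 2) * ℓ :=
      mul_le_mul_of_nonneg_left h3 (integral_nonneg fun _ => sq_nonneg _)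
    nlinarith [sq_nonneg (2 * f s - f t)]
  have hi : IntegrableOn (fun s => f s ^ 2) (Ioo 0 ℓ) := hf.integrable_sq
  have hc : ∀ c : ℝ, IntegrableOn (fun _ => c) (Ioo 0 ℓ) := fun c => integrableOn_const (by simp)
  have h5 := setIntegral_mono_on (hc (f t ^ 2)) ((hi.const_mul 2).add (hc _)) measurableSet_Ioo h1
  rw [integral_add' (hi.const_mul 2) (hc _), integral_const_mul, setIntegral_const,
    setIntegral_const, measureReal_def, Real.volume_Ioo, sub_zero, ENNReal.toReal_ofReal hℓ.le,
    smul_eq_mul, smul_eq_mul] at h5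
  rw [← mul_le_mul_iff_right₀ hℓ]
  refine h5.trans (le_of_eq ?_)
  field_simp

lemma tendsto_integral_sq {X : Type*} [MeasurableSpace X] {μ : Measure X} {F : ℕ → X → ℝ}
    (hF : ∀ k, MemLp (F k) 2 μ) (hl : Tendsto (fun k => eLpNorm (F k) 2 μ) atTop (𝓝 0)) :
    Tendsto (fun k => ∫ x, F k x ^ 2 ∂μ) atTop (𝓝 0) := by
  have h1 : ∀ k, ∫ x, F k x ^ 2 ∂μ = (eLpNorm (F k) 2 μ).toReal ^ 2 := fun k => by
    rw [(hF k).eLpNorm_eq_integral_rpow_norm two_ne_zero ENNReal.ofNat_ne_top,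
      ENNReal.toReal_ofReal (by positivity), ← Real.rpow_natCast, ← Real.rpow_mul (by positivity)]
    simp
  simp_rw [h1]
  have h2 := ((ENNReal.tendsto_toReal ENNReal.zero_ne_top).comp hl).pow 2
  simpa using h2

/-- Identifies the limits of the zero order and nonlocal data, for which only pointwise convergence
is at hand, without any norm estimate. -/
lemma ae_unique_of_tendsto_eLpNorm {X : Type*} [MeasurableSpace X] {μ : Measure X}
    {F : ℕ → X → ℝ} {f g : X → ℝ} (hF : ∀ k, AEStronglyMeasurable (F k) μ)
    (hf : AEStronglyMeasurable f μ)
    (hl : Tendsto (fun k => eLpNorm (F k - f) 2 μ) atTop (𝓝 0))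
    (hg : ∀ᵐ x ∂μ, Tendsto (fun k => F k x) atTop (𝓝 (g x))) : f =ᵐ[μ] g := by
  obtain ⟨ns, hns, hae⟩ :=
    (tendstoInMeasure_of_tendsto_eLpNorm two_ne_zero hF hf hl).exists_seq_tendsto_ae
  filter_upwards [hae, hg] with x h1 h2
  exact tendsto_nhds_unique h1 (h2.comp hns.tendsto_atTop)

end Lift

/-! ### Closedness of the energy data -/

section LiftClosed

variable {n : ℕ} {b : ℂ → ℝ}

/-- On each side the Sobolev inequality upgrades convergence of values and derivatives to uniform
convergence. With finitely many sides this is uniform on the curve, so the limit is continuous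
across the corners too. -/
lemma exists_continuousOn_of_tendsto {g : ℕ → ℂ → ℝ} {h : ℕ → SideIndex n → ℝ → ℝ} {u : ℂ → ℝ}
    {h' : SideIndex n → ℝ → ℝ} (hg : ∀ k, ContinuousOn (g k) (snowflake n))
    (hgm : ∀ k, MemLp (g k) 2 (arcMeasure n))
    (hd : ∀ k i, IsWeakDeriv (sideLength n) (g k ∘ sideParam n i) (h k i))
    (hu : MemLp u 2 (arcMeasure n))
    (hd' : ∀ i, IsWeakDeriv (sideLength n) (u ∘ sideParam n i) (h' i))
    (hlg : Tendsto (fun k => eLpNorm (g k - u) 2 (arcMeasure n)) atTop (𝓝 0))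
    (hlh : ∀ i, Tendsto (fun k => eLpNorm (h k i - h' i) 2
      (volume.restrict (Ioo 0 (sideLength n)))) atTop (𝓝 0)) :
    ∃ g', ContinuousOn g' (snowflake n) ∧ u =ᵐ[arcMeasure n] g' := by
  have hℓ := sideLength_pos n
  have hum : ∀ i, MemLp (u ∘ sideParam n i) 2 (volume.restrict (Ioo 0 (sideLength n))) :=
    fun i => memLp_comp_sideParam hu i
  have hfin : IsFiniteMeasure (volume.restrict (Ioo 0 (sideLength n))) := ⟨by simp⟩
  have hprim : ∀ i, ∃ c, ∀ᵐ s, s ∈ Ioo 0 (sideLength n) →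
      (u ∘ sideParam n i) s = c + ∫ r in (0 : ℝ)..s, h' i r := fun i =>
    ae_eq_primitive_of_weakDeriv hℓ ((hum i).integrable one_le_two) (hd' i).integrableOn (hd' i).2
  choose c hc using hprim
  set w : SideIndex n → ℝ → ℝ := fun i s => c i + ∫ r in (0 : ℝ)..s, h' i r with hw
  have hunif : ∀ i, TendstoUniformlyOn (fun k t => g k (sideParam n i t)) (w i) atTop
      (Icc 0 (sideLength n)) := by
    intro i
    have hii : ∀ {F : ℝ → ℝ}, IntegrableOn F (Ioo 0 (sideLength n)) → ∀ s ∈ Icc 0 (sideLength n),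
        ∀ t ∈ Icc 0 (sideLength n), IntervalIntegrable F volume s t := by
      intro F hF s hs t ht
      have := (intervalIntegrable_iff_integrableOn_Ioo_of_le hℓ.le).2 hF
      refine this.mono_set ?_
      rw [uIcc_of_le hℓ.le]
      exact uIcc_subset_Icc hs ht
    have hdiff : ∀ k, ∀ s ∈ Icc 0 (sideLength n), ∀ t ∈ Icc 0 (sideLength n),
        (g k (sideParam n i t) - w i t) - (g k (sideParam n i s) - w i s)
          = ∫ r in s..t, (h k i r - h' i r) := by
      intro k s hs t ht
      have h1 := sub_eq_integral_side (hg k) (hd k) i s hs t ht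
      have h0 : (0 : ℝ) ∈ Icc 0 (sideLength n) := ⟨le_rfl, hℓ.le⟩
      have h2 := intervalIntegral.integral_interval_sub_left
        (hii (hd' i).integrableOn 0 h0 t ht) (hii (hd' i).integrableOn 0 h0 s hs)
      rw [intervalIntegral.integral_sub (hii (hd k i).integrableOn s hs t ht)
        (hii (hd' i).integrableOn s hs t ht), ← h1, ← h2]
      simp only [hw, Function.comp_apply]
      ring
    have hae : ∀ k, (fun s => g k (sideParam n i s) - w i s)
        =ᵐ[volume.restrict (Ioo 0 (sideLength n))] (g k - u) ∘ sideParam n i := fun k => by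
      rw [EventuallyEq, ae_restrict_iff' measurableSet_Ioo]
      filter_upwards [hc i] with s hs hs'
      simp only [Function.comp_apply, Pi.sub_apply, hw]
      rw [← hs hs', Function.comp_apply]
    have hfm : ∀ k, MemLp (fun s => g k (sideParam n i s) - w i s) 2
        (volume.restrict (Ioo 0 (sideLength n))) := fun k =>
      (memLp_congr_ae (hae k)).2 (memLp_comp_sideParam ((hgm k).sub hu) i)
    have hf0 : Tendsto (fun k => ∫ s in Ioo 0 (sideLength n),
        (g k (sideParam n i s) - w i s) ^ 2) atTop (𝓝 0) := by
      refine tendsto_integral_sq hfm ?_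
      refine tendsto_of_tendsto_of_tendsto_of_le_of_le tendsto_const_nhds hlg (fun _ => zero_le)
        fun k => ?_
      exact (eLpNorm_congr_ae (hae k)).trans_le (eLpNorm_comp_sideParam_le _ i)
    have hh0 : Tendsto (fun k => ∫ s in Ioo 0 (sideLength n), (h k i s - h' i s) ^ 2)
        atTop (𝓝 0) := tendsto_integral_sq (fun k => (hd k i).1.sub (hd' i).1) (hlh i)
    have hsum := (hf0.const_mul (2 / sideLength n)).add (hh0.const_mul (2 * sideLength n))
    simp only [mul_zero, add_zero] at hsum
    rw [Metric.tendstoUniformlyOn_iff]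
    intro ε hε
    filter_upwards [hsum.eventually (gt_mem_nhds (sq_pos_of_pos hε))] with k hk t ht
    rw [dist_comm, Real.dist_eq]
    refine abs_lt_of_sq_lt_sq (lt_of_le_of_lt ?_ hk) hε.le
    exact sq_le_of_weakDeriv hℓ (hfm k) ((hd k i).1.sub (hd' i).1) (hdiff k) ht
  have hlim : ∀ i, ∀ t ∈ Icc 0 (sideLength n),
      limUnder atTop (fun k => g k (sideParam n i t)) = w i t := fun i t ht =>
    ((hunif i).tendsto_at ht).limUnder_eq
  -- The limit is taken pointwise on the curve and not side by side, so that a corner receives one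
  -- value from all sides meeting there.
  refine ⟨fun x => limUnder atTop fun k => g k x, ?_, ?_⟩
  · have hK : TendstoUniformlyOn g (fun x => limUnder atTop fun k => g k x) atTop (snowflake n) := by
      rw [Metric.tendstoUniformlyOn_iff]
      intro ε hε
      have := eventually_all.2 fun i => Metric.tendstoUniformlyOn_iff.1 (hunif i) ε hε
      filter_upwards [this] with k hk x hx
      obtain ⟨i, t, ht, rfl⟩ := mem_iUnion.1 hx
      have := hk i t ht
      rwa [← hlim i t ht] at this
    exact hK.continuousOn (Frequently.of_forall hg)
  · refine ae_arcMeasure_iff.2 fun i => ?_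
    rw [ae_restrict_iff' measurableSet_Ioo]
    filter_upwards [hc i] with s hs hs'
    rw [hlim i s (Ioo_subset_Icc_self hs')]
    exact hs hs'

/-- Each clause has its own reason: weak derivatives by duality, the trace by
`hasTraceAt_of_tendsto`, continuity by uniform convergence, and the last two data along an almost
everywhere convergent subsequence. -/
theorem IsLift.of_tendsto {u : ℕ → ℂ → ℝ} {G : ℕ → ℂ → ℂ} {h : ℕ → SideIndex n → ℝ → ℝ}
    {q : ℕ → ℂ → ℝ} {r : ℕ → ℂ × ℂ → ℝ} {u' : ℂ → ℝ} {G' : ℂ → ℂ} {h' : SideIndex n → ℝ → ℝ}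
    {q' : ℂ → ℝ} {r' : ℂ × ℂ → ℝ} (hl : ∀ k, IsLift n b (u k) (G k) (h k) (q k) (r k))
    (hqm : ∀ k, AEStronglyMeasurable (q k) (arcMeasure n))
    (hrm : ∀ k, AEStronglyMeasurable (r k) ((arcMeasure n).prod (arcMeasure n)))
    (hu' : MemLp u' 2 (mMeasure n)) (hG' : MemLp G' 2 (volume.restrict (domain n)))
    (hh' : ∀ i, MemLp (h' i) 2 (volume.restrict (Ioo 0 (sideLength n))))
    (hq' : MemLp q' 2 (arcMeasure n)) (hr' : MemLp r' 2 ((arcMeasure n).prod (arcMeasure n)))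
    (hlu : Tendsto (fun k => eLpNorm (u k - u') 2 (mMeasure n)) atTop (𝓝 0))
    (hlG : Tendsto (fun k => eLpNorm (G k - G') 2 (volume.restrict (domain n))) atTop (𝓝 0))
    (hlh : ∀ i, Tendsto (fun k => eLpNorm (h k i - h' i) 2
      (volume.restrict (Ioo 0 (sideLength n)))) atTop (𝓝 0))
    (hlq : Tendsto (fun k => eLpNorm (q k - q') 2 (arcMeasure n)) atTop (𝓝 0))
    (hlr : Tendsto (fun k => eLpNorm (r k - r') 2 ((arcMeasure n).prod (arcMeasure n)))
      atTop (𝓝 0)) : IsLift n b u' G' h' q' r' := by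
  have hluΩ : Tendsto (fun k => eLpNorm (u k - u') 2 (volume.restrict (domain n))) atTop (𝓝 0) :=
    tendsto_of_tendsto_of_tendsto_of_le_of_le tendsto_const_nhds hlu (fun _ => zero_le)
      fun k => eLpNorm_mono_measure _ (volume_domain_le_mMeasure n)
  have hlua : Tendsto (fun k => eLpNorm (u k - u') 2 (arcMeasure n)) atTop (𝓝 0) :=
    tendsto_of_tendsto_of_tendsto_of_le_of_le tendsto_const_nhds hlu (fun _ => zero_le)
      fun k => eLpNorm_mono_measure _ (arcMeasure_le_mMeasure n)
  have huΩ := hu'.mono_measure (volume_domain_le_mMeasure n)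
  have hua := hu'.mono_measure (arcMeasure_le_mMeasure n)
  have hgrad : IsWeakGrad (domain n) u' G' :=
    IsWeakGrad.of_tendsto (fun k => (hl k).grad) (fun k => (hl k).memLp_domain) huΩ hG' hluΩ hlG
  have hder : ∀ i, IsWeakDeriv (sideLength n) (u' ∘ sideParam n i) (h' i) := by
    intro i
    refine IsWeakDeriv.of_tendsto (fun k => (hl k).deriv i)
      (fun k => memLp_comp_sideParam (hl k).memLp_arc i) (memLp_comp_sideParam hua i) (hh' i) ?_
      (hlh i)
    exact tendsto_of_tendsto_of_tendsto_of_le_of_le tendsto_const_nhds hlua (fun _ => zero_le)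
      fun k => eLpNorm_comp_sideParam_le (u k - u') i
  obtain ⟨ns, hns, hae⟩ := (tendstoInMeasure_of_tendsto_eLpNorm two_ne_zero
    (fun k => (hl k).memLp_arc.1) hua.1 hlua).exists_seq_tendsto_ae
  refine ⟨hu', hgrad, ?_, ?_, hder, ?_, ?_⟩
  · exact hasTraceAt_of_tendsto (fun k => (hl k).memLp_domain) (fun k => (hl k).grad) huΩ hgrad hluΩ
      hlG (fun k => (hl k).memLp_arc) hua hlua fun k => (hl k).trace
  · choose g hg hug using fun k => (hl k).cont
    refine exists_continuousOn_of_tendsto hg (fun k => (hl k).memLp_arc.ae_eq (hug k))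
      (fun k i => ((hl k).deriv i).congr (ae_side_of_ae_arc (hug k) i) (EventuallyEq.refl _ _))
      hua hder ?_ hlh
    refine hlua.congr fun k => eLpNorm_congr_ae ?_
    exact (hug k).sub (EventuallyEq.refl _ _)
  · refine ae_unique_of_tendsto_eLpNorm (F := fun k => q (ns k)) (fun k => hqm _) hq'.1
      (hlq.comp hns.tendsto_atTop) ?_
    filter_upwards [hae, ae_all_iff.2 fun k => (hl k).zeroth] with x hx hx'
    simp only [hx']
    exact hx.const_mul _
  · refine ae_unique_of_tendsto_eLpNorm (F := fun k => r (ns k)) (fun k => hrm _) hr'.1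
      (hlr.comp hns.tendsto_atTop) ?_
    have h1 := Measure.quasiMeasurePreserving_fst (μ := arcMeasure n) (ν := arcMeasure n) |>.ae hae
    have h2 := Measure.quasiMeasurePreserving_snd (μ := arcMeasure n) (ν := arcMeasure n) |>.ae hae
    filter_upwards [h1, h2, ae_all_iff.2 fun k => (hl k).nonlocal] with p hp1 hp2 hp
    simp only [hp, quotient]
    exact (hp1.sub hp2).div_const _

end LiftClosed

/-! ### Test functions of the plane belong to the form domain -/

section SmoothFunctions

variable {n : ℕ} {φ : ℂ → ℝ}

lemma hasTraceAt_of_continuous (hφ : Continuous φ) {x : ℂ} (hx : x ∈ closure (domain n)) :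
    HasTraceAt (domain n) φ x (φ x) := by
  rw [HasTraceAt, Metric.tendsto_nhds]
  intro ε hε
  obtain ⟨δ, hδ, hball⟩ := Metric.continuousAt_iff.1 hφ.continuousAt (ε / 2) (half_pos hε)
  filter_upwards [self_mem_nhdsWithin, nhdsWithin_le_nhds (gt_mem_nhds hδ)] with r hr hrδ
  have hr0 : 0 < r := hr
  have ho : IsOpen (Metric.ball x r ∩ domain n) := Metric.isOpen_ball.inter (isOpen_domain n)
  have hne : (Metric.ball x r ∩ domain n).Nonempty :=
    mem_closure_iff.1 hx _ Metric.isOpen_ball (Metric.mem_ball_self hr0)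
  have hpos : volume (Metric.ball x r ∩ domain n) ≠ 0 := (ho.measure_pos volume hne).ne'
  have hfin : volume (Metric.ball x r ∩ domain n) ≠ ⊤ :=
    ne_top_of_le_ne_top measure_ball_lt_top.ne (measure_mono inter_subset_left)
  have hi : IntegrableOn φ (Metric.ball x r ∩ domain n) :=
    (hφ.continuousOn.integrableOn_compact (isCompact_closedBall x r)).mono_set
      (inter_subset_left.trans Metric.ball_subset_closedBall)
  have hmem := (convex_closedBall (φ x) (ε / 2)).set_average_mem Metric.isClosed_closedBall hpos hfin
    ((ae_restrict_iff' ho.measurableSet).2 (Eventually.of_forall fun y hy =>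
      Metric.ball_subset_closedBall (hball (lt_trans hy.1 hrδ)))) hi
  exact lt_of_le_of_lt hmem (half_lt_self hε)

lemma isWeakGrad_gradient (hφ : ContDiff ℝ ∞ φ) (hc : HasCompactSupport φ) {D : Set ℂ} :
    IsWeakGrad D φ (gradient φ) := by
  have hg : Continuous (gradient φ) :=
    (InnerProductSpace.toDual ℝ ℂ).symm.continuous.comp (hφ.continuous_fderiv (by simp))
  have hgc : HasCompactSupport (gradient φ) :=
    (hc.fderiv ℝ).comp_left (g := (InnerProductSpace.toDual ℝ ℂ).symm) (map_zero _)
  refine ⟨(hg.memLp_of_hasCompactSupport hgc).restrict D, fun ψ hψ hψc hψs e => ?_⟩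
  have hin : ∀ x, inner ℝ (gradient φ x) e = fderiv ℝ φ x e := fun x => by
    rw [gradient, InnerProductSpace.toDual_symm_apply]
  simp only [hin]
  have hψd : Continuous fun x => fderiv ℝ ψ x e :=
    (hψ.continuous_fderiv (by simp)).clm_apply continuous_const
  have hφd : Continuous fun x => fderiv ℝ φ x e :=
    (hφ.continuous_fderiv (by simp)).clm_apply continuous_const
  have hψ0 : ∀ x ∉ D, ψ x = 0 := fun x hx => image_eq_zero_of_notMem_tsupport fun h => hx (hψs h)
  have hψ1 : ∀ x ∉ D, fderiv ℝ ψ x e = 0 := fun x hx => by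
    rw [image_eq_zero_of_notMem_tsupport fun h => hx (hψs (tsupport_fderiv_subset ℝ h))]; rfl
  rw [setIntegral_eq_integral_of_forall_compl_eq_zero fun x hx => by rw [hψ1 x hx, mul_zero],
    setIntegral_eq_integral_of_forall_compl_eq_zero fun x hx => by rw [hψ0 x hx, mul_zero]]
  refine integral_mul_fderiv_eq_neg_fderiv_mul_of_integrable ?_ ?_ ?_
    (fun x _ => (hφ.differentiable (by simp)) x) (fun x _ => (hψ.differentiable (by simp)) x)
  · exact (hφd.mul hψ.continuous).integrable_of_hasCompactSupport hψc.mul_left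
  · exact (hφ.continuous.mul hψd).integrable_of_hasCompactSupport hc.mul_right
  · exact (hφ.continuous.mul hψ.continuous).integrable_of_hasCompactSupport hc.mul_right

lemma isWeakDeriv_deriv {f : ℝ → ℝ} (hf : ContDiff ℝ 1 f) (ℓ : ℝ) : IsWeakDeriv ℓ f (deriv f) := by
  have hfd : Continuous (deriv f) := hf.continuous_deriv le_rfl
  refine ⟨?_, fun ψ hψ hψc hψs => ?_⟩
  · obtain ⟨C, hC⟩ := isCompact_Icc.exists_bound_of_continuousOn (hfd.continuousOn (s := Icc 0 ℓ))
    have : IsFiniteMeasure (volume.restrict (Ioo 0 ℓ)) := ⟨by simp⟩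
    refine MemLp.of_bound hfd.aestronglyMeasurable C ?_
    filter_upwards [ae_restrict_mem measurableSet_Ioo] with x hx using hC x (Ioo_subset_Icc_self hx)
  have hψd : Continuous (deriv ψ) := hψ.continuous_deriv (by simp)
  have hψ0 : ∀ x ∉ Ioo 0 ℓ, ψ x = 0 := fun x hx =>
    image_eq_zero_of_notMem_tsupport fun h => hx (hψs h)
  have hψ1 : ∀ x ∉ Ioo 0 ℓ, deriv ψ x = 0 := fun x hx =>
    image_eq_zero_of_notMem_tsupport fun h => hx (hψs (tsupport_deriv_subset h))
  rw [setIntegral_eq_integral_of_forall_compl_eq_zero fun x hx => by rw [hψ1 x hx, mul_zero],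
    setIntegral_eq_integral_of_forall_compl_eq_zero fun x hx => by rw [hψ0 x hx, mul_zero]]
  refine integral_mul_deriv_eq_deriv_mul_of_integrable
    (fun x _ => ((hf.differentiable one_ne_zero) x).hasDerivAt)
    (fun x _ => ((hψ.differentiable (by simp)) x).hasDerivAt) ?_ ?_ ?_
  · exact (hf.continuous.mul hψd).integrable_of_hasCompactSupport hψc.deriv.mul_left
  · exact (hfd.mul hψ.continuous).integrable_of_hasCompactSupport hψc.mul_left
  · exact (hf.continuous.mul hψ.continuous).integrable_of_hasCompactSupport hψc.mul_left

lemma contDiff_sideParam (n : ℕ) (i : SideIndex n) : ContDiff ℝ ∞ (sideParam n i) := by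
  have : sideParam n i = fun s : ℝ => sideBase n i + sideDir n i * s := funext (sideParam_eq n i)
  rw [this]
  exact contDiff_const.add (contDiff_const.mul Complex.ofRealCLM.contDiff)

/-- Supplies the dense subset. No boundary condition is imposed: values on the curve are part of the
unknown. -/
lemma isLift_of_contDiff (b : ℂ → ℝ) (hφ : ContDiff ℝ ∞ φ) (hc : HasCompactSupport φ) :
    IsLift n b φ (gradient φ) (fun i => deriv (φ ∘ sideParam n i))
      (fun x => Real.sqrt (b x) * φ x) (quotient φ) where
  memLp := by
    obtain ⟨C, hC⟩ := hc.exists_bound_of_continuous hφ.continuous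
    exact MemLp.of_bound hφ.continuous.aestronglyMeasurable C (Eventually.of_forall hC)
  grad := isWeakGrad_gradient hφ hc
  trace := by
    filter_upwards [ae_mem_snowflake n] with x hx
    exact hasTraceAt_of_continuous hφ.continuous (snowflake_subset_closure_domain n hx)
  cont := ⟨φ, hφ.continuous.continuousOn, EventuallyEq.refl _ _⟩
  deriv i := isWeakDeriv_deriv ((hφ.comp (contDiff_sideParam n i)).of_le (by simp)) _
  zeroth := EventuallyEq.refl _ _
  nonlocal := EventuallyEq.refl _ _

end SmoothFunctions

/-! ### The energy as an inner product, and the operator `A` -/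

section FormGraph

/-- The Hilbert space of the data (gradient, tangential derivatives, boundary values, difference
quotients) whose inner product is the energy. -/
abbrev FormSpace (n : ℕ) : Type :=
  WithLp 2 (Lp ℂ 2 ((volume : Measure ℂ).restrict (domain n)) ×
    WithLp 2 (PiLp 2 (fun _ : SideIndex n =>
      Lp ℝ 2 ((volume : Measure ℝ).restrict (Ioo 0 (sideLength n)))) ×
    WithLp 2 (Lp ℝ 2 (arcMeasure n) × Lp ℝ 2 ((arcMeasure n).prod (arcMeasure n)))))

/-- The components of `p` are those of an element of the form domain. -/
def IsGraphPoint (n : ℕ) (b : ℂ → ℝ) (p : WithLp 2 (L2 n × FormSpace n)) : Prop :=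
  IsLift n b p.fst p.snd.fst (fun i => p.snd.snd.fst i) p.snd.snd.snd.fst p.snd.snd.snd.snd

variable {n : ℕ} {b : ℂ → ℝ}

lemma isLift_zero : IsLift n b (fun _ => 0) (fun _ => 0) (fun _ _ => 0) (fun _ => 0) fun _ => 0 := by
  have h := (isLift_of_contDiff (n := n) b (contDiff_const (c := (0 : ℝ)))
    HasCompactSupport.zero).const_mul 0
  simpa only [zero_mul, zero_smul] using h

/-- The graph of the map sending `u` to the data entering the energy. -/
def formGraph (n : ℕ) (b : ℂ → ℝ) : Submodule ℝ (WithLp 2 (L2 n × FormSpace n)) where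
  carrier := {p | IsGraphPoint n b p}
  zero_mem' := isLift_zero.congr (Lp.coeFn_zero _ _ _).symm (Lp.coeFn_zero _ _ _).symm
    (fun _ => (Lp.coeFn_zero _ _ _).symm) (Lp.coeFn_zero _ _ _).symm (Lp.coeFn_zero _ _ _).symm
  add_mem' hp hp' := (IsLift.add hp hp').congr (Lp.coeFn_add _ _).symm
    (Lp.coeFn_add _ _).symm (fun _ => (Lp.coeFn_add _ _).symm) (Lp.coeFn_add _ _).symm
    (Lp.coeFn_add _ _).symm
  smul_mem' c p hp := (IsLift.const_mul hp c).congr (Lp.coeFn_smul c p.fst).symm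
    (Lp.coeFn_smul c p.snd.fst).symm (fun i => (Lp.coeFn_smul c (p.snd.snd.fst i)).symm)
    (Lp.coeFn_smul c p.snd.snd.snd.fst).symm (Lp.coeFn_smul c p.snd.snd.snd.snd).symm

lemma mem_formGraph {p : WithLp 2 (L2 n × FormSpace n)} : p ∈ formGraph n b ↔ IsGraphPoint n b p :=
  Iff.rfl

lemma isClosed_formGraph : IsClosed (formGraph n b : Set (WithLp 2 (L2 n × FormSpace n))) := by
  refine IsSeqClosed.isClosed fun p p' hp hlim => ?_
  have c1 := (WithLp.continuous_fst 2 _ _).tendsto p' |>.comp hlim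
  have c2 := (WithLp.continuous_snd 2 _ _).tendsto p' |>.comp hlim
  have c21 := (WithLp.continuous_fst 2 _ _).tendsto p'.snd |>.comp c2
  have c22 := (WithLp.continuous_snd 2 _ _).tendsto p'.snd |>.comp c2
  have c221 := (WithLp.continuous_fst 2 _ _).tendsto p'.snd.snd |>.comp c22
  have c222 := (WithLp.continuous_snd 2 _ _).tendsto p'.snd.snd |>.comp c22
  have c2221 := (WithLp.continuous_fst 2 _ _).tendsto p'.snd.snd.snd |>.comp c222
  have c2222 := (WithLp.continuous_snd 2 _ _).tendsto p'.snd.snd.snd |>.comp c222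
  have c3 := fun i => (PiLp.continuous_apply 2 _ i).tendsto p'.snd.snd.fst |>.comp c221
  exact IsLift.of_tendsto (fun k => hp k) (fun k => (Lp.memLp _).1) (fun k => (Lp.memLp _).1)
    (Lp.memLp _) (Lp.memLp _) (fun i => Lp.memLp _) (Lp.memLp _) (Lp.memLp _)
    ((Lp.tendsto_Lp_iff_tendsto_eLpNorm' _ _).1 c1) ((Lp.tendsto_Lp_iff_tendsto_eLpNorm' _ _).1 c21)
    (fun i => (Lp.tendsto_Lp_iff_tendsto_eLpNorm' _ _).1 (c3 i))
    ((Lp.tendsto_Lp_iff_tendsto_eLpNorm' _ _).1 c2221)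
    ((Lp.tendsto_Lp_iff_tendsto_eLpNorm' _ _).1 c2222)

/-- Only continuity of `b` on the closure is given; compactness of the curve supplies the bound. -/
lemma memLp_sqrt_mul (hb : ContinuousOn b (closure (domain n))) {u : ℂ → ℝ}
    (hu : MemLp u 2 (arcMeasure n)) : MemLp (fun x => Real.sqrt (b x) * u x) 2 (arcMeasure n) := by
  have hc : ContinuousOn (fun x => Real.sqrt (b x)) (snowflake n) :=
    (hb.mono (snowflake_subset_closure_domain n)).sqrt
  obtain ⟨C, hC⟩ := (isCompact_snowflake n).exists_bound_of_continuousOn hc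
  refine hu.of_le_mul (c := C)
    ((aestronglyMeasurable_of_continuousOn_snowflake hc).mul hu.1) ?_
  filter_upwards [ae_mem_snowflake n] with x hx
  rw [norm_mul]
  exact mul_le_mul_of_nonneg_right (hC x hx) (norm_nonneg _)

lemma IsLift.memH1Boundary {u : ℂ → ℝ} {G : ℂ → ℂ} {h : SideIndex n → ℝ → ℝ} {q : ℂ → ℝ}
    {r : ℂ × ℂ → ℝ} (hl : IsLift n b u G h q r) : MemH1Boundary n u := by
  obtain ⟨g, hg, hug⟩ := hl.cont
  exact ⟨g, hg, hug, fun i =>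
    ⟨_, (hl.deriv i).congr (ae_side_of_ae_arc hug i) (EventuallyEq.refl _ _)⟩⟩

lemma IsLift.mem_formDomain {u : L2 n} {G : ℂ → ℂ} {h : SideIndex n → ℝ → ℝ} {q : ℂ → ℝ}
    {r : ℂ × ℂ → ℝ} (hl : IsLift n b u G h q r) : u ∈ formDomain n :=
  ⟨⟨hl.memLp_domain, G, hl.grad⟩, hl.trace, hl.memH1Boundary⟩

/-- Every element of the form domain is covered by the graph. -/
lemma IsLift.exists_mem_formGraph (hb : ContinuousOn b (closure (domain n))) {u : L2 n} {G : ℂ → ℂ}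
    {h : SideIndex n → ℝ → ℝ} {q : ℂ → ℝ} {r : ℂ × ℂ → ℝ} (hl : IsLift n b u G h q r) :
    ∃ p ∈ formGraph n b, p.fst = u := by
  have hq : MemLp q 2 (arcMeasure n) :=
    (memLp_congr_ae hl.zeroth).2 (memLp_sqrt_mul hb hl.memLp_arc)
  have hr : MemLp r 2 ((arcMeasure n).prod (arcMeasure n)) :=
    (memLp_congr_ae hl.nonlocal).2 (memLp_quotient hl.memH1Boundary)
  refine ⟨WithLp.toLp 2 (u, WithLp.toLp 2 (hl.grad.1.toLp G,
    WithLp.toLp 2 (WithLp.toLp 2 fun i => (hl.deriv i).1.toLp (h i),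
      WithLp.toLp 2 (hq.toLp q, hr.toLp r)))), ?_, rfl⟩
  exact hl.congr (EventuallyEq.refl _ _) hl.grad.1.coeFn_toLp.symm
    (fun i => (hl.deriv i).1.coeFn_toLp.symm) hq.coeFn_toLp.symm hr.coeFn_toLp.symm

lemma exists_mem_formGraph_of_mem_formDomain (hb : ContinuousOn b (closure (domain n))) {u : L2 n}
    (hu : u ∈ formDomain n) : ∃ p ∈ formGraph n b, p.fst = u := by
  obtain ⟨⟨-, G, hG⟩, htr, g, hg, hug, hd⟩ := hu
  choose h hh using hd
  exact IsLift.exists_mem_formGraph hb (G := G) (h := h) (q := fun x => Real.sqrt (b x) * u x)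
    (r := quotient u)
    ⟨Lp.memLp u, hG, htr, ⟨g, hg, hug⟩, fun i => (hh i).congr (ae_side_of_ae_arc hug.symm i)
      (EventuallyEq.refl _ _), EventuallyEq.refl _ _, EventuallyEq.refl _ _⟩

lemma dense_formGraph (hb : ContinuousOn b (closure (domain n))) :
    Dense {u : L2 n | ∃ p ∈ formGraph n b, p.fst = u} := by
  refine (Lp.dense_hasCompactSupport_contDiff (p := 2) (F := ℝ) (μ := mMeasure n)
    ENNReal.ofNat_ne_top).mono ?_
  rintro u ⟨φ, hu, hc, hφ⟩
  exact IsLift.exists_mem_formGraph hb ((isLift_of_contDiff b hφ hc).congr hu.symm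
    (EventuallyEq.refl _ _) (fun _ => EventuallyEq.refl _ _) (EventuallyEq.refl _ _)
    (EventuallyEq.refl _ _))

lemma weakGrad_ae_eq {D : Set ℂ} (hD : IsOpen D) {u : ℂ → ℝ} {G : ℂ → ℂ} (h : IsWeakGrad D u G) :
    weakGrad D u =ᵐ[volume.restrict D] G := by
  have hex : ∃ G, IsWeakGrad D u G := ⟨G, h⟩
  rw [weakGrad, dif_pos hex]
  exact hex.choose_spec.ae_eq hD h

lemma tangDeriv_ae_eq {u : ℂ → ℝ} {i : SideIndex n} {h : ℝ → ℝ}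
    (hw : IsWeakDeriv (sideLength n) (u ∘ sideParam n i) h) :
    tangDeriv n u i =ᵐ[volume.restrict (Ioo 0 (sideLength n))] h := by
  have hex : ∃ h, IsWeakDeriv (sideLength n) (u ∘ sideParam n i) h := ⟨h, hw⟩
  rw [tangDeriv, dif_pos hex]
  exact hex.choose_spec.ae_eq hw

/-- The energy is the inner product of the corresponding points of the graph. -/
lemma energy_eq_inner (hb0 : ∀ x ∈ closure (domain n), 0 < b x)
    {p p' : WithLp 2 (L2 n × FormSpace n)} (hp : p ∈ formGraph n b) (hp' : p' ∈ formGraph n b) :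
    energy n b p.fst p'.fst = inner ℝ p.snd p'.snd := by
  rw [mem_formGraph] at hp hp'
  rw [WithLp.prod_inner_apply, WithLp.prod_inner_apply, WithLp.prod_inner_apply, PiLp.inner_apply,
    energy, add_assoc, add_assoc]
  refine congrArg₂ _ ?_ (congrArg₂ _ (Finset.sum_congr rfl fun i _ => ?_) (congrArg₂ _ ?_ ?_))
  · refine Eq.trans (integral_congr_ae ?_) (L2.inner_def _ _).symm
    filter_upwards [weakGrad_ae_eq (isOpen_domain n) hp.grad,
      weakGrad_ae_eq (isOpen_domain n) hp'.grad] with x h1 h2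
    rw [h1, h2]; rfl
  · refine Eq.trans (integral_congr_ae ?_) (L2.inner_def _ _).symm
    filter_upwards [tangDeriv_ae_eq (hp.deriv i), tangDeriv_ae_eq (hp'.deriv i)] with x h1 h2
    rw [h1, h2, mul_comm]; rfl
  · refine Eq.trans (integral_congr_ae ?_) (L2.inner_def _ _).symm
    filter_upwards [hp.zeroth, hp'.zeroth, ae_mem_snowflake n] with x h1 h2 hx
    -- The weight `b` is split as `√b · √b` between the two factors; this is where its nonnegativity
    -- on the curve is used.
    have hbx := Real.mul_self_sqrt (hb0 x (snowflake_subset_closure_domain n hx)).le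
    change _ = inner ℝ (p.snd.snd.snd.fst x) (p'.snd.snd.snd.fst x)
    rw [h1, h2]
    simp only [RCLike.inner_apply, conj_trivial]
    linear_combination -(p.fst x * p'.fst x) * hbx
  · refine Eq.trans (integral_congr_ae ?_) (L2.inner_def _ _).symm
    filter_upwards [hp.nonlocal, hp'.nonlocal] with x h1 h2
    change _ = inner ℝ (p.snd.snd.snd.snd x) (p'.snd.snd.snd.snd x)
    rw [h1, h2]
    simp only [RCLike.inner_apply, conj_trivial, quotient]
    rw [div_mul_div_comm, mul_comm, sq]

/-- Translates the variational definition of `A` into the weak equation on the graph, the form in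
which `exists_resolvent_of_closed` provides the resolvent. -/
lemma isImage_iff (hb : ContinuousOn b (closure (domain n)))
    (hb0 : ∀ x ∈ closure (domain n), 0 < b x) (u w : L2 n) :
    IsImage n b u w ↔ ∃ p ∈ formGraph n b, p.fst = u ∧
      ∀ q ∈ formGraph n b, inner ℝ p.snd q.snd = inner ℝ (-w) q.fst := by
  constructor
  · rintro ⟨hu, h⟩
    obtain ⟨p, hp, rfl⟩ := exists_mem_formGraph_of_mem_formDomain hb hu
    refine ⟨p, hp, rfl, fun q hq => ?_⟩
    rw [← energy_eq_inner hb0 hp hq]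
    exact h _ (IsLift.mem_formDomain (mem_formGraph.1 hq))
  · rintro ⟨p, hp, rfl, h⟩
    refine ⟨IsLift.mem_formDomain (mem_formGraph.1 hp), fun v hv => ?_⟩
    obtain ⟨q, hq, rfl⟩ := exists_mem_formGraph_of_mem_formDomain hb hv
    rw [energy_eq_inner hb0 hp hq]
    exact h q hq

/-- The operator `A` is self-adjoint and nonpositive. -/
theorem exists_isResolvent (hb : ContinuousOn b (closure (domain n)))
    (hb0 : ∀ x ∈ closure (domain n), 0 < b x) :
    ∃ R : L2 n →L[ℝ] L2 n, IsResolvent R ∧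
      ∀ u w, (u ∈ opDomain n b ∧ opA n b u = w) ↔ IsGen R u w := by
  obtain ⟨R, hR, hgen⟩ := exists_resolvent_of_closed (formGraph n b) isClosed_formGraph
    (dense_formGraph hb)
  have him : ∀ u w, IsImage n b u w ↔ IsGen R u w := fun u w =>
    (isImage_iff hb hb0 u w).trans (hgen u w).symm
  refine ⟨R, hR, fun u w => ⟨?_, fun h => ?_⟩⟩
  · rintro ⟨hu, rfl⟩
    have hex : ∃ w, IsImage n b u w := hu
    rw [opA, dif_pos hex]
    exact (him _ _).1 hex.choose_spec
  · have hex : ∃ w, IsImage n b u w := ⟨w, (him u w).2 h⟩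
    refine ⟨hex, ?_⟩
    rw [opA, dif_pos hex]
    exact hR.gen_unique ((him _ _).1 hex.choose_spec) h

/-- The existence result excludes the default value `0` in the definition by choice. -/
lemma isC0Semigroup_semigroup (hb : ContinuousOn b (closure (domain n)))
    (hb0 : ∀ x ∈ closure (domain n), 0 < b x) :
    IsC0SemigroupGeneratedBy (opDomain n b) (opA n b) (semigroup n b) := by
  obtain ⟨R, hR, hDA⟩ := exists_isResolvent hb hb0
  obtain ⟨S, B, hS⟩ := hR.exists_semigroup
  have hex : ∃ S, IsC0SemigroupGeneratedBy (opDomain n b) (opA n b) S := ⟨S, hS.isC0 hDA⟩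
  rw [semigroup, dif_pos hex]
  exact hex.choose_spec

end FormGraph

end KochVenttsel

theorem mainTheorem8 (T : ℝ) (hT : 0 < T) (α : ℝ≥0) (hα0 : 0 < α) (hα1 : α < 1) :
    ∃ C : ℝ, 0 < C ∧ ∀ (n : ℕ) (b : ℂ → ℝ),
      ContinuousOn b (closure (domain n)) → (∀ x ∈ closure (domain n), 0 < b x) →
      IsC0SemigroupGeneratedBy (opDomain n b) (opA n b) (semigroup n b) ∧
      ∀ (f : ℝ → L2 n) (u₀ : L2 n),
        (∃ M : ℝ≥0, HolderOnWith M α f (Icc 0 T)) → u₀ ∈ opDomain n b →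
        (∀ t ∈ Icc 0 T, IntervalIntegrable (fun τ => semigroup n b (t - τ) (f τ)) volume 0 t) ∧
        IsStrictSolution n b T f u₀ (mildSolution n b u₀ f) ∧
        (∀ v : ℝ → L2 n, IsStrictSolution n b T f u₀ v →
          EqOn v (mildSolution n b u₀ f) (Icc 0 T)) ∧
        c1Norm T (mildSolution n b u₀ f) + c0GraphNorm n b T (mildSolution n b u₀ f)
          ≤ C * (graphNorm n b u₀ + holderNorm T α f) := by
  have hα0' : (0 : ℝ) < α := NNReal.coe_pos.2 hα0
  -- The constant is fixed before `n` and `b` appear: it comes from `‖T_t‖ ≤ 1` and `‖A T_t‖ ≤ 1/t`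
  -- alone.
  refine ⟨2 * T + 5 + 2 * (T ^ (α : ℝ) / α), by positivity, fun n b hb hb0 => ?_⟩
  have hS := isC0Semigroup_semigroup hb hb0
  obtain ⟨R, hR, hDA⟩ := exists_isResolvent hb hb0
  refine ⟨hS, fun f u₀ hf hu₀ => ?_⟩
  obtain ⟨h1, h2, h3, h4, h5, h6, h7, h8⟩ := hR.strict_solution hDA hS hT hα0 hf hu₀
    (u := mildSolution n b u₀ f) fun _ => rfl
  exact ⟨h1, ⟨h2, h3, h4, h5, h6⟩,
    fun v hv => h7 v hv.contDiffOn hv.mem_domain hv.equation hv.initial, h8⟩
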